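/- Let $d\in\mathbb N$. Let $\mathcal P_2(\mathbb R^d)$ be the set of Borel probability measures on $\mathbb R^d$ with finite second moment, $W_p(\mu,\nu)=\big(\inf_{\pi}\iint|x-y|^p\,d\pi\big)^{1/p}$ ($p=1,2$; infimum over couplings), and $\mathbf W_2=(\mathcal P_2(\mathbb R^d),W_2)$. For $\phi:\mathcal P_2(\mathbb R^d)\to\mathbb R$: * The first variation $\frac{\delta\phi}{\delta\mu}(\rho,x)$ is the function that is jointly continuous on $\mathbf W_2\times\mathbb R^d$, has at most quadratic growth in $x$ for each $\rho$, satisfies $\lim_{\varepsilon\downarrow0}\varepsilon^{-1}\big(\phi((1-\varepsilon)\rho+\varepsilon\rho')-\phi(\rho)\big)=\int\frac{\delta\phi}{\delta\mu}(\rho,x)\,d(\rho'-\rho)(x)$ for all $\rho,\rho'$, and is normalised by $\int\frac{\delta\phi}{\delta\mu}(\rho,y)\,d\rho(y)=0$. * $\phi\in C^1(\mathbf W_2)$ if the first variation exists, is differentiable in $x$, and $\nabla_{\mathbf W}\phi(\rho,x)=\nabla_x\frac{\delta\phi}{\delta\mu}(\rho,x)$ is jointly continuous and of at most quadratic growth in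 $x$ for each $\rho$. * $\phi\in C^2(\mathbf W_2)$ if $\phi\in C^1(\mathbf W_2)$, every component of $\rho\mapsto\nabla_{\mathbf W}\phi(\rho,x)$ is in $C^1(\mathbf W_2)$ for every $x$, and $\nabla^2_{\mathbf W}\phi(\rho,x,x')=\nabla_{x'}\frac{\delta}{\delta\mu}\nabla_{\mathbf W}\phi(\rho,x,x')$ is jointly continuous on $\mathbf W_2\times\mathbb R^d\times\mathbb R^d$. * The lift over $\mu\in\mathcal P_2(\mathbb R^d)$ is $\phi^\#_\mu(\xi)=\phi(\xi_\#\mu)$ on the Hilbert space $\mathbb H_\mu=L^2(\mathbb R^d;\mu)$ of maps into $\mathbb R^d$. A function on a Hilbert space is $C^{1,1}$ if it is Fréchet differentiable with globally Lipschitz gradient, and $C^{1,1}_b$ if moreover it and its gradient are bounded. Let $f\in C^2_b(\mathbb R)$, $V,W\in C^2_b(\mathbb R^d)$, $\chi\in C^2_c(\mathbb R^d)$ (in $C^2_b$ the function and its derivatives up to order 2 are bounded), with $W,\chi$ even, and $$U(\rho)=\int f(\rho\star\chi)\,d\rho+\int V\,d\rho+\tfrac12\iint W(x-y)\,d\rho(x)\,d\rho(y),\qquad(\rho\star\chi)(x)=\int\chi(x-y)\,d\rho(y).$$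 **(A)** $U\in C^2(\mathbf W_2)$; $\nabla_{\mathbf W}U(\rho,x)$ is Lipschitz in $x$ uniformly in $\rho$; and $\nabla^2_{\mathbf W}U$ is bounded on $\mathcal P_2(\mathbb R^d)\times\mathbb R^d\times\mathbb R^d$. **(B)** If $\mu\in\mathcal P_2(\mathbb R^d)$ has no atoms, then $U^\#_\mu$ is $C^{1,1}$ on $\mathbb H_\mu$. Assume in addition that the second derivatives of $f,V,W,\chi$ are Lipschitz (i.e. $f,V,W\in C^{2,1}_b$, $\chi\in C^{2,1}_c$), let $\rho_0\in\mathcal P_2(\mathbb R^d)$ have no atoms, and put $\mathbb H=L^2(\mathbb R^d;\rho_0)$. **(C)** On every $W_2$-bounded set of measures $\rho$, $|\nabla_{\mathbf W}U(\rho,x)|\le C(1+|x|)$ and $|\frac{\delta U}{\delta\mu}(\rho,x)|\le C(1+|x|^2)$ with $C$ uniform in $\rho$; $\nabla_{\mathbf W}U(\rho,\cdot)$ is differentiable; and there is a $C$ such that for all $\rho,\mu,\nu\in\mathcal P_2(\mathbb R^d)$ and $x,y\in\mathbb R^d$ $$|\nabla_{\mathbf W}U(\rho,x)|+|\nabla_x\nabla_{\mathbf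 W}U(\rho,x)|+|\nabla^2_{\mathbf W}U(\rho,x,y)|\le C,$$ $\nabla_x\nabla_{\mathbf W}U(\rho,\cdot)$ and $\nabla^2_{\mathbf W}U(\rho,\cdot,\cdot)$ are Lipschitz with constant $C$, and $|\nabla^2_{\mathbf W}U(\mu,x,y)-\nabla^2_{\mathbf W}U(\nu,x,y)|\le C\,W_1(\mu,\nu)$. **(D)** $U^\#_{\rho_0}\in C^{1,1}_b$. Let $L$ be the optimal Lipschitz constant of $\nabla U^\#_{\rho_0}$. The problem $\dot X(t)=-\nabla U^\#_{\rho_0}(X(t))$ on $[0,\infty)$, $X(0)=\mathrm{Id}$, has a unique solution in $\mathbb H$; $\dot X$ is differentiable and $\|\dot X(t+h)-\dot X(t)-h\ddot X(t)\|_{\mathbb H}\le C|h|^2$ for all $t,t+h\ge0$. In particular $L_T:=\sup_{t\ne s\in[0,T]}\|\dot X(t)-\dot X(s)-(t-s)\ddot X(s)\|_{\mathbb H}/|t-s|^2$ is finite for every $T>0$. The measures $\rho_t=X(t)_\#\rho_0$ satisfy $\frac{d}{dt}\int\psi\,d\rho_t=-\int\langle\nabla\psi,\nabla_{\mathbf W}U(\rho_t,\cdot)\rangle\,d\rho_t$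 for all $\psi\in C^1_c(\mathbb R^d)$ and $t>0$, and $W_2(\rho_t,\rho_0)\to0$ as $t\downarrow0$. Finally, let $\tau>0$ with $\tau L\le1$. For every $Y_0\in\mathbb H$ there is exactly one sequence $(Y_n)$ in $\mathbb H$ starting at $Y_0$ with $$Y_{n+1}\in\operatorname*{arg\,min}_{\xi\in\mathbb H}\Big\{\tfrac12U^\#_{\rho_0}(\xi)+\tfrac12\langle\nabla U^\#_{\rho_0}(Y_n),\xi\rangle_{\mathbb H}+\tfrac1{2\tau}\|\xi-Y_n\|_{\mathbb H}^2\Big\}\quad(n\ge0),$$ and for all $T>0$ and $n$ with $n\tau\le T$, $$W_2\big(\rho_{n\tau},(Y_n)_\#\rho_0\big)\le\|X(n\tau)-Y_n\|_{\mathbb H}\le e^{2LT}\|Y_0-\mathrm{Id}\|_{\mathbb H}+2\,\frac{L_T}{L}\,\big(e^{2LT}-1\big)\,\tau^2,$$ where the last term is read as $0$ if $L=0$. -/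

import Mathlib

open MeasureTheory Filter Topology
open scoped NNReal ENNReal

/-- Euclidean space `ℝ^d`. -/
abbrev E (d : ℕ) : Type := EuclideanSpace ℝ (Fin d)

/-! ### Probability measures with finite second moment -/

/-- `𝒫₂(ℝ^d)`: Borel probability measures on `ℝ^d` with `∫ |x|² dμ < ∞`. -/
structure P2 (d : ℕ) where
  toMeasure : Measure (E d)
  isProb : IsProbabilityMeasure toMeasure
  memLp_id : MemLp (fun x : E d => x) 2 toMeasure

attribute [instance] P2.isProb

/-- The Hilbert space `L²(ℝ^d; μ)` of (classes of) maps `ℝ^d → ℝ^d`. -/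
abbrev L2Space {d : ℕ} (μ : P2 d) : Type := Lp (E d) 2 μ.toMeasure

/-- The identity map as an element of `L²(ℝ^d; μ)`. -/
noncomputable def idL2 {d : ℕ} (μ : P2 d) : L2Space μ := μ.memLp_id.toLp (fun x : E d => x)

/-- The push-forward `ξ_# μ ∈ 𝒫₂(ℝ^d)` for `ξ ∈ L²(ℝ^d; μ)`. -/
noncomputable def pushforward {d : ℕ} (μ : P2 d) (ξ : L2Space μ) : P2 d where
  toMeasure := μ.toMeasure.map ξ
  isProb := Measure.isProbabilityMeasure_map (Lp.aestronglyMeasurable ξ).aemeasurable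
  memLp_id := by
    rw [memLp_map_measure_iff (by fun_prop) (Lp.aestronglyMeasurable ξ).aemeasurable]
    exact Lp.memLp ξ

/-- The convex combination `(1 - t) μ + t ν`, `t ∈ [0,1]`. -/
noncomputable def mix {d : ℕ} (μ ν : P2 d) (t : unitInterval) : P2 d where
  toMeasure := ENNReal.ofReal (1 - (t : ℝ)) • μ.toMeasure + ENNReal.ofReal (t : ℝ) • ν.toMeasure
  isProb := ⟨by
    simp only [Measure.coe_add, Measure.coe_smul, Pi.add_apply, Pi.smul_apply, measure_univ,
      smul_eq_mul, mul_one]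
    rw [← ENNReal.ofReal_add (by linarith [t.2.2]) t.2.1]
    simp⟩
  memLp_id := by
    have h1 := μ.memLp_id.smul_measure (c := ENNReal.ofReal (1 - (t : ℝ))) ENNReal.ofReal_ne_top
    have h2 := ν.memLp_id.smul_measure (c := ENNReal.ofReal (t : ℝ)) ENNReal.ofReal_ne_top
    refine (memLp_two_iff_integrable_sq_norm (by fun_prop)).2 (Integrable.add_measure ?_ ?_)
    · exact (memLp_two_iff_integrable_sq_norm h1.1).1 h1
    · exact (memLp_two_iff_integrable_sq_norm h2.1).1 h2

/-- `μ` has no atoms. -/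
def IsAtomless {d : ℕ} (μ : P2 d) : Prop := ∀ x, μ.toMeasure {x} = 0

/-! ### Wasserstein distances -/

/-- The set `Π[μ, ν]` of couplings of `μ` and `ν`. -/
def couplings {d : ℕ} (μ ν : P2 d) : Set (Measure (E d × E d)) :=
  {π | π.map Prod.fst = μ.toMeasure ∧ π.map Prod.snd = ν.toMeasure}

/-- The Wasserstein distance `W_p(μ, ν) = (inf_π ∬ |x - y|^p dπ)^{1/p}` (finite for `1 ≤ p ≤ 2`
on `𝒫₂(ℝ^d)`; it is used for `p = 1` and `p = 2` only). -/
noncomputable def wass {d : ℕ} (p : ℝ) (μ ν : P2 d) : ℝ :=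
  ((⨅ π ∈ couplings μ ν, ∫⁻ z, edist z.1 z.2 ^ p ∂π) ^ (1 / p)).toReal

/-- The neighbourhood filter of `μ` in the metric space `(𝒫₂(ℝ^d), W₂)`. -/
noncomputable def nhdsW2 {d : ℕ} (μ : P2 d) : Filter (P2 d) :=
  comap (fun ν => wass 2 ν μ) (𝓝 0)

/-- Joint continuity of a function on `𝐖₂(ℝ^d) × Y`. -/
def JointContinuous {d : ℕ} {Y Z : Type*} [TopologicalSpace Y] [TopologicalSpace Z]
    (h : P2 d → Y → Z) : Prop :=
  ∀ μ y, Tendsto (fun p : P2 d × Y => h p.1 p.2) (nhdsW2 μ ×ˢ 𝓝 y) (𝓝 (h μ y))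

/-- Boundedness of a subset of `(𝒫₂(ℝ^d), W₂)`. -/
def IsBoundedW2 {d : ℕ} (S : Set (P2 d)) : Prop :=
  ∃ R : ℝ, ∀ μ ∈ S, ∀ ν ∈ S, wass 2 μ ν ≤ R

/-! ### Derivatives on Wasserstein space -/

/-- `h = δφ/δμ` is the (normalised) first variation of `φ : 𝒫₂(ℝ^d) → ℝ`.
The normalisation makes `h` unique. -/
structure IsFirstVariation {d : ℕ} (φ : P2 d → ℝ) (h : P2 d → E d → ℝ) : Prop where
  cont : JointContinuous h
  growth : ∀ ν, ∃ C : ℝ, ∀ x, |h ν x| ≤ C * (1 + ‖x‖ ^ 2)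
  limit : ∀ ρ ρ' : P2 d,
    Tendsto (fun t : unitInterval => (φ (mix ρ ρ' t) - φ ρ) / (t : ℝ)) (𝓝[≠] 0)
      (𝓝 ((∫ x, h ρ x ∂ρ'.toMeasure) - ∫ x, h ρ x ∂ρ.toMeasure))
  normalized : ∀ ρ : P2 d, ∫ x, h ρ x ∂ρ.toMeasure = 0

/-- `φ ∈ C¹(𝐖₂(ℝ^d); ℝ)` with first variation `h` and Wasserstein gradient
`G = ∇_𝐖 φ = ∇_x δφ/δμ`. -/
structure IsWassersteinC1 {d : ℕ} (φ : P2 d → ℝ) (h : P2 d → E d → ℝ)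
    (G : P2 d → E d → E d) : Prop where
  firstVariation : IsFirstVariation φ h
  hasGradient : ∀ ρ x, HasGradientAt (h ρ) (G ρ x) x
  cont : JointContinuous G
  growth : ∀ ρ, ∃ C : ℝ, ∀ y, ‖G ρ y‖ ≤ C * (1 + ‖y‖ ^ 2)

/-- `φ ∈ C²(𝐖₂(ℝ^d); ℝ)` with first variation `h`, Wasserstein gradient `G = ∇_𝐖 φ`,
first variation `K(ρ, x, ·)` of `ρ ↦ G(ρ, x)` (componentwise), and Wasserstein Hessian
`H = ∇²_𝐖 φ`. The value `H ρ x x'` is the linear map of the matrix whose `i`-th row is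
`∇_{x'} (δ/δμ) G_i(ρ, x, x')`; the vector `(H ρ x x')ᵀ e_i` is this row. -/
structure IsWassersteinC2 {d : ℕ} (φ : P2 d → ℝ) (h : P2 d → E d → ℝ)
    (G : P2 d → E d → E d) (K : P2 d → E d → E d → E d)
    (H : P2 d → E d → E d → (E d →L[ℝ] E d)) : Prop where
  c1 : IsWassersteinC1 φ h G
  c1_gradient : ∀ (x : E d) (i : Fin d),
    IsWassersteinC1 (fun ρ => G ρ x i) (fun ρ x' => K ρ x x' i)
      (fun ρ x' => ContinuousLinearMap.adjoint (H ρ x x') (EuclideanSpace.single i 1))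
  cont_hessian : JointContinuous (fun ρ (p : E d × E d) => H ρ p.1 p.2)

/-! ### The lift and Hölder classes -/

/-- The lift `φ^#_μ(ξ) = φ(ξ_# μ)` on `L²(ℝ^d; μ)`. -/
noncomputable def liftFun {d : ℕ} (φ : P2 d → ℝ) (μ : P2 d) (ξ : L2Space μ) : ℝ := φ (pushforward μ ξ)

/-- The class `C^{1,α}(X; X)` of real functions on a Hilbert space `X`. -/
def IsC1Holder {X : Type*} [NormedAddCommGroup X] [InnerProductSpace ℝ X] [CompleteSpace X]
    (α : ℝ) (u : X → ℝ) : Prop :=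
  Differentiable ℝ u ∧
    ∃ C > 0, ∀ x y, ‖gradient u x - gradient u y‖ ≤ C * ‖x - y‖ ^ α

/-- The class `C^{1,α}_b(X; X)`. -/
def IsC1HolderBdd {X : Type*} [NormedAddCommGroup X] [InnerProductSpace ℝ X] [CompleteSpace X]
    (α : ℝ) (u : X → ℝ) : Prop :=
  IsC1Holder α u ∧ ∃ C, ∀ x, |u x| + ‖gradient u x‖ ≤ C

/-- `u ∈ C^{1,α}(I; X)` on a time interval `I`, with derivative `u'`. -/
def IsC1HolderCurve {X : Type*} [NormedAddCommGroup X] [NormedSpace ℝ X]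
    (α : ℝ) (I : Set ℝ) (u u' : ℝ → X) : Prop :=
  (∀ t ∈ I, HasDerivWithinAt u (u' t) I t) ∧
    ∃ C > 0, ∀ t h : ℝ, t ∈ I → t + h ∈ I →
      ‖u (t + h) - u t - h • u' t‖ ≤ C * |h| ^ (1 + α)

/-! ### Regularity classes of the data -/

/-- `g ∈ C²_b`: twice continuously differentiable with `g`, `Dg`, `D²g` bounded. -/
def IsCb2 {F : Type*} [NormedAddCommGroup F] [NormedSpace ℝ F] (g : F → ℝ) : Prop :=
  ContDiff ℝ 2 g ∧ ∀ k ≤ 2, ∃ C : ℝ, ∀ x, ‖iteratedFDeriv ℝ k g x‖ ≤ C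

/-- The second derivative of `g` is Lipschitz; together with `C²_b` (or `C²_c`) this is
`C^{2,1}_b` (or `C^{2,1}_c`). -/
def HasLipschitzSecondDeriv {F : Type*} [NormedAddCommGroup F] [NormedSpace ℝ F]
    (g : F → ℝ) : Prop :=
  ∃ L : ℝ≥0, LipschitzWith L (iteratedFDeriv ℝ 2 g)

/-! ### The model functional -/

/-- The convolution `(ρ ⋆ χ)(x) = ∫ χ(x - y) dρ(y)`. -/
noncomputable def convolve {d : ℕ} (ρ : P2 d) (χ : E d → ℝ) (x : E d) : ℝ :=
  ∫ y, χ (x - y) ∂ρ.toMeasure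

/-- `U(ρ) = ∫ f(ρ ⋆ χ) dρ + ∫ V dρ + ½ ∬ W(x - y) dρ(x) dρ(y)`. -/
noncomputable def modelU {d : ℕ} (f : ℝ → ℝ) (V W χ : E d → ℝ) (ρ : P2 d) : ℝ :=
  (∫ x, f (convolve ρ χ x) ∂ρ.toMeasure) + (∫ x, V x ∂ρ.toMeasure) +
    (1 / 2) * ∫ x, (∫ y, W (x - y) ∂ρ.toMeasure) ∂ρ.toMeasure

/-! ### Sufficient conditions for a smooth velocity -/

/-- The sufficient conditions, with Hölder exponent `α`, for the Lagrangian velocity of `φ` started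
at `ρ₀` to be `C^{1,α}` in time. Here `h`, `G`, `H` are the first variation, the
Wasserstein gradient and the Wasserstein Hessian of `φ`, and `∇_x G` is `fderiv ℝ (G ρ)`. -/
structure VelocityConditions {d : ℕ} (φ : P2 d → ℝ) (h : P2 d → E d → ℝ)
    (G : P2 d → E d → E d) (K : P2 d → E d → E d → E d)
    (H : P2 d → E d → E d → (E d →L[ℝ] E d)) (ρ₀ : P2 d) (α : ℝ≥0) : Prop where
  atomless : IsAtomless ρ₀
  c2 : IsWassersteinC2 φ h G K H
  lift_c11 : IsC1Holder 1 (liftFun φ ρ₀)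
  gradient_growth : ∀ S : Set (P2 d), IsBoundedW2 S →
    ∃ C : ℝ, ∀ ρ ∈ S, ∀ x, ‖G ρ x‖ ≤ C * (1 + ‖x‖)
  variation_growth : ∀ S : Set (P2 d), IsBoundedW2 S →
    ∃ C : ℝ, ∀ ρ ∈ S, ∀ x, |h ρ x| ≤ C * (1 + ‖x‖ ^ 2)
  gradient_differentiable : ∀ ρ, Differentiable ℝ (G ρ)
  bounds : ∃ C : ℝ≥0,
    (∀ ρ x y, ‖G ρ x‖ + ‖fderiv ℝ (G ρ) x‖ + ‖H ρ x y‖ ≤ C) ∧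
    (∀ ρ, HolderWith C α (fun x => fderiv ℝ (G ρ) x)) ∧
    (∀ ρ, HolderWith C α (fun p : E d × E d => H ρ p.1 p.2)) ∧
    (∀ μ ν x y, ‖H μ x y - H ν x y‖ ≤ C * wass 1 μ ν ^ (α : ℝ))

/-! ### Lagrangian flow, trapezoidal scheme, continuity equation -/

/-- `X : [0,∞) → L²(ℝ^d; ρ₀)` solves `Ẋ(t) = -∇φ^#_{ρ₀}(X(t))`, `X(0) = Id`
(values at negative times are irrelevant). -/
def IsLagrangianFlow {d : ℕ} (φ : P2 d → ℝ) (ρ₀ : P2 d) (X : ℝ → L2Space ρ₀) : Prop :=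
  X 0 = idL2 ρ₀ ∧
    ∀ t, 0 ≤ t → HasDerivWithinAt X (-gradient (liftFun φ ρ₀) (X t)) (Set.Ici 0) t

/-- The Lagrangian trapezoidal scheme with time step `τ`: each `Y (n+1)` minimises
`½ Φ(ξ) + ½ ⟨∇Φ(Y n), ξ⟩ + (1/2τ) ‖ξ - Y n‖²` over the Hilbert space, `Φ` being the lift. -/
def IsTrapezoidalScheme {d : ℕ} (φ : P2 d → ℝ) (ρ₀ : P2 d) (τ : ℝ)
    (Y : ℕ → L2Space ρ₀) : Prop :=
  ∀ n, IsMinOn (fun ξ : L2Space ρ₀ =>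
    (1 / 2) * liftFun φ ρ₀ ξ + (1 / 2) * inner ℝ (gradient (liftFun φ ρ₀) (Y n)) ξ +
      (1 / (2 * τ)) * ‖ξ - Y n‖ ^ 2) Set.univ (Y (n + 1))

/-- The difference quotients of `∇φ^#_{ρ₀}`. -/
def gradientQuotients {d : ℕ} (φ : P2 d → ℝ) (ρ₀ : P2 d) : Set ℝ :=
  {r | ∃ ξ₁ ξ₂ : L2Space ρ₀, ξ₁ ≠ ξ₂ ∧
    r = ‖gradient (liftFun φ ρ₀) ξ₁ - gradient (liftFun φ ρ₀) ξ₂‖ / ‖ξ₁ - ξ₂‖}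

/-- `L(φ)`, the optimal Lipschitz constant of `∇φ^#_{ρ₀}`. -/
noncomputable def gradientLip {d : ℕ} (φ : P2 d → ℝ) (ρ₀ : P2 d) : ℝ :=
  sSup (gradientQuotients φ ρ₀)

/-- The Taylor quotients `‖u(t) - u(s) - (t-s) u'(s)‖ / |t-s|^{1+α}`, `s ≠ t` in `[0,T]`. -/
def taylorQuotients {X : Type*} [NormedAddCommGroup X] [NormedSpace ℝ X]
    (α T : ℝ) (u u' : ℝ → X) : Set ℝ :=
  {r | ∃ t ∈ Set.Icc 0 T, ∃ s ∈ Set.Icc 0 T, t ≠ s ∧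
    r = ‖u t - u s - (t - s) • u' s‖ / |t - s| ^ (1 + α)}

/-- The optimal first-order Taylor constant of `u` on `[0,T]`. -/
noncomputable def taylorConst {X : Type*} [NormedAddCommGroup X] [NormedSpace ℝ X]
    (α T : ℝ) (u u' : ℝ → X) : ℝ :=
  sSup (taylorQuotients α T u u')

/-- `ρ` is a weak solution of `∂_t ρ - ∇·(ρ G(ρ, x)) = 0` on `(0,∞) × ℝ^d` with
initial datum `ρ₀`, attained in `W₂`. -/
structure IsWeakSolution {d : ℕ} (G : P2 d → E d → E d) (ρ₀ : P2 d) (ρ : ℝ → P2 d) : Prop where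
  equation : ∀ ψ : E d → ℝ, ContDiff ℝ 1 ψ → HasCompactSupport ψ → ∀ t > 0,
    HasDerivAt (fun s => ∫ x, ψ x ∂(ρ s).toMeasure)
      (-∫ x, inner ℝ (gradient ψ x) (G (ρ t) x) ∂(ρ t).toMeasure) t
  initial : Tendsto (fun t => wass 2 (ρ t) ρ₀) (𝓝[>] 0) (𝓝 0)

/-! ### Couplings and Wasserstein distances -/

/-! Each of the three terms of `U` has the form `∫ f(∫ k(x,y) dρ(y)) dρ(x)` with a symmetric `C²`
kernel `k`, so one computation covers them all (`isRegularFunctional_kernelFunctional`). Averages of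
kernels are affine along a segment `(1-t)ρ + tρ'`, hence linear derivatives reduce to calculus in
the real variable `t`. The first variation, gradient and Hessian become explicit expressions in
averages of `k` and its derivatives. A bounded Lipschitz kernel has averages that are bounded and
Lipschitz in `x` and in `ρ` with respect to `W₁`. Only `f''` and the second derivatives of `k` may
fail to be Lipschitz; the proposition `s` records whether they are, so that `C²` and `C^{2,1}` data
are treated together.

The passage to `L²(μ)` rests on `HasLinearDerivative.norm_sub_sub_integral_le`. Between `ξ_#μ` and
`ξ'_#μ` the functional is followed along the segment of measures, and the coupling induced by `(ξ,
ξ')` turns the difference of two integrals into a Taylor expansion in `x`. This gives `∇φ^#(ξ) =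
G(ξ_#μ, ξ(·))` with a quadratic remainder. The field is bounded, and Lipschitz because `W₁ ≤ W₂ ≤ ‖ξ
- ξ'‖`, so its flow is global and unique.

The delicate point is the time derivative of the velocity. The map `ξ ↦ G(ξ_#μ, ξ(·))` need not be
Fréchet differentiable on `L²`: its pointwise remainder is of order `|ξ' - ξ|²`, and the `L²` norm
of that is not controlled by `‖ξ' - ξ‖²`. Along the flow, however, the velocity is bounded
pointwise, so increments over a time `e` are `O(|e|)` in `L^∞` (`ae_norm_sub_le_of_hasDerivAt`), and
the remainder is then `O(e²)` in `L²` (`IsRegularFunctional.exists_norm_lagrangianField_sub_le`).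

The scheme is a Hilbert space matter. For `τL ≤ 1` the minimisers are exactly the solutions of the
implicit trapezoidal equation, which is a contraction; a local error `O(τ³)` and a discrete Gronwall
argument give `O(τ²)`. -/

theorem isProbabilityMeasure_of_mem_couplings {d : ℕ} {μ ν : P2 d} {π : Measure (E d × E d)}
    (hπ : π ∈ couplings μ ν) : IsProbabilityMeasure π := by
  have h : IsProbabilityMeasure (π.map Prod.fst) := by rw [hπ.1]; infer_instance
  exact Measure.isProbabilityMeasure_of_map Prod.fst

theorem memLp_sub_of_mem_couplings {d : ℕ} {μ ν : P2 d} {π : Measure (E d × E d)}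
    (hπ : π ∈ couplings μ ν) : MemLp (fun z : E d × E d => z.1 - z.2) 2 π := by
  have h1 : MemLp (fun z : E d × E d => z.1) 2 π := by
    have := μ.memLp_id
    rw [← hπ.1, memLp_map_measure_iff (by fun_prop) (by fun_prop)] at this
    exact this
  have h2 : MemLp (fun z : E d × E d => z.2) 2 π := by
    have := ν.memLp_id
    rw [← hπ.2, memLp_map_measure_iff (by fun_prop) (by fun_prop)] at this
    exact this
  exact h1.sub h2

theorem integrable_sub_of_mem_couplings {d : ℕ} {μ ν : P2 d} {π : Measure (E d × E d)}
    (hπ : π ∈ couplings μ ν) : Integrable (fun z : E d × E d => z.1 - z.2) π := by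
  have := isProbabilityMeasure_of_mem_couplings hπ
  exact (memLp_sub_of_mem_couplings hπ).integrable (by norm_num)

theorem prod_mem_couplings {d : ℕ} (μ ν : P2 d) :
    μ.toMeasure.prod ν.toMeasure ∈ couplings μ ν := by
  constructor <;> simp [Measure.map_fst_prod, Measure.map_snd_prod]

theorem wass_nonneg {d : ℕ} (p : ℝ) (μ ν : P2 d) : 0 ≤ wass p μ ν := ENNReal.toReal_nonneg

theorem lintegral_edist_eq {d : ℕ} {μ ν : P2 d} {π : Measure (E d × E d)}
    (hπ : π ∈ couplings μ ν) :
    ∫⁻ z, edist z.1 z.2 ^ (1 : ℝ) ∂π = ENNReal.ofReal (∫ z, ‖z.1 - z.2‖ ∂π) := by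
  rw [ofReal_integral_norm_eq_lintegral_enorm (integrable_sub_of_mem_couplings hπ)]
  simp [edist_eq_enorm_sub]

theorem wass_one_le {d : ℕ} {μ ν : P2 d} {π : Measure (E d × E d)} (hπ : π ∈ couplings μ ν) :
    wass 1 μ ν ≤ ∫ z, ‖z.1 - z.2‖ ∂π := by
  refine ENNReal.toReal_le_of_le_ofReal (integral_nonneg fun z => norm_nonneg _) ?_
  rw [div_one, ENNReal.rpow_one]
  exact (iInf₂_le π hπ).trans (lintegral_edist_eq hπ).le

theorem exists_coupling_le {d : ℕ} (μ ν : P2 d) {δ : ℝ} (hδ : 0 < δ) :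
    ∃ π ∈ couplings μ ν, ∫ z, ‖z.1 - z.2‖ ∂π ≤ wass 1 μ ν + δ := by
  by_contra! hc
  -- Since `toReal` sends `∞` to `0`, the infimum has to be known finite; the product coupling shows
  -- it.
  have hfin : (⨅ π ∈ couplings μ ν, ∫⁻ z, edist z.1 z.2 ^ (1 : ℝ) ∂π) ≠ ∞ := by
    refine ne_top_of_le_ne_top ?_ (iInf₂_le _ (prod_mem_couplings μ ν))
    rw [lintegral_edist_eq (prod_mem_couplings μ ν)]
    exact ENNReal.ofReal_ne_top
  have h : ENNReal.ofReal (wass 1 μ ν + δ) ≤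
      ⨅ π ∈ couplings μ ν, ∫⁻ z, edist z.1 z.2 ^ (1 : ℝ) ∂π := by
    refine le_iInf₂ fun π hπ => ?_
    rw [lintegral_edist_eq hπ]
    exact ENNReal.ofReal_le_ofReal (hc π hπ).le
  have h' := ENNReal.toReal_mono hfin h
  rw [ENNReal.toReal_ofReal (by linarith [wass_nonneg 1 μ ν])] at h'
  have : wass 1 μ ν = (⨅ π ∈ couplings μ ν, ∫⁻ z, edist z.1 z.2 ^ (1 : ℝ) ∂π).toReal := by
    simp [wass]
  linarith

theorem wass_two_le {d : ℕ} {μ ν : P2 d} {π : Measure (E d × E d)} (hπ : π ∈ couplings μ ν) :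
    wass 2 μ ν ≤ (eLpNorm (fun z : E d × E d => z.1 - z.2) 2 π).toReal := by
  refine ENNReal.toReal_mono (memLp_sub_of_mem_couplings hπ).eLpNorm_ne_top ?_
  rw [eLpNorm_eq_lintegral_rpow_enorm_toReal (by norm_num) (by norm_num)]
  simp only [ENNReal.toReal_ofNat]
  refine ENNReal.rpow_le_rpow ((iInf₂_le π hπ).trans (le_of_eq ?_)) (by norm_num)
  simp [edist_eq_enorm_sub]

theorem wass_one_le_wass_two {d : ℕ} (μ ν : P2 d) : wass 1 μ ν ≤ wass 2 μ ν := by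
  refine ENNReal.toReal_mono ?_ ?_
  · refine ENNReal.rpow_ne_top_of_nonneg (by norm_num)
      (ne_top_of_le_ne_top ?_ (iInf₂_le _ (prod_mem_couplings μ ν)))
    have := (memLp_sub_of_mem_couplings (prod_mem_couplings μ ν)).eLpNorm_lt_top
    rw [eLpNorm_lt_top_iff_lintegral_rpow_enorm_lt_top (by norm_num) (by norm_num)] at this
    simpa [edist_eq_enorm_sub] using this.ne
  · rw [div_one, ENNReal.rpow_one, one_div, ENNReal.le_rpow_inv_iff (by norm_num)]
    refine le_iInf₂ fun π hπ => ?_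
    have := isProbabilityMeasure_of_mem_couplings hπ
    rw [← ENNReal.le_rpow_inv_iff (by norm_num)]
    refine (iInf₂_le π hπ).trans ?_
    have h := eLpNorm_le_eLpNorm_of_exponent_le (μ := π) (p := 1) (q := 2) (by norm_num)
      (memLp_sub_of_mem_couplings hπ).1
    rw [eLpNorm_one_eq_lintegral_enorm,
      eLpNorm_eq_lintegral_rpow_enorm_toReal (by norm_num) (by norm_num)] at h
    simpa [edist_eq_enorm_sub] using h

/-- Two maps over the same base measure provide a coupling for free. This makes the push-forward a
1-Lipschitz map from `L²(μ)` into Wasserstein space. -/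
theorem map_pair_mem_couplings {d : ℕ} {μ : P2 d} (ξ η : L2Space μ) :
    μ.toMeasure.map (fun x => (ξ x, η x)) ∈ couplings (pushforward μ ξ) (pushforward μ η) := by
  have h1 := (Lp.aestronglyMeasurable ξ).aemeasurable
  have h2 := (Lp.aestronglyMeasurable η).aemeasurable
  constructor
  · rw [AEMeasurable.map_map_of_aemeasurable (by fun_prop) (h1.prodMk h2)]; rfl
  · rw [AEMeasurable.map_map_of_aemeasurable (by fun_prop) (h1.prodMk h2)]; rfl

theorem wass_two_pushforward_le {d : ℕ} {μ : P2 d} (ξ η : L2Space μ) :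
    wass 2 (pushforward μ ξ) (pushforward μ η) ≤ ‖ξ - η‖ := by
  refine (wass_two_le (map_pair_mem_couplings ξ η)).trans (le_of_eq ?_)
  have h1 := (Lp.aestronglyMeasurable ξ).aemeasurable
  have h2 := (Lp.aestronglyMeasurable η).aemeasurable
  rw [Lp.norm_def, eLpNorm_map_measure (by fun_prop) (h1.prodMk h2)]
  congr 1
  exact eLpNorm_congr_ae (Lp.coeFn_sub ξ η).symm

theorem wass_one_pushforward_le {d : ℕ} {μ : P2 d} (ξ η : L2Space μ) :
    wass 1 (pushforward μ ξ) (pushforward μ η) ≤ ‖ξ - η‖ :=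
  (wass_one_le_wass_two _ _).trans (wass_two_pushforward_le ξ η)

theorem map_diag_mem_couplings {d : ℕ} (μ : P2 d) :
    μ.toMeasure.map (fun x => (x, x)) ∈ couplings μ μ := by
  constructor
  · rw [Measure.map_map (by fun_prop) (by fun_prop)]; exact Measure.map_id
  · rw [Measure.map_map (by fun_prop) (by fun_prop)]; exact Measure.map_id

theorem wass_one_self {d : ℕ} (μ : P2 d) : wass 1 μ μ = 0 := by
  refine le_antisymm ((wass_one_le (map_diag_mem_couplings μ)).trans (le_of_eq ?_))
    (wass_nonneg _ _ _)
  rw [integral_map (by fun_prop) (by fun_prop)]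
  simp

theorem integral_mix {d : ℕ} {Z : Type*} [NormedAddCommGroup Z] [NormedSpace ℝ Z] (μ ν : P2 d)
    (t : unitInterval) {F : E d → Z} (h1 : Integrable F μ.toMeasure)
    (h2 : Integrable F ν.toMeasure) :
    ∫ x, F x ∂(mix μ ν t).toMeasure =
      (1 - (t : ℝ)) • ∫ x, F x ∂μ.toMeasure + (t : ℝ) • ∫ x, F x ∂ν.toMeasure := by
  rw [mix, integral_add_measure (h1.smul_measure ENNReal.ofReal_ne_top)
    (h2.smul_measure ENNReal.ofReal_ne_top), integral_smul_measure, integral_smul_measure,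
    ENNReal.toReal_ofReal (by linarith [t.2.2]), ENNReal.toReal_ofReal t.2.1]

/-- The portion `(1-t)μ` stays in place and only the portion `tν` is transported, at cost at most
`t` times that of a coupling of `ν` and `μ`. -/
theorem wass_one_mix_le {d : ℕ} (μ ν : P2 d) (t : unitInterval) :
    wass 1 (mix μ ν t) μ ≤ wass 1 ν μ := by
  refine le_of_forall_pos_le_add fun δ hδ => ?_
  obtain ⟨π, hπ, hle⟩ := exists_coupling_le ν μ hδ
  refine le_trans ?_ hle
  have hD := map_diag_mem_couplings μ
  set D := μ.toMeasure.map (fun x => (x, x)) with hDdef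
  have hc : ENNReal.ofReal (1 - (t : ℝ)) • D + ENNReal.ofReal (t : ℝ) • π ∈
      couplings (mix μ ν t) μ := by
    constructor
    · rw [Measure.map_add _ _ measurable_fst, Measure.map_smul, Measure.map_smul, hD.1, hπ.1, mix]
    · rw [Measure.map_add _ _ measurable_snd, Measure.map_smul, Measure.map_smul, hD.2, hπ.2,
        ← add_smul, ← ENNReal.ofReal_add (by linarith [t.2.2]) t.2.1]
      simp
  have i1 := (integrable_sub_of_mem_couplings hD).norm
  have i2 := (integrable_sub_of_mem_couplings hπ).norm
  refine (wass_one_le hc).trans ?_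
  rw [integral_add_measure (i1.smul_measure ENNReal.ofReal_ne_top)
    (i2.smul_measure ENNReal.ofReal_ne_top), integral_smul_measure, integral_smul_measure,
    ENNReal.toReal_ofReal (by linarith [t.2.2]), ENNReal.toReal_ofReal t.2.1, hDdef,
    integral_map (by fun_prop) (by fun_prop)]
  simp only [sub_self, norm_zero, integral_zero, mul_zero, zero_add, smul_eq_mul]
  exact mul_le_of_le_one_left (integral_nonneg fun z : E d × E d => norm_nonneg (z.1 - z.2)) t.2.2

/-- Integrals of nearly Lipschitz functions are controlled by `W₁`. -/
theorem norm_integral_sub_integral_le {d : ℕ} {Z : Type*} [NormedAddCommGroup Z] [NormedSpace ℝ Z]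
    {μ ν : P2 d} {A B : E d → Z} (hA : Integrable A μ.toMeasure) (hB : Integrable B ν.toMeasure)
    {ε L : ℝ} (hL : 0 ≤ L) (h : ∀ z z', ‖A z - B z'‖ ≤ ε + L * ‖z - z'‖) :
    ‖∫ x, A x ∂μ.toMeasure - ∫ x, B x ∂ν.toMeasure‖ ≤ ε + L * wass 1 μ ν := by
  refine le_of_forall_pos_le_add fun δ hδ => ?_
  -- The denominator `L + 1` keeps `L * (δ / (L + 1)) ≤ δ` valid also for `L = 0`.
  obtain ⟨π, hπ, hle⟩ := exists_coupling_le μ ν (δ := δ / (L + 1)) (by positivity)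
  have := isProbabilityMeasure_of_mem_couplings hπ
  have hA' := hA
  have hB' := hB
  rw [← hπ.1] at hA'
  rw [← hπ.2] at hB'
  have iA : Integrable (fun z : E d × E d => A z.1) π := hA'.comp_measurable measurable_fst
  have iB : Integrable (fun z : E d × E d => B z.2) π := hB'.comp_measurable measurable_snd
  have eA : ∫ x, A x ∂μ.toMeasure = ∫ z, A z.1 ∂π := by
    rw [← hπ.1, integral_map (by fun_prop) hA'.1]
  have eB : ∫ x, B x ∂ν.toMeasure = ∫ z, B z.2 ∂π := by
    rw [← hπ.2, integral_map (by fun_prop) hB'.1]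
  have iD := (integrable_sub_of_mem_couplings hπ).norm
  rw [eA, eB, ← integral_sub iA iB]
  calc ‖∫ z, (A z.1 - B z.2) ∂π‖ ≤ ∫ z, (ε + L * ‖z.1 - z.2‖) ∂π :=
        norm_integral_le_of_norm_le ((integrable_const ε).add (iD.const_mul L))
          (Eventually.of_forall fun z => h z.1 z.2)
    _ = ε + L * ∫ z, ‖z.1 - z.2‖ ∂π := by
        rw [integral_add (integrable_const ε) (iD.const_mul L), integral_const_mul]; simp
    _ ≤ ε + L * (wass 1 μ ν + δ / (L + 1)) := by gcongr
    _ ≤ ε + L * wass 1 μ ν + δ := by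
        have : L * (δ / (L + 1)) ≤ δ := by
          rw [mul_div_assoc', div_le_iff₀ (by linarith)]; nlinarith
        linarith

/-! ### Bounded, almost Lipschitz functions of a measure and a parameter -/

/-- `Φ` is bounded and uniformly continuous with respect to `W₁` and the parameter, in the form
`‖Φ ρ y - Φ ρ' y'‖ ≤ ε + L (W₁(ρ, ρ') + |y - y'|)` for every `ε > 0` with `L` depending on `ε`;
if `s` holds then also for `ε = 0`, that is, `Φ` is Lipschitz. -/
def AlmostLipschitz (s : Prop) {d : ℕ} {Y Z : Type*} [PseudoMetricSpace Y] [NormedAddCommGroup Z]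
    (Φ : P2 d → Y → Z) : Prop :=
  (∃ C ≥ 0, ∀ ρ y, ‖Φ ρ y‖ ≤ C) ∧ ∀ ε ≥ 0, (0 < ε ∨ s) → ∃ L ≥ 0, ∀ ρ ρ' y y',
    ‖Φ ρ y - Φ ρ' y'‖ ≤ ε + L * (wass 1 ρ ρ' + dist y y')

namespace AlmostLipschitz

variable {s : Prop} {d : ℕ} {Y Y' Z Z₁ Z₂ : Type*} [PseudoMetricSpace Y] [PseudoMetricSpace Y']
  [NormedAddCommGroup Z] [NormedAddCommGroup Z₁] [NormedAddCommGroup Z₂]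

theorem of_lipschitz {Φ : P2 d → Y → Z} {C L : ℝ} (hC : ∀ ρ y, ‖Φ ρ y‖ ≤ C) (hL : 0 ≤ L)
    (h : ∀ ρ ρ' y y', ‖Φ ρ y - Φ ρ' y'‖ ≤ L * (wass 1 ρ ρ' + dist y y')) :
    AlmostLipschitz s Φ :=
  ⟨⟨max C 0, le_max_right _ _, fun ρ y => (hC ρ y).trans (le_max_left _ _)⟩,
    fun ε hε _ => ⟨L, hL, fun ρ ρ' y y' => by linarith [h ρ ρ' y y']⟩⟩

theorem lipschitz {Φ : P2 d → Y → Z} (h : AlmostLipschitz True Φ) :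
    ∃ L ≥ 0, ∀ ρ ρ' y y', ‖Φ ρ y - Φ ρ' y'‖ ≤ L * (wass 1 ρ ρ' + dist y y') := by
  obtain ⟨L, hL, hl⟩ := h.2 0 le_rfl (Or.inr trivial)
  exact ⟨L, hL, fun ρ ρ' y y' => by linarith [hl ρ ρ' y y']⟩

theorem mono {Φ : P2 d → Y → Z} (h : AlmostLipschitz True Φ) : AlmostLipschitz s Φ :=
  ⟨h.1, fun ε hε _ => h.2 ε hε (Or.inr trivial)⟩

/-- All algebraic closure properties follow from this one: only increments have to be dominated. -/
theorem of_dominated {Φ₁ : P2 d → Y → Z₁} {Φ₂ : P2 d → Y → Z₂} {Ψ : P2 d → Y → Z}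
    (h₁ : AlmostLipschitz s Φ₁) (h₂ : AlmostLipschitz s Φ₂) {C c : ℝ} (hC : ∀ ρ y, ‖Ψ ρ y‖ ≤ C)
    (hc : 0 ≤ c) (h : ∀ ρ ρ' y y', ‖Ψ ρ y - Ψ ρ' y'‖ ≤
      c * (‖Φ₁ ρ y - Φ₁ ρ' y'‖ + ‖Φ₂ ρ y - Φ₂ ρ' y'‖)) : AlmostLipschitz s Ψ := by
  refine ⟨⟨max C 0, le_max_right _ _, fun ρ y => (hC ρ y).trans (le_max_left _ _)⟩,
    fun ε hε hs => ?_⟩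
  -- Each of the two increments receives half of the tolerance, divided by `c + 1` to absorb the
  -- factor `c`. For `ε = 0` the share is again `0`, which is admissible under `s`.
  have hs' : 0 < ε / (2 * (c + 1)) ∨ s := hs.imp (fun h => by positivity) id
  obtain ⟨L₁, hL₁, hl₁⟩ := h₁.2 (ε / (2 * (c + 1))) (by positivity) hs'
  obtain ⟨L₂, hL₂, hl₂⟩ := h₂.2 (ε / (2 * (c + 1))) (by positivity) hs'
  refine ⟨c * (L₁ + L₂), by positivity, fun ρ ρ' y y' => (h ρ ρ' y y').trans ?_⟩
  calc _ ≤ c * ((ε / (2 * (c + 1)) + L₁ * (wass 1 ρ ρ' + dist y y')) +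
        (ε / (2 * (c + 1)) + L₂ * (wass 1 ρ ρ' + dist y y'))) := by
        gcongr
        · exact hl₁ ρ ρ' y y'
        · exact hl₂ ρ ρ' y y'
    _ = c * (ε / (c + 1)) + c * (L₁ + L₂) * (wass 1 ρ ρ' + dist y y') := by
        field_simp; ring
    _ ≤ _ := by
        have : c * (ε / (c + 1)) ≤ ε := by
          rw [mul_div_assoc', div_le_iff₀ (by linarith)]; nlinarith
        linarith

theorem add {Φ₁ Φ₂ : P2 d → Y → Z} (h₁ : AlmostLipschitz s Φ₁) (h₂ : AlmostLipschitz s Φ₂) :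
    AlmostLipschitz s (fun ρ y => Φ₁ ρ y + Φ₂ ρ y) := by
  obtain ⟨C₁, -, hC₁⟩ := h₁.1
  obtain ⟨C₂, -, hC₂⟩ := h₂.1
  refine of_dominated h₁ h₂ (C := C₁ + C₂) (c := 1)
    (fun ρ y => (norm_add_le _ _).trans (add_le_add (hC₁ ρ y) (hC₂ ρ y))) zero_le_one
    fun ρ ρ' y y' => ?_
  rw [add_sub_add_comm, one_mul]
  exact norm_add_le _ _

theorem sub {Φ₁ Φ₂ : P2 d → Y → Z} (h₁ : AlmostLipschitz s Φ₁) (h₂ : AlmostLipschitz s Φ₂) :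
    AlmostLipschitz s (fun ρ y => Φ₁ ρ y - Φ₂ ρ y) := by
  obtain ⟨C₁, -, hC₁⟩ := h₁.1
  obtain ⟨C₂, -, hC₂⟩ := h₂.1
  refine of_dominated h₁ h₂ (C := C₁ + C₂) (c := 1)
    (fun ρ y => (norm_sub_le _ _).trans (add_le_add (hC₁ ρ y) (hC₂ ρ y))) zero_le_one
    fun ρ ρ' y y' => ?_
  rw [sub_sub_sub_comm, one_mul]
  exact norm_sub_le _ _

theorem bilinear [NormedSpace ℝ Z] [NormedSpace ℝ Z₁] [NormedSpace ℝ Z₂]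
    (B : Z₁ →L[ℝ] Z₂ →L[ℝ] Z) {Φ₁ : P2 d → Y → Z₁} {Φ₂ : P2 d → Y → Z₂}
    (h₁ : AlmostLipschitz s Φ₁) (h₂ : AlmostLipschitz s Φ₂) :
    AlmostLipschitz s (fun ρ y => B (Φ₁ ρ y) (Φ₂ ρ y)) := by
  obtain ⟨C₁, hC₁', hC₁⟩ := h₁.1
  obtain ⟨C₂, hC₂', hC₂⟩ := h₂.1
  refine of_dominated h₁ h₂ (C := ‖B‖ * C₁ * C₂) (c := ‖B‖ * (C₁ + C₂))
    (fun ρ y => (B.le_opNorm₂ _ _).trans ?_) (by positivity) fun ρ ρ' y y' => ?_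
  · gcongr
    · exact hC₁ ρ y
    · exact hC₂ ρ y
  · have e : B (Φ₁ ρ y) (Φ₂ ρ y) - B (Φ₁ ρ' y') (Φ₂ ρ' y') =
        B (Φ₁ ρ y - Φ₁ ρ' y') (Φ₂ ρ y) + B (Φ₁ ρ' y') (Φ₂ ρ y - Φ₂ ρ' y') := by
      simp
    rw [e]
    calc _ ≤ ‖B‖ * ‖Φ₁ ρ y - Φ₁ ρ' y'‖ * ‖Φ₂ ρ y‖ + ‖B‖ * ‖Φ₁ ρ' y'‖ * ‖Φ₂ ρ y - Φ₂ ρ' y'‖ :=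
          (norm_add_le _ _).trans (add_le_add (B.le_opNorm₂ _ _) (B.le_opNorm₂ _ _))
      _ ≤ ‖B‖ * ‖Φ₁ ρ y - Φ₁ ρ' y'‖ * C₂ + ‖B‖ * C₁ * ‖Φ₂ ρ y - Φ₂ ρ' y'‖ := by
          gcongr
          · exact hC₂ ρ y
          · exact hC₁ ρ' y'
      _ ≤ _ := by
          have a1 : 0 ≤ ‖B‖ * C₁ * ‖Φ₁ ρ y - Φ₁ ρ' y'‖ := by positivity
          have a2 : 0 ≤ ‖B‖ * C₂ * ‖Φ₂ ρ y - Φ₂ ρ' y'‖ := by positivity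
          nlinarith

theorem smul [NormedSpace ℝ Z] {Φ₁ : P2 d → Y → ℝ} {Φ₂ : P2 d → Y → Z}
    (h₁ : AlmostLipschitz s Φ₁) (h₂ : AlmostLipschitz s Φ₂) :
    AlmostLipschitz s (fun ρ y => Φ₁ ρ y • Φ₂ ρ y) :=
  bilinear (ContinuousLinearMap.lsmul ℝ ℝ) h₁ h₂

theorem comp_clm [NormedSpace ℝ Z] [NormedSpace ℝ Z₁] (T : Z₁ →L[ℝ] Z) {Φ : P2 d → Y → Z₁}
    (h : AlmostLipschitz s Φ) : AlmostLipschitz s (fun ρ y => T (Φ ρ y)) := by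
  obtain ⟨C, hC', hC⟩ := h.1
  refine of_dominated h h (C := ‖T‖ * C) (c := ‖T‖) (fun ρ y => ?_) (norm_nonneg _)
    fun ρ ρ' y y' => ?_
  · exact (T.le_opNorm _).trans (by gcongr; exact hC ρ y)
  · rw [← map_sub]
    refine (T.le_opNorm _).trans ?_
    gcongr
    linarith [norm_nonneg (Φ ρ y - Φ ρ' y')]

/-- Reparametrisation by a Lipschitz map. -/
theorem reparam {Φ : P2 d → Y → Z} (h : AlmostLipschitz s Φ) (r : Y' → Y)
    (hr : ∃ K : ℝ≥0, LipschitzWith K r) : AlmostLipschitz s (fun ρ y => Φ ρ (r y)) := by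
  obtain ⟨C, hC', hC⟩ := h.1
  obtain ⟨K, hK⟩ := hr
  refine ⟨⟨C, hC', fun ρ y => hC ρ _⟩, fun ε hε hs => ?_⟩
  obtain ⟨L, hL, hl⟩ := h.2 ε hε hs
  refine ⟨L * (K + 1), by positivity, fun ρ ρ' y y' => (hl _ _ _ _).trans ?_⟩
  rw [mul_assoc]
  gcongr
  have := hK.dist_le_mul y y'
  have h1 := wass_nonneg 1 ρ ρ'
  have h2 : 0 ≤ (K : ℝ) * wass 1 ρ ρ' := by positivity
  nlinarith [dist_nonneg (x := y) (y := y')]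

/-- Composition with a scalar function that is almost Lipschitz on bounded intervals. -/
theorem comp_scalar {Φ : P2 d → Y → ℝ} (h : AlmostLipschitz s Φ) {P : ℝ → ℝ}
    (hP : Continuous P) (hs : s → ∃ L : ℝ≥0, LipschitzWith L P) :
    AlmostLipschitz s (fun ρ y => P (Φ ρ y)) := by
  obtain ⟨C, hC', hC⟩ := h.1
  have hmem : ∀ ρ y, Φ ρ y ∈ Set.Icc (-C) C := fun ρ y => abs_le.1 (hC ρ y)
  have hcomp : IsCompact (Set.Icc (-C) C) := isCompact_Icc
  obtain ⟨M, hM⟩ := hcomp.exists_bound_of_continuousOn hP.continuousOn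
  have hM0 : 0 ≤ M := (norm_nonneg _).trans (hM 0 ⟨by linarith, hC'⟩)
  refine ⟨⟨M, hM0, fun ρ y => hM _ (hmem ρ y)⟩, fun ε hε hes => ?_⟩
  -- Zero tolerance is only asked for under `s`, where `P` is Lipschitz. For positive tolerance,
  -- uniform continuity of `P` on the compact range `[-C, C]` is enough.
  rcases eq_or_lt_of_le hε with h0 | hpos
  · have hs' : s := hes.resolve_left (by rw [← h0]; exact lt_irrefl _)
    obtain ⟨K, hK⟩ := hs hs'
    obtain ⟨L, hL, hl⟩ := h.2 0 le_rfl (Or.inr hs')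
    refine ⟨K * L, by positivity, fun ρ ρ' y y' => ?_⟩
    have h1 := hK.dist_le_mul (Φ ρ y) (Φ ρ' y')
    rw [dist_eq_norm, dist_eq_norm] at h1
    have h2 : (K : ℝ) * ‖Φ ρ y - Φ ρ' y'‖ ≤ K * (0 + L * (wass 1 ρ ρ' + dist y y')) := by
      gcongr; exact hl ρ ρ' y y'
    linarith
  · have huc := hcomp.uniformContinuousOn_of_continuous hP.continuousOn
    rw [Metric.uniformContinuousOn_iff] at huc
    obtain ⟨δ, hδ, hδ'⟩ := huc (ε / 2) (by positivity)
    have hK : 0 ≤ 2 * M / δ := by positivity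
    obtain ⟨L, hL, hl⟩ := h.2 (ε / 2 / (2 * M / δ + 1)) (by positivity) (Or.inl (by positivity))
    refine ⟨2 * M / δ * L, by positivity, fun ρ ρ' y y' => ?_⟩
    -- Arguments closer than `δ` cost `ε / 2`. Otherwise the trivial bound `2M` is at most `2M / δ`
    -- times their distance.
    have key : ‖P (Φ ρ y) - P (Φ ρ' y')‖ ≤ ε / 2 + 2 * M / δ * ‖Φ ρ y - Φ ρ' y'‖ := by
      by_cases hd : ‖Φ ρ y - Φ ρ' y'‖ < δ
      · have := hδ' _ (hmem ρ y) _ (hmem ρ' y') (by rwa [dist_eq_norm])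
        rw [dist_eq_norm] at this
        have : 0 ≤ 2 * M / δ * ‖Φ ρ y - Φ ρ' y'‖ := by positivity
        linarith
      · have h1 : ‖P (Φ ρ y) - P (Φ ρ' y')‖ ≤ 2 * M := by
          linarith [norm_sub_le (P (Φ ρ y)) (P (Φ ρ' y')), hM _ (hmem ρ y), hM _ (hmem ρ' y')]
        have h2 : 2 * M / δ * δ ≤ 2 * M / δ * ‖Φ ρ y - Φ ρ' y'‖ := by
          gcongr; exact not_lt.1 hd
        rw [div_mul_cancel₀ _ hδ.ne'] at h2
        linarith
    have h3 : 2 * M / δ * ‖Φ ρ y - Φ ρ' y'‖ ≤ 2 * M / δ *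
        (ε / 2 / (2 * M / δ + 1) + L * (wass 1 ρ ρ' + dist y y')) := by
      gcongr; exact hl ρ ρ' y y'
    have h4 : 2 * M / δ * (ε / 2 / (2 * M / δ + 1)) ≤ ε / 2 := by
      rw [mul_div_assoc', div_le_iff₀ (by linarith)]; nlinarith
    nlinarith

theorem continuous {Φ : P2 d → Y → Z} (h : AlmostLipschitz s Φ) (ρ : P2 d) :
    Continuous (Φ ρ) := by
  rw [Metric.continuous_iff]
  intro y ε hε
  obtain ⟨L, hL, hl⟩ := h.2 (ε / 2) (by positivity) (Or.inl (by positivity))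
  refine ⟨ε / 2 / (L + 1), by positivity, fun y' hy' => ?_⟩
  rw [dist_eq_norm]
  refine (hl ρ ρ y' y).trans_lt ?_
  rw [wass_one_self, zero_add]
  have : L * dist y' y ≤ L * (ε / 2 / (L + 1)) := by gcongr
  have : L * (ε / 2 / (L + 1)) < ε / 2 := by
    rw [mul_div_assoc', div_lt_iff₀ (by linarith)]; nlinarith
  linarith

/-- The estimates are in `W₁`, the topology is that of `W₂`; `W₁ ≤ W₂` bridges the two. -/
theorem jointContinuous {Φ : P2 d → Y → Z} (h : AlmostLipschitz s Φ) : JointContinuous Φ := by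
  intro μ y
  rw [Metric.tendsto_nhds]
  intro ε hε
  obtain ⟨L, hL, hl⟩ := h.2 (ε / 2) (by positivity) (Or.inl (by positivity))
  have h1 : ∀ᶠ ν in nhdsW2 μ, wass 2 ν μ < ε / 4 / (L + 1) :=
    tendsto_comap.eventually (gt_mem_nhds (by positivity))
  have h2 : ∀ᶠ y' in 𝓝 y, dist y' y < ε / 4 / (L + 1) := Metric.ball_mem_nhds _ (by positivity)
  filter_upwards [h1.prod_mk h2] with p hp
  rw [dist_eq_norm]
  refine (hl _ _ _ _).trans_lt ?_
  have hw := wass_one_le_wass_two p.1 μ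
  have : L * (wass 1 p.1 μ + dist p.2 y) ≤ L * (ε / 4 / (L + 1) + ε / 4 / (L + 1)) := by
    gcongr
    · exact hw.trans hp.1.le
    · exact hp.2.le
  have : L * (ε / 4 / (L + 1) + ε / 4 / (L + 1)) < ε / 2 := by
    rw [← add_div, mul_div_assoc', div_lt_iff₀ (by linarith)]; nlinarith
  linarith

theorem integrable {Φ : P2 d → E d → Z} (h : AlmostLipschitz s Φ) (ρ ν : P2 d) :
    Integrable (Φ ρ) ν.toMeasure := by
  obtain ⟨C, -, hC⟩ := h.1
  exact Integrable.of_bound (h.continuous ρ).aestronglyMeasurable C (Eventually.of_forall (hC ρ))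

theorem integrable_right {Φ : P2 d → Y × E d → Z} (h : AlmostLipschitz s Φ) (ρ ν : P2 d) (y : Y) :
    Integrable (fun x => Φ ρ (y, x)) ν.toMeasure := by
  obtain ⟨C, -, hC⟩ := h.1
  exact Integrable.of_bound ((h.continuous ρ).comp (by fun_prop)).aestronglyMeasurable C
    (Eventually.of_forall fun x => hC ρ (y, x))

theorem integral [NormedSpace ℝ Z] {Φ : P2 d → Y × E d → Z} (h : AlmostLipschitz s Φ) :
    AlmostLipschitz s (fun ρ y => ∫ x, Φ ρ (y, x) ∂ρ.toMeasure) := by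
  obtain ⟨C, hC', hC⟩ := h.1
  refine ⟨⟨C, hC', fun ρ y => ?_⟩, fun ε hε hs => ?_⟩
  · simpa using norm_integral_le_of_norm_le_const (μ := ρ.toMeasure)
      (Eventually.of_forall fun x => hC ρ (y, x))
  · obtain ⟨L, hL, hl⟩ := h.2 ε hε hs
    refine ⟨2 * L, by positivity, fun ρ ρ' y y' => ?_⟩
    -- Both integrand and measure vary. The change of the integrand at fixed `x` is put into the
    -- tolerance, and the change of measure adds another `L * W₁`, whence `2 * L`.
    have key := norm_integral_sub_integral_le (ε := ε + L * (wass 1 ρ ρ' + dist y y')) (L := L)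
      (h.integrable_right ρ ρ y) (h.integrable_right ρ' ρ' y') hL (fun z z' => ?_)
    · refine key.trans ?_
      have : 0 ≤ L * dist y y' := by positivity
      nlinarith
    · refine (hl ρ ρ' (y, z) (y', z')).trans ?_
      have h1 : dist (y, z) (y', z') ≤ dist y y' + ‖z - z'‖ := by
        rw [Prod.dist_eq, dist_eq_norm z z']
        exact max_le (by linarith [norm_nonneg (z - z')])
          (by linarith [dist_nonneg (x := y) (y := y')])
      have : L * dist (y, z) (y', z') ≤ L * (dist y y' + ‖z - z'‖) := by gcongr
      linarith

end AlmostLipschitz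

theorem AlmostLipschitz.upgrade {s : Prop} {d : ℕ} {Y Z : Type*} [PseudoMetricSpace Y]
    [NormedAddCommGroup Z] {Φ : P2 d → Y → Z} (hs : s) (h : AlmostLipschitz s Φ) :
    AlmostLipschitz True Φ :=
  ⟨h.1, fun ε hε _ => h.2 ε hε (Or.inr hs)⟩

/-! ### Linear derivatives along convex combinations -/

/-- Along each segment `t ↦ (1 - t) ρ + t ρ'` the function `φ` is differentiable with derivative
`∫ κ d(ρ' - ρ)`, where `κ` is evaluated at the current point of the segment. -/
def HasLinearDerivative {d : ℕ} {Z : Type*} [NormedAddCommGroup Z] [NormedSpace ℝ Z]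
    (φ : P2 d → Z) (κ : P2 d → E d → Z) : Prop :=
  ∀ ρ ρ' : P2 d, ∃ Θ : ℝ → Z, (∀ t : unitInterval, φ (mix ρ ρ' t) = Θ t) ∧
    ∀ t : unitInterval, HasDerivAt Θ ((∫ x, κ (mix ρ ρ' t) x ∂ρ'.toMeasure) -
      ∫ x, κ (mix ρ ρ' t) x ∂ρ.toMeasure) t

theorem mix_zero {d : ℕ} (μ ν : P2 d) : mix μ ν 0 = μ := by
  cases μ; simp [mix]

theorem mix_one {d : ℕ} (μ ν : P2 d) : mix μ ν 1 = ν := by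
  cases ν; simp [mix]

namespace HasLinearDerivative

variable {d : ℕ} {Z Z' : Type*} [NormedAddCommGroup Z] [NormedSpace ℝ Z] [NormedAddCommGroup Z']
  [NormedSpace ℝ Z'] {s : Prop}

/-- `mix` only makes sense for `t ∈ [0,1]`; the extension `Θ` to real times has an ordinary
derivative at `0`, from which the one-sided limit is read off. -/
theorem tendsto {φ : P2 d → Z} {κ : P2 d → E d → Z} (h : HasLinearDerivative φ κ) (ρ ρ' : P2 d) :
    Tendsto (fun t : unitInterval => (t : ℝ)⁻¹ • (φ (mix ρ ρ' t) - φ ρ)) (𝓝[≠] 0)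
      (𝓝 ((∫ x, κ ρ x ∂ρ'.toMeasure) - ∫ x, κ ρ x ∂ρ.toMeasure)) := by
  obtain ⟨Θ, h1, h2⟩ := h ρ ρ'
  have h3 := h2 0
  rw [mix_zero, hasDerivAt_iff_tendsto_slope] at h3
  have h4 : Tendsto (fun t : unitInterval => (t : ℝ)) (𝓝[≠] 0) (𝓝[≠] ((0 : unitInterval) : ℝ)) :=
    tendsto_nhdsWithin_of_tendsto_nhds_of_eventually_within _
      (continuous_subtype_val.continuousAt.mono_left nhdsWithin_le_nhds)
      (eventually_nhdsWithin_of_forall fun t ht h => ht (Subtype.ext h))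
  refine (h3.comp h4).congr fun t => ?_
  have h0 := h1 0
  rw [mix_zero] at h0
  simp [slope_def_module, h1 t, h0]

theorem add {φ₁ φ₂ : P2 d → Z} {κ₁ κ₂ : P2 d → E d → Z} (h₁ : HasLinearDerivative φ₁ κ₁)
    (h₂ : HasLinearDerivative φ₂ κ₂) (i₁ : ∀ ρ ν : P2 d, Integrable (κ₁ ρ) ν.toMeasure)
    (i₂ : ∀ ρ ν : P2 d, Integrable (κ₂ ρ) ν.toMeasure) :
    HasLinearDerivative (fun ρ => φ₁ ρ + φ₂ ρ) (fun ρ x => κ₁ ρ x + κ₂ ρ x) := by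
  intro ρ ρ'
  obtain ⟨Θ₁, a₁, b₁⟩ := h₁ ρ ρ'
  obtain ⟨Θ₂, a₂, b₂⟩ := h₂ ρ ρ'
  refine ⟨Θ₁ + Θ₂, fun t => by simp [a₁ t, a₂ t], fun t => ?_⟩
  refine ((b₁ t).add (b₂ t)).congr_deriv ?_
  rw [integral_add (i₁ _ _) (i₂ _ _), integral_add (i₁ _ _) (i₂ _ _)]
  abel

theorem comp_clm [CompleteSpace Z] [CompleteSpace Z'] (T : Z →L[ℝ] Z') {φ : P2 d → Z}
    {κ : P2 d → E d → Z} (h : HasLinearDerivative φ κ)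
    (i : ∀ ρ ν : P2 d, Integrable (κ ρ) ν.toMeasure) :
    HasLinearDerivative (fun ρ => T (φ ρ)) (fun ρ x => T (κ ρ x)) := by
  intro ρ ρ'
  obtain ⟨Θ, a, b⟩ := h ρ ρ'
  refine ⟨fun t => T (Θ t), fun t => by simp [a t], fun t => ?_⟩
  refine (T.hasFDerivAt.comp_hasDerivAt _ (b t)).congr_deriv ?_
  rw [map_sub, T.integral_comp_comm (i _ _), T.integral_comp_comm (i _ _)]

/-- Adding a function of the measure alone does not change the linear derivative. -/
theorem sub_const {φ : P2 d → Z} {κ : P2 d → E d → Z} (h : HasLinearDerivative φ κ)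
    (i : ∀ ρ ν : P2 d, Integrable (κ ρ) ν.toMeasure) (c : P2 d → Z) :
    HasLinearDerivative φ (fun ρ x => κ ρ x - c ρ) := by
  intro ρ ρ'
  obtain ⟨Θ, a, b⟩ := h ρ ρ'
  refine ⟨Θ, a, fun t => (b t).congr_deriv ?_⟩
  -- In an incomplete space every Bochner integral is `0` by definition, so both formulas agree.
  by_cases hZ : CompleteSpace Z
  · rw [integral_sub (i _ _) (integrable_const _), integral_sub (i _ _) (integrable_const _)]
    simp
  · simp [integral, hZ]

end HasLinearDerivative

/-! ### Kernels -/

/-- The average `∫ κ(x, y) dρ(y)`. -/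
noncomputable def avg {d : ℕ} {Z : Type*} [NormedAddCommGroup Z] [NormedSpace ℝ Z]
    (κ : E d → E d → Z) (ρ : P2 d) (x : E d) : Z := ∫ y, κ x y ∂ρ.toMeasure

/-- `k` is a symmetric kernel, bounded with two bounded continuous derivatives; `g` is the gradient
in the first variable, `a` and `b` are the derivatives of `g`. If `s` holds then `a` and `b` are
Lipschitz. -/
structure IsC2Kernel (s : Prop) {d : ℕ} (k : E d → E d → ℝ) (g : E d → E d → E d)
    (a b : E d → E d → (E d →L[ℝ] E d)) : Prop where
  symm : ∀ x y, k x y = k y x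
  k_al : AlmostLipschitz True (fun (_ : P2 d) (z : E d × E d) => k z.1 z.2)
  g_al : AlmostLipschitz True (fun (_ : P2 d) (z : E d × E d) => g z.1 z.2)
  grad : ∀ x y, HasGradientAt (fun x => k x y) (g x y) x
  g_fst : ∀ x y, HasFDerivAt (fun x => g x y) (a x y) x
  g_snd : ∀ x y, HasFDerivAt (fun y => g x y) (b x y) y
  a_cont : Continuous (fun z : E d × E d => a z.1 z.2)
  b_cont : Continuous (fun z : E d × E d => b z.1 z.2)
  a_bdd : ∃ C, ∀ x y, ‖a x y‖ ≤ C
  b_bdd : ∃ C, ∀ x y, ‖b x y‖ ≤ C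
  smooth : s → AlmostLipschitz True (fun (_ : P2 d) (z : E d × E d) => a z.1 z.2) ∧
    AlmostLipschitz True (fun (_ : P2 d) (z : E d × E d) => b z.1 z.2)

/-- `f` is a `C²` function with bounded derivatives `p = f'` and `q = f''`; if `s` holds then `q`
is Lipschitz. -/
structure IsC2Scalar (s : Prop) (f p q : ℝ → ℝ) : Prop where
  hasDeriv : ∀ z, HasDerivAt f (p z) z
  hasDeriv₂ : ∀ z, HasDerivAt p (q z) z
  q_cont : Continuous q
  p_bdd : ∃ C, ∀ z, |p z| ≤ C
  q_bdd : ∃ C, ∀ z, |q z| ≤ C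
  smooth : s → ∃ L : ℝ≥0, LipschitzWith L q

theorem exists_lipschitzWith_of_hasDerivAt {f p : ℝ → ℝ} (h : ∀ z, HasDerivAt f (p z) z)
    (hb : ∃ C, ∀ z, |p z| ≤ C) : ∃ L : ℝ≥0, LipschitzWith L f := by
  obtain ⟨C, hC⟩ := hb
  have hC0 : 0 ≤ C := (abs_nonneg _).trans (hC 0)
  refine ⟨⟨C, hC0⟩, lipschitzWith_of_nnnorm_deriv_le (fun z => (h z).differentiableAt) fun z => ?_⟩
  rw [(h z).deriv]
  exact hC z

theorem IsC2Scalar.cont {s : Prop} {f p q : ℝ → ℝ} (h : IsC2Scalar s f p q) : Continuous f :=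
  continuous_iff_continuousAt.2 fun z => (h.hasDeriv z).continuousAt

theorem IsC2Scalar.p_cont {s : Prop} {f p q : ℝ → ℝ} (h : IsC2Scalar s f p q) : Continuous p :=
  continuous_iff_continuousAt.2 fun z => (h.hasDeriv₂ z).continuousAt

/-! ### Averages of kernels and differentiation along segments -/

section avg

variable {d : ℕ} {Z : Type*} [NormedAddCommGroup Z] [NormedSpace ℝ Z]

theorem AlmostLipschitz.avg {s : Prop} {κ : E d → E d → Z}
    (h : AlmostLipschitz s (fun (_ : P2 d) (z : E d × E d) => κ z.1 z.2)) :
    AlmostLipschitz s (avg κ) := h.integral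

/-- Averages are affine in the measure. Every linear derivative below comes from this. -/
theorem avg_mix {s : Prop} {κ : E d → E d → Z}
    (h : AlmostLipschitz s (fun (_ : P2 d) (z : E d × E d) => κ z.1 z.2)) (ρ ρ' : P2 d)
    (t : unitInterval) (x : E d) :
    avg κ (mix ρ ρ' t) x = avg κ ρ x + (t : ℝ) • (avg κ ρ' x - avg κ ρ x) := by
  rw [_root_.avg, integral_mix _ _ _ (h.integrable_right ρ ρ x) (h.integrable_right ρ' ρ' x),
    smul_sub, sub_smul, one_smul]
  simp only [_root_.avg]
  abel

theorem hasFDerivAt_integral_of_bounded [CompleteSpace Z] {ρ : P2 d} {F : E d → E d → Z}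
    {F' : E d → E d → (E d →L[ℝ] Z)} (hi : ∀ x, Integrable (F x) ρ.toMeasure)
    (hc : ∀ x, Continuous (F' x)) {C : ℝ} (hC : ∀ x y, ‖F' x y‖ ≤ C)
    (hF : ∀ x y, HasFDerivAt (fun x => F x y) (F' x y) x) (x : E d) :
    HasFDerivAt (fun x => ∫ y, F x y ∂ρ.toMeasure) (∫ y, F' x y ∂ρ.toMeasure) x :=
  hasFDerivAt_integral_of_dominated_of_fderiv_le (bound := fun _ => C) (s := Set.univ)
    univ_mem (Eventually.of_forall fun x => (hi x).1) (hi x) (hc x).aestronglyMeasurable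
    (Eventually.of_forall fun y x _ => hC x y) (integrable_const C)
    (Eventually.of_forall fun y x _ => hF x y)

/-- Here `u + t v` stands for the average of a kernel at time `t` of a segment, while `ν` is either
endpoint. The derivative is dominated by a constant because `P'`, `v` and `m` are bounded. -/
theorem hasDerivAt_integral_comp_line [CompleteSpace Z] (ν : P2 d) {u v : E d → ℝ} {m : E d → Z}
    {P P' : ℝ → ℝ} (hu : Continuous u) (hv : Continuous v) (hm : Continuous m) {Cu Cv Cm C : ℝ}
    (hCu : ∀ y, |u y| ≤ Cu) (hCv : ∀ y, |v y| ≤ Cv) (hCm : ∀ y, ‖m y‖ ≤ Cm)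
    (hP : ∀ z, HasDerivAt P (P' z) z) (hP' : Continuous P') (hC : ∀ z, |P' z| ≤ C) (t : ℝ) :
    Integrable (fun y => P (u y + t * v y) • m y) ν.toMeasure ∧
    Integrable (fun y => (P' (u y + t * v y) * v y) • m y) ν.toMeasure ∧
    HasDerivAt (fun t => ∫ y, P (u y + t * v y) • m y ∂ν.toMeasure)
      (∫ y, (P' (u y + t * v y) * v y) • m y ∂ν.toMeasure) t := by
  have hC0 : 0 ≤ C := (abs_nonneg _).trans (hC 0)
  have hCv0 : 0 ≤ Cv := (abs_nonneg _).trans (hCv 0)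
  have hCm0 : 0 ≤ Cm := (norm_nonneg _).trans (hCm 0)
  have hPc : Continuous P := continuous_iff_continuousAt.2 fun z => (hP z).continuousAt
  -- `P` itself need not be bounded, but at a fixed time its argument stays in a compact interval.
  obtain ⟨M, hM⟩ := (isCompact_Icc (a := -(Cu + |t| * Cv)) (b := Cu + |t| * Cv)
    ).exists_bound_of_continuousOn hPc.continuousOn
  have hin : ∀ y, P (u y + t * v y) ∈ P '' Set.Icc (-(Cu + |t| * Cv)) (Cu + |t| * Cv) := by
    intro y
    refine ⟨_, abs_le.1 ((abs_add_le _ _).trans (add_le_add (hCu y) ?_)), rfl⟩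
    rw [abs_mul]
    gcongr
    exact hCv y
  have hb : ∀ y, ‖P (u y + t * v y)‖ ≤ M := by
    intro y
    obtain ⟨z, hz, hz'⟩ := hin y
    rw [← hz']
    exact hM z hz
  have hM0 : 0 ≤ M := (norm_nonneg _).trans (hb 0)
  have hi : Integrable (fun y => P (u y + t * v y) • m y) ν.toMeasure := by
    refine Integrable.of_bound (C := M * Cm) (by fun_prop) (Eventually.of_forall fun y => ?_)
    rw [norm_smul]
    gcongr
    · exact hb y
    · exact hCm y
  have hd := hasDerivAt_integral_of_dominated_loc_of_deriv_le (μ := ν.toMeasure) (x₀ := t)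
    (F := fun t y => P (u y + t * v y) • m y)
    (F' := fun t y => (P' (u y + t * v y) * v y) • m y) (bound := fun _ => C * Cv * Cm)
    (s := Set.univ) univ_mem (Eventually.of_forall fun t => by fun_prop) hi (by fun_prop)
    (Eventually.of_forall fun y t _ => ?_) (integrable_const _)
    (Eventually.of_forall fun y t _ => ?_)
  · exact ⟨hi, hd.1, hd.2⟩
  · rw [norm_smul, norm_mul]
    gcongr
    · exact hC _
    · exact hCv y
    · exact hCm y
  · have h1 : HasDerivAt (fun t : ℝ => u y + t * v y) (v y) t := by
      simpa using ((hasDerivAt_id t).mul_const (v y)).const_add (u y)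
    exact ((hP _).comp t h1).smul_const (m y)

/-- The linear derivative of `ρ ↦ ∫ P(∫ k(y, z) dρ(z)) m(y) dρ(y)`. -/
theorem hasLinearDerivative_integral [CompleteSpace Z] {k : E d → E d → ℝ}
    (hk : AlmostLipschitz True (fun (_ : P2 d) (z : E d × E d) => k z.1 z.2))
    (hsymm : ∀ x y, k x y = k y x) {m : E d → Z}
    (hm : AlmostLipschitz True (fun (_ : P2 d) y => m y)) {P P' : ℝ → ℝ}
    (hP : ∀ z, HasDerivAt P (P' z) z) (hP' : Continuous P') (hb : ∃ C, ∀ z, |P' z| ≤ C) :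
    HasLinearDerivative (fun ρ => ∫ y, P (avg k ρ y) • m y ∂ρ.toMeasure)
      (fun ρ x => P (avg k ρ x) • m x + ∫ y, (P' (avg k ρ y) * k x y) • m y ∂ρ.toMeasure) := by
  intro ρ ρ'
  obtain ⟨C, hC⟩ := hb
  obtain ⟨Cm, hCm0, hCm⟩ := hm.1
  obtain ⟨Ck, hCk0, hCk⟩ := hk.1
  obtain ⟨Cu, hCu0, hCu⟩ := hk.avg.1
  have hv : AlmostLipschitz True (fun (_ : P2 d) y => avg k ρ' y - avg k ρ y) := by
    obtain ⟨L, hL0, hL⟩ := hk.avg.lipschitz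
    refine .of_lipschitz (C := Cu + Cu) (L := L + L) (fun _ y => (norm_sub_le _ _).trans
      (add_le_add (hCu ρ' y) (hCu ρ y))) (by positivity) fun σ σ' y y' => ?_
    have h1 := hL ρ' ρ' y y'
    have h2 := hL ρ ρ y y'
    rw [wass_one_self, zero_add] at h1 h2
    rw [sub_sub_sub_comm]
    refine (norm_sub_le _ _).trans ?_
    nlinarith [wass_nonneg 1 σ σ', dist_nonneg (x := y) (y := y')]
  obtain ⟨Cv, -, hCv⟩ := hv.1
  have hmc : Continuous m := hm.continuous ρ
  have key := fun ν t => hasDerivAt_integral_comp_line ν (hk.avg.continuous ρ) (hv.continuous ρ) hmc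
    (hCu ρ) (hCv ρ) (hCm ρ) hP hP' hC t
  -- The measure enters twice: through the weights `1 - t` and `t` of the outer integral, and
  -- through the affine average inside `P`. The product rule yields the two terms of the linear
  -- derivative.
  refine ⟨fun t => (1 - t) • (∫ y, P (avg k ρ y + t * (avg k ρ' y - avg k ρ y)) • m y ∂ρ.toMeasure)
    + t • (∫ y, P (avg k ρ y + t * (avg k ρ' y - avg k ρ y)) • m y ∂ρ'.toMeasure),
    fun t => ?_, fun t => ?_⟩
  · simp only [avg_mix hk, smul_eq_mul]
    exact integral_mix _ _ _ (key ρ t).1 (key ρ' t).1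
  · have h1 := ((hasDerivAt_id (t : ℝ)).const_sub 1).smul (key ρ t).2.2
    have h2 := (hasDerivAt_id (t : ℝ)).smul (key ρ' t).2.2
    refine (h1.add h2).congr_deriv ?_
    have hPc : Continuous P := continuous_iff_continuousAt.2 fun z => (hP z).continuousAt
    set σ := mix ρ ρ' t with hσ
    have hkc : Continuous fun z : E d × E d => k z.1 z.2 := hk.continuous ρ
    have huc : Continuous (avg k σ) := hk.avg.continuous σ
    have hC0 : 0 ≤ C := (abs_nonneg _).trans (hC 0)
    have hbd : ∀ x y, ‖(P' (avg k σ y) * k x y) • m y‖ ≤ C * Ck * Cm := fun x y => by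
      rw [norm_smul, norm_mul]
      gcongr
      · exact hC _
      · exact hCk σ (x, y)
      · exact hCm σ y
    -- Fubini and the symmetry of `k` move the outer integration into the kernel, so that the
    -- nonlocal term tested against `ν` becomes an average over `ν`.
    have fub : ∀ ν : P2 d, ∫ x, (∫ y, (P' (avg k σ y) * k x y) • m y ∂σ.toMeasure) ∂ν.toMeasure =
        ∫ y, (P' (avg k σ y) * avg k ν y) • m y ∂σ.toMeasure := by
      intro ν
      rw [integral_integral_swap]
      · refine integral_congr_ae (Eventually.of_forall fun y => ?_)
        simp only
        rw [integral_smul_const, integral_const_mul]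
        simp only [avg, hsymm y]
      · exact Integrable.of_bound (C := C * Ck * Cm)
          (Continuous.aestronglyMeasurable (by simp only [Function.uncurry_def]; fun_prop))
          (Eventually.of_forall fun z => hbd z.1 z.2)
    have iin : ∀ ν : P2 d, Integrable (fun x => ∫ y, (P' (avg k σ y) * k x y) • m y ∂σ.toMeasure)
        ν.toMeasure := by
      intro ν
      refine Integrable.of_bound (C := C * Ck * Cm) (Continuous.aestronglyMeasurable ?_)
        (Eventually.of_forall fun x => ?_)
      · refine continuous_of_dominated (bound := fun _ => C * Ck * Cm) (fun x => ?_)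
          (fun x => Eventually.of_forall fun y => hbd x y) (integrable_const _)
          (Eventually.of_forall fun y => ?_)
        · exact Continuous.aestronglyMeasurable (by fun_prop)
        · fun_prop
      · simpa using norm_integral_le_of_norm_le_const (μ := σ.toMeasure)
          (Eventually.of_forall fun y => hbd x y)
    have i1 : ∀ ν : P2 d, Integrable (fun x => P (avg k σ x) • m x) ν.toMeasure := by
      intro ν
      simp only [hσ, avg_mix hk, smul_eq_mul]
      exact (key ν t).1
    have i2 : ∀ ν : P2 d, Integrable (fun y => (P' (avg k σ y) * avg k ν y) • m y) σ.toMeasure := by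
      intro ν
      refine Integrable.of_bound (C := C * Cu * Cm)
        (Continuous.aestronglyMeasurable (by have := hk.avg.continuous ν; fun_prop))
        (Eventually.of_forall fun y => ?_)
      rw [norm_smul, norm_mul]
      gcongr
      · exact hC _
      · exact hCu ν y
      · exact hCm ν y
    rw [integral_add (i1 ρ') (iin ρ'), integral_add (i1 ρ) (iin ρ), fub, fub]
    have e : ∫ y, (P' (avg k σ y) * avg k ρ' y) • m y ∂σ.toMeasure -
        ∫ y, (P' (avg k σ y) * avg k ρ y) • m y ∂σ.toMeasure =
        (1 - (t : ℝ)) • (∫ y, (P' (avg k ρ y + t * (avg k ρ' y - avg k ρ y)) *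
          (avg k ρ' y - avg k ρ y)) • m y ∂ρ.toMeasure) + (t : ℝ) •
          (∫ y, (P' (avg k ρ y + t * (avg k ρ' y - avg k ρ y)) *
          (avg k ρ' y - avg k ρ y)) • m y ∂ρ'.toMeasure) := by
      rw [← integral_sub (i2 ρ') (i2 ρ), ← integral_mix ρ ρ' t (key ρ t).2.1 (key ρ' t).2.1]
      refine integral_congr_ae (Eventually.of_forall fun y => ?_)
      simp only [hσ, avg_mix hk, smul_eq_mul]
      rw [← sub_smul, ← mul_sub]
    rw [add_sub_add_comm, e]
    simp only [hσ, avg_mix hk, smul_eq_mul, id, neg_smul, one_smul]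
    abel

end avg

/-! ### Regular functionals -/

/-- The functional `φ` is bounded, with first variation `h` and Wasserstein gradient `G`, both
Lipschitz, `G` has the first variation `K`, derivative `A` in `x`, and Wasserstein Hessian `H`;
if `s` holds then `A` and `H` are Lipschitz. The first variations are not normalised. -/
structure IsRegularFunctional (s : Prop) {d : ℕ} (φ : P2 d → ℝ) (h : P2 d → E d → ℝ)
    (G : P2 d → E d → E d) (K : P2 d → E d → E d → E d)
    (H A : P2 d → E d → E d → (E d →L[ℝ] E d)) : Prop where
  bdd : ∃ C, ∀ ρ, |φ ρ| ≤ C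
  h_al : AlmostLipschitz True h
  G_al : AlmostLipschitz True G
  K_al : AlmostLipschitz s (fun ρ (z : E d × E d) => K ρ z.1 z.2)
  H_cont : JointContinuous (fun ρ (z : E d × E d) => H ρ z.1 z.2)
  H_bdd : ∃ C, ∀ ρ x x', ‖H ρ x x'‖ ≤ C
  h_grad : ∀ ρ x, HasGradientAt (h ρ) (G ρ x) x
  G_fderiv : ∀ ρ x, HasFDerivAt (G ρ) (A ρ x x) x
  K_fderiv : ∀ ρ x x', HasFDerivAt (K ρ x) (H ρ x x') x'
  h_linear : HasLinearDerivative φ h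
  K_linear : ∀ x, HasLinearDerivative (fun ρ => G ρ x) (fun ρ => K ρ x)
  smooth : s → AlmostLipschitz True (fun ρ x => A ρ x x) ∧
    AlmostLipschitz True (fun ρ (z : E d × E d) => H ρ z.1 z.2)

theorem exists_lipschitzWith_prodMk_left {X Y : Type*} [PseudoMetricSpace X] [PseudoMetricSpace Y]
    (x : X) : ∃ K : ℝ≥0, LipschitzWith K (fun y : Y => (x, y)) :=
  ⟨1, LipschitzWith.prodMk_left x⟩

theorem IsRegularFunctional.add {s : Prop} {d : ℕ} {φ₁ φ₂ : P2 d → ℝ} {h₁ h₂ : P2 d → E d → ℝ}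
    {G₁ G₂ : P2 d → E d → E d} {K₁ K₂ : P2 d → E d → E d → E d}
    {H₁ H₂ A₁ A₂ : P2 d → E d → E d → (E d →L[ℝ] E d)}
    (r₁ : IsRegularFunctional s φ₁ h₁ G₁ K₁ H₁ A₁) (r₂ : IsRegularFunctional s φ₂ h₂ G₂ K₂ H₂ A₂) :
    IsRegularFunctional s (fun ρ => φ₁ ρ + φ₂ ρ) (fun ρ x => h₁ ρ x + h₂ ρ x)
      (fun ρ x => G₁ ρ x + G₂ ρ x) (fun ρ x x' => K₁ ρ x x' + K₂ ρ x x')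
      (fun ρ x x' => H₁ ρ x x' + H₂ ρ x x') (fun ρ x x' => A₁ ρ x x' + A₂ ρ x x') where
  bdd := by
    obtain ⟨C₁, h₁⟩ := r₁.bdd
    obtain ⟨C₂, h₂⟩ := r₂.bdd
    exact ⟨C₁ + C₂, fun ρ => (abs_add_le _ _).trans (add_le_add (h₁ ρ) (h₂ ρ))⟩
  h_al := r₁.h_al.add r₂.h_al
  G_al := r₁.G_al.add r₂.G_al
  K_al := r₁.K_al.add r₂.K_al
  H_cont := fun μ z => (r₁.H_cont μ z).add (r₂.H_cont μ z)
  H_bdd := by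
    obtain ⟨C₁, h₁⟩ := r₁.H_bdd
    obtain ⟨C₂, h₂⟩ := r₂.H_bdd
    exact ⟨C₁ + C₂, fun ρ x x' => (norm_add_le _ _).trans (add_le_add (h₁ ρ x x') (h₂ ρ x x'))⟩
  h_grad := fun ρ x => by
    have := (r₁.h_grad ρ x).hasFDerivAt.add (r₂.h_grad ρ x).hasFDerivAt
    rw [← map_add] at this
    exact this
  G_fderiv := fun ρ x => (r₁.G_fderiv ρ x).add (r₂.G_fderiv ρ x)
  K_fderiv := fun ρ x x' => (r₁.K_fderiv ρ x x').add (r₂.K_fderiv ρ x x')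
  h_linear := r₁.h_linear.add r₂.h_linear (fun ρ ν => r₁.h_al.integrable ρ ν)
    (fun ρ ν => r₂.h_al.integrable ρ ν)
  K_linear := fun x => (r₁.K_linear x).add (r₂.K_linear x)
    (fun ρ ν => r₁.K_al.integrable_right ρ ν x) (fun ρ ν => r₂.K_al.integrable_right ρ ν x)
  smooth := fun hs => ⟨(r₁.smooth hs).1.add (r₂.smooth hs).1, (r₁.smooth hs).2.add (r₂.smooth hs).2⟩

/-! ### The functional `∫ f(∫ k(x, y) dρ(y)) dρ(x)` -/

section kernel

variable {d : ℕ}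

/-- The functional `∫ f(∫ k(x, y) dρ(y)) dρ(x)`. -/
noncomputable def kernelFunctional (f : ℝ → ℝ) (k : E d → E d → ℝ) (ρ : P2 d) : ℝ :=
  ∫ x, f (avg k ρ x) ∂ρ.toMeasure

/-- The first variation of `kernelFunctional`. -/
noncomputable def kernelVariation (f p : ℝ → ℝ) (k : E d → E d → ℝ) (ρ : P2 d) (x : E d) : ℝ :=
  f (avg k ρ x) + ∫ y, p (avg k ρ y) • k x y ∂ρ.toMeasure

/-- The Wasserstein gradient of `kernelFunctional`. -/
noncomputable def kernelGradient (p : ℝ → ℝ) (k : E d → E d → ℝ) (g : E d → E d → E d) (ρ : P2 d)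
    (x : E d) : E d :=
  p (avg k ρ x) • avg g ρ x + ∫ y, p (avg k ρ y) • g x y ∂ρ.toMeasure

/-- The first variation of `kernelGradient`. -/
noncomputable def kernelGradientVariation (p q : ℝ → ℝ) (k : E d → E d → ℝ) (g : E d → E d → E d)
    (ρ : P2 d) (x x' : E d) : E d :=
  ((q (avg k ρ x) * k x x') • avg g ρ x + p (avg k ρ x) • g x x') +
    (p (avg k ρ x') • g x x' + ∫ y, (q (avg k ρ y) * k x' y) • g x y ∂ρ.toMeasure)

/-- The map `v ↦ ⟪u, v⟫ w` as a bilinear function of `w` and `u`. -/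
noncomputable def outer (d : ℕ) : E d →L[ℝ] E d →L[ℝ] (E d →L[ℝ] E d) :=
  InnerProductSpace.rankOne ℝ

theorem outer_apply (w u v : E d) : outer d w u v = inner ℝ u v • w := rfl

theorem norm_outer_le (w u : E d) : ‖outer d w u‖ ≤ ‖w‖ * ‖u‖ :=
  ContinuousLinearMap.opNorm_le_bound _ (by positivity) fun v => by
    rw [outer_apply, norm_smul]
    nlinarith [norm_inner_le_norm (𝕜 := ℝ) u v, norm_nonneg w]

/-- The part of the Hessian of `kernelFunctional` without second derivatives of the kernel. -/
noncomputable def kernelHessianMain (q : ℝ → ℝ) (k : E d → E d → ℝ)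
    (g : E d → E d → E d) (ρ : P2 d) (x x' : E d) : E d →L[ℝ] E d :=
  q (avg k ρ x) • outer d (avg g ρ x) (g x' x) + (q (avg k ρ x') • outer d (g x x') (avg g ρ x') +
    ∫ y, q (avg k ρ y) • outer d (g x y) (g x' y) ∂ρ.toMeasure)

/-- The Wasserstein Hessian of `kernelFunctional`. -/
noncomputable def kernelHessian (p q : ℝ → ℝ) (k : E d → E d → ℝ)
    (g : E d → E d → E d) (b : E d → E d → (E d →L[ℝ] E d)) (ρ : P2 d) (x x' : E d) :
    E d →L[ℝ] E d :=
  kernelHessianMain q k g ρ x x' + (p (avg k ρ x) + p (avg k ρ x')) • b x x'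

/-- The derivative of `kernelGradient` in `x`, on the diagonal `x = x'`. -/
noncomputable def kernelGradientDeriv (p q : ℝ → ℝ) (k : E d → E d → ℝ)
    (g : E d → E d → E d) (a : E d → E d → (E d →L[ℝ] E d)) (ρ : P2 d) (x _x' : E d) :
    E d →L[ℝ] E d :=
  (q (avg k ρ x) • outer d (avg g ρ x) (avg g ρ x) + p (avg k ρ x) • avg a ρ x) +
    ∫ y, p (avg k ρ y) • a x y ∂ρ.toMeasure

theorem exists_lipschitzWith_fst {X Y : Type*} [PseudoMetricSpace X] [PseudoMetricSpace Y] :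
    ∃ K : ℝ≥0, LipschitzWith K (Prod.fst : X × Y → X) := ⟨1, LipschitzWith.prod_fst⟩

theorem exists_lipschitzWith_snd {X Y : Type*} [PseudoMetricSpace X] [PseudoMetricSpace Y] :
    ∃ K : ℝ≥0, LipschitzWith K (Prod.snd : X × Y → Y) := ⟨1, LipschitzWith.prod_snd⟩

variable {s : Prop} {f p q : ℝ → ℝ} {k : E d → E d → ℝ} {g : E d → E d → E d}
  {a b : E d → E d → (E d →L[ℝ] E d)}

theorem almostLipschitz_p_avg (hf : IsC2Scalar s f p q) (hk : IsC2Kernel s k g a b) :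
    AlmostLipschitz True (fun ρ x => p (avg k ρ x)) :=
  hk.k_al.avg.comp_scalar hf.p_cont
    (fun _ => exists_lipschitzWith_of_hasDerivAt hf.hasDeriv₂ hf.q_bdd)

/-- In contrast to `p`, which is Lipschitz because `q` is bounded, `q` is merely continuous unless
`s` holds. -/
theorem almostLipschitz_q_avg (hf : IsC2Scalar s f p q) (hk : IsC2Kernel s k g a b) :
    AlmostLipschitz s (fun ρ x => q (avg k ρ x)) :=
  hk.k_al.avg.mono.comp_scalar hf.q_cont hf.smooth

theorem hasFDerivAt_avg (hk : IsC2Kernel s k g a b) (ρ : P2 d) (x : E d) :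
    HasFDerivAt (avg k ρ) (innerSL ℝ (avg g ρ x)) x := by
  obtain ⟨C, hC0, hC⟩ := hk.g_al.1
  have h := hasFDerivAt_integral_of_bounded (ρ := ρ) (F := k) (F' := fun x y => innerSL ℝ (g x y))
    (fun x => hk.k_al.integrable_right ρ ρ x)
    (fun x => by have := hk.g_al.continuous ρ; fun_prop)
    (fun x y => (innerSL_apply_norm ℝ (g x y)).le.trans (hC ρ (x, y)))
    (fun x y => (hk.grad x y).hasFDerivAt) x
  rwa [(innerSL ℝ).integral_comp_comm (hk.g_al.integrable_right ρ ρ x)] at h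

theorem hasFDerivAt_avg_gradient (hk : IsC2Kernel s k g a b) (ρ : P2 d) (x : E d) :
    HasFDerivAt (avg g ρ) (avg a ρ x) x := by
  obtain ⟨C, hC⟩ := hk.a_bdd
  have := hk.a_cont
  exact hasFDerivAt_integral_of_bounded (ρ := ρ) (F := g) (F' := a)
    (fun x => hk.g_al.integrable_right ρ ρ x) (fun x => by fun_prop) hC hk.g_fst x

theorem hasGradientAt_kernelVariation (hf : IsC2Scalar s f p q) (hk : IsC2Kernel s k g a b)
    (ρ : P2 d) (x : E d) :
    HasGradientAt (kernelVariation f p k ρ) (kernelGradient p k g ρ x) x := by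
  have hu := hasFDerivAt_avg hk ρ x
  have h1 := (hf.hasDeriv (avg k ρ x)).comp_hasFDerivAt x hu
  obtain ⟨C, hC0, hC⟩ := hk.g_al.1
  obtain ⟨Cp, hCp⟩ := hf.p_bdd
  have hCp0 : 0 ≤ Cp := (abs_nonneg _).trans (hCp 0)
  have pc := (almostLipschitz_p_avg hf hk).continuous ρ
  have gc := hk.g_al.continuous ρ
  have kc := hk.k_al.continuous ρ
  have ig : ∀ x, Integrable (fun y => p (avg k ρ y) • g x y) ρ.toMeasure := fun x =>
    (((almostLipschitz_p_avg hf hk).reparam (Prod.snd : E d × E d → E d)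
      exists_lipschitzWith_snd).smul hk.g_al).integrable_right ρ ρ x
  have ik : ∀ x, Integrable (fun y => p (avg k ρ y) • k x y) ρ.toMeasure := fun x =>
    (((almostLipschitz_p_avg hf hk).reparam (Prod.snd : E d × E d → E d)
      exists_lipschitzWith_snd).smul hk.k_al).integrable_right ρ ρ x
  have h2 := hasFDerivAt_integral_of_bounded (ρ := ρ) (C := Cp * C)
    (F := fun x y => p (avg k ρ y) • k x y) (F' := fun x y => innerSL ℝ (p (avg k ρ y) • g x y))
    ik (fun x => (innerSL ℝ).continuous.comp (pc.smul (gc.comp (Continuous.prodMk_right x))))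
    (fun x y => by
      rw [innerSL_apply_norm, norm_smul]
      gcongr
      · exact hCp _
      · exact hC ρ (x, y))
    (fun x y => by
      rw [map_smul]
      exact (hk.grad x y).hasFDerivAt.const_smul (p (avg k ρ y))) x
  rw [(innerSL ℝ).integral_comp_comm (ig x)] at h2
  have h3 := h1.add h2
  rw [← map_smul, ← map_add] at h3
  exact h3

theorem hasFDerivAt_kernelGradient (hf : IsC2Scalar s f p q) (hk : IsC2Kernel s k g a b)
    (ρ : P2 d) (x : E d) :
    HasFDerivAt (kernelGradient p k g ρ) (kernelGradientDeriv p q k g a ρ x x) x := by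
  obtain ⟨C, hC⟩ := hk.a_bdd
  obtain ⟨Cp, hCp⟩ := hf.p_bdd
  have hCp0 : 0 ≤ Cp := (abs_nonneg _).trans (hCp 0)
  have pc := (almostLipschitz_p_avg hf hk).continuous ρ
  have ac := hk.a_cont
  have h1 := ((hf.hasDeriv₂ (avg k ρ x)).comp_hasFDerivAt x (hasFDerivAt_avg hk ρ x)).smul
    (hasFDerivAt_avg_gradient hk ρ x)
  have ig : ∀ x, Integrable (fun y => p (avg k ρ y) • g x y) ρ.toMeasure := fun x =>
    (((almostLipschitz_p_avg hf hk).reparam (Prod.snd : E d × E d → E d)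
      exists_lipschitzWith_snd).smul hk.g_al).integrable_right ρ ρ x
  have h2 := hasFDerivAt_integral_of_bounded (ρ := ρ) (C := Cp * C)
    (F := fun x y => p (avg k ρ y) • g x y) (F' := fun x y => p (avg k ρ y) • a x y)
    ig (fun x => pc.smul (ac.comp (Continuous.prodMk_right x)))
    (fun x y => by
      rw [norm_smul]
      gcongr
      · exact hCp _
      · exact hC x y)
    (fun x y => (hk.g_fst x y).const_smul (p (avg k ρ y))) x
  refine (h1.add h2).congr_fderiv ?_
  rw [kernelGradientDeriv]
  congr 1
  ext v
  simp [outer_apply, smul_smul, add_comm]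

theorem hasFDerivAt_kernelGradientVariation (hf : IsC2Scalar s f p q) (hk : IsC2Kernel s k g a b)
    (ρ : P2 d) (x x' : E d) :
    HasFDerivAt (kernelGradientVariation p q k g ρ x) (kernelHessian p q k g b ρ x x') x' := by
  -- By symmetry the derivative in the second variable is `g` with exchanged arguments.
  have hk' : HasFDerivAt (fun x' => k x x') (innerSL ℝ (g x' x)) x' := by
    simp_rw [hk.symm x]
    exact (hk.grad x' x).hasFDerivAt
  obtain ⟨C, hC0, hC⟩ := hk.g_al.1
  obtain ⟨Cq, hCq⟩ := hf.q_bdd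
  have hCq0 : 0 ≤ Cq := (abs_nonneg _).trans (hCq 0)
  have qc := (almostLipschitz_q_avg hf hk).continuous ρ
  have gc := hk.g_al.continuous ρ
  have ig : ∀ x', Integrable (fun y => (q (avg k ρ y) * k x' y) • g x y) ρ.toMeasure := fun x' => by
    have h1 := hk.k_al.continuous ρ
    obtain ⟨Ck, hCk0, hCk⟩ := hk.k_al.1
    refine Integrable.of_bound (C := Cq * Ck * C)
      ((qc.mul (h1.comp (Continuous.prodMk_right x'))).smul
      (gc.comp (Continuous.prodMk_right x))).aestronglyMeasurable (Eventually.of_forall fun y => ?_)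
    rw [norm_smul, norm_mul]
    gcongr
    · exact hCq _
    · exact hCk ρ (x', y)
    · exact hC ρ (x, y)
  have h1 := ((hk'.const_mul (q (avg k ρ x))).smul_const (avg g ρ x)).add
    ((hk.g_snd x x').const_smul (p (avg k ρ x)))
  have h2 := ((hf.hasDeriv₂ (avg k ρ x')).comp_hasFDerivAt x' (hasFDerivAt_avg hk ρ x')).smul
    (hk.g_snd x x')
  have h3 := hasFDerivAt_integral_of_bounded (ρ := ρ) (C := Cq * (C * C))
    (F := fun x' y => (q (avg k ρ y) * k x' y) • g x y)
    (F' := fun x' y => q (avg k ρ y) • outer d (g x y) (g x' y)) ig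
    (fun x' => qc.smul (((outer d).continuous.comp (gc.comp (Continuous.prodMk_right x))).clm_apply
      (gc.comp (Continuous.prodMk_right x'))))
    (fun x' y => by
      rw [norm_smul]
      gcongr
      · exact hCq _
      · refine (norm_outer_le _ _).trans ?_
        gcongr
        · exact hC ρ (x, y)
        · exact hC ρ (x', y))
    (fun x' y => by
      have := ((hk.grad x' y).hasFDerivAt.const_mul (q (avg k ρ y))).smul_const (g x y)
      refine this.congr_fderiv ?_
      ext v
      simp [outer_apply, smul_smul]) x'
  refine (h1.add (h2.add h3)).congr_fderiv ?_
  rw [kernelHessian, kernelHessianMain]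
  ext v
  simp [outer_apply, smul_smul, add_smul]
  ring

/-- This part is separated since it is uniformly continuous for all `C²` data. The remaining term
contains `b`, which without `s` is only bounded and continuous, so the full Hessian is then only
jointly continuous. -/
theorem almostLipschitz_kernelHessianMain (hf : IsC2Scalar s f p q) (hk : IsC2Kernel s k g a b) :
    AlmostLipschitz s (fun ρ (z : E d × E d) => kernelHessianMain q k g ρ z.1 z.2) := by
  have hq := almostLipschitz_q_avg hf hk
  have hg : AlmostLipschitz s (fun (_ : P2 d) (z : E d × E d) => g z.1 z.2) := hk.g_al.mono
  have hga := hg.avg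
  refine .add (.smul (hq.reparam _ exists_lipschitzWith_fst) (.bilinear (outer d)
    (hga.reparam _ exists_lipschitzWith_fst) (hg.reparam Prod.swap ?_))) (.add (.smul
    (hq.reparam _ exists_lipschitzWith_snd) (.bilinear (outer d) hg
    (hga.reparam _ exists_lipschitzWith_snd))) (AlmostLipschitz.integral
      (Φ := fun ρ (z : (E d × E d) × E d) =>
      q (avg k ρ z.2) • outer d (g z.1.1 z.2) (g z.1.2 z.2)) (.smul
      (hq.reparam _ exists_lipschitzWith_snd) (.bilinear (outer d)
      (hg.reparam (fun z : (E d × E d) × E d => (z.1.1, z.2)) ?_)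
      (hg.reparam (fun z : (E d × E d) × E d => (z.1.2, z.2)) ?_)))))
  · exact ⟨max 1 1, LipschitzWith.prod_snd.prodMk LipschitzWith.prod_fst⟩
  · exact ⟨max (1 * 1) 1,
      (LipschitzWith.prod_fst.comp LipschitzWith.prod_fst).prodMk LipschitzWith.prod_snd⟩
  · exact ⟨max (1 * 1) 1,
      (LipschitzWith.prod_snd.comp LipschitzWith.prod_fst).prodMk LipschitzWith.prod_snd⟩

theorem hasLinearDerivative_smul_avg (hf : IsC2Scalar s f p q) (hk : IsC2Kernel s k g a b)
    (x : E d) : HasLinearDerivative (fun ρ => p (avg k ρ x) • avg g ρ x)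
      (fun ρ x' => (q (avg k ρ x) * k x x') • avg g ρ x + p (avg k ρ x) • g x x') := by
  intro ρ ρ'
  refine ⟨fun t => p (avg k ρ x + t * (avg k ρ' x - avg k ρ x)) •
    (avg g ρ x + t • (avg g ρ' x - avg g ρ x)), fun t => ?_, fun t => ?_⟩
  · simp only [avg_mix hk.k_al, avg_mix hk.g_al, smul_eq_mul]
  · have h1 : HasDerivAt (fun t : ℝ => avg k ρ x + t * (avg k ρ' x - avg k ρ x))
        (avg k ρ' x - avg k ρ x) t := by
      simpa using ((hasDerivAt_id (t : ℝ)).mul_const (avg k ρ' x - avg k ρ x)).const_add (avg k ρ x)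
    have h2 : HasDerivAt (fun t : ℝ => avg g ρ x + t • (avg g ρ' x - avg g ρ x))
        (avg g ρ' x - avg g ρ x) t := by
      simpa using ((hasDerivAt_id (t : ℝ)).smul_const (avg g ρ' x - avg g ρ x)).const_add
        (avg g ρ x)
    refine (((hf.hasDeriv₂ _).comp (t : ℝ) h1).smul h2).congr_deriv ?_
    have i1 : ∀ ν : P2 d, Integrable (fun x' => (q (avg k (mix ρ ρ' t) x) * k x x') •
        avg g (mix ρ ρ' t) x) ν.toMeasure := fun ν =>
      ((hk.k_al.integrable_right ρ ν x).const_mul _).smul_const _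
    have i2 : ∀ ν : P2 d, Integrable (fun x' => p (avg k (mix ρ ρ' t) x) • g x x') ν.toMeasure :=
      fun ν => (hk.g_al.integrable_right ρ ν x).smul (p (avg k (mix ρ ρ' t) x))
    rw [integral_add (i1 ρ') (i2 ρ'), integral_add (i1 ρ) (i2 ρ)]
    simp only [integral_smul_const, integral_const_mul, integral_smul]
    rw [avg_mix hk.k_al, avg_mix hk.g_al, smul_eq_mul]
    simp only [Function.comp_apply]
    change _ = (_ * avg k ρ' x) • _ + _ • avg g ρ' x - ((_ * avg k ρ x) • _ + _ • avg g ρ x)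
    module

theorem almostLipschitz_integral_kernel (hf : IsC2Scalar s f p q) (hk : IsC2Kernel s k g a b) :
    AlmostLipschitz s (fun ρ (z : E d × E d) =>
      ∫ y, (q (avg k ρ y) * k z.2 y) • g z.1 y ∂ρ.toMeasure) := by
  refine AlmostLipschitz.integral
    (Φ := fun ρ (z : (E d × E d) × E d) => (q (avg k ρ z.2) * k z.1.2 z.2) • g z.1.1 z.2)
    (.smul (.smul ((almostLipschitz_q_avg hf hk).reparam _ exists_lipschitzWith_snd)
    (hk.k_al.mono.reparam (fun z : (E d × E d) × E d => (z.1.2, z.2)) ?_))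
    (hk.g_al.mono.reparam (fun z : (E d × E d) × E d => (z.1.1, z.2)) ?_))
  · exact ⟨max (1 * 1) 1,
      (LipschitzWith.prod_snd.comp LipschitzWith.prod_fst).prodMk LipschitzWith.prod_snd⟩
  · exact ⟨max (1 * 1) 1,
      (LipschitzWith.prod_fst.comp LipschitzWith.prod_fst).prodMk LipschitzWith.prod_snd⟩

theorem almostLipschitz_kernelGradientVariation_fst (hf : IsC2Scalar s f p q)
    (hk : IsC2Kernel s k g a b) :
    AlmostLipschitz s (fun ρ (z : E d × E d) =>
      (q (avg k ρ z.1) * k z.1 z.2) • avg g ρ z.1 + p (avg k ρ z.1) • g z.1 z.2) :=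
  .add (.smul (.smul ((almostLipschitz_q_avg hf hk).reparam _ exists_lipschitzWith_fst)
    hk.k_al.mono) (hk.g_al.avg.mono.reparam _ exists_lipschitzWith_fst))
    (.smul ((almostLipschitz_p_avg hf hk).mono.reparam _ exists_lipschitzWith_fst) hk.g_al.mono)

theorem almostLipschitz_kernelGradientVariation_snd (hf : IsC2Scalar s f p q)
    (hk : IsC2Kernel s k g a b) :
    AlmostLipschitz s (fun ρ (z : E d × E d) => p (avg k ρ z.2) • g z.1 z.2 +
      ∫ y, (q (avg k ρ y) * k z.2 y) • g z.1 y ∂ρ.toMeasure) :=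
  .add (.smul ((almostLipschitz_p_avg hf hk).mono.reparam _ exists_lipschitzWith_snd) hk.g_al.mono)
    (almostLipschitz_integral_kernel hf hk)

theorem almostLipschitz_kernelGradientVariation (hf : IsC2Scalar s f p q)
    (hk : IsC2Kernel s k g a b) :
    AlmostLipschitz s (fun ρ (z : E d × E d) => kernelGradientVariation p q k g ρ z.1 z.2) :=
  (almostLipschitz_kernelGradientVariation_fst hf hk).add
    (almostLipschitz_kernelGradientVariation_snd hf hk)

/-- The nonlocal part of the gradient is again an integral of an outer function of an average, now
with outer function `p` and the vector weight `g(x, ·)`. This is why `hasLinearDerivative_integral`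
carries a weight `m`. -/
theorem hasLinearDerivative_kernelGradient (hf : IsC2Scalar s f p q) (hk : IsC2Kernel s k g a b)
    (x : E d) : HasLinearDerivative (fun ρ => kernelGradient p k g ρ x)
      (fun ρ => kernelGradientVariation p q k g ρ x) :=
  HasLinearDerivative.add (hasLinearDerivative_smul_avg hf hk x)
    (hasLinearDerivative_integral hk.k_al hk.symm
      (hk.g_al.reparam _ (exists_lipschitzWith_prodMk_left x)) hf.hasDeriv₂ hf.q_cont hf.q_bdd)
    (fun ρ ν => (almostLipschitz_kernelGradientVariation_fst hf hk).integrable_right ρ ν x)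
    (fun ρ ν => (almostLipschitz_kernelGradientVariation_snd hf hk).integrable_right ρ ν x)

theorem isRegularFunctional_kernelFunctional (hf : IsC2Scalar s f p q)
    (hk : IsC2Kernel s k g a b) :
    IsRegularFunctional s (kernelFunctional f k) (kernelVariation f p k) (kernelGradient p k g)
      (kernelGradientVariation p q k g) (kernelHessian p q k g b)
      (kernelGradientDeriv p q k g a) := by
  have hp := almostLipschitz_p_avg hf hk
  have hfu : AlmostLipschitz True (fun ρ x => f (avg k ρ x)) :=
    hk.k_al.avg.comp_scalar hf.cont
      (fun _ => exists_lipschitzWith_of_hasDerivAt hf.hasDeriv hf.p_bdd)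
  have hpk : AlmostLipschitz True (fun ρ (z : E d × E d) => p (avg k ρ z.2) • k z.1 z.2) :=
    .smul (hp.reparam _ exists_lipschitzWith_snd) hk.k_al
  have hpg : AlmostLipschitz True (fun ρ (z : E d × E d) => p (avg k ρ z.2) • g z.1 z.2) :=
    .smul (hp.reparam _ exists_lipschitzWith_snd) hk.g_al
  have hm := almostLipschitz_kernelHessianMain hf hk
  have hpp : AlmostLipschitz True
      (fun ρ (z : E d × E d) => p (avg k ρ z.1) + p (avg k ρ z.2)) :=
    .add (hp.reparam _ exists_lipschitzWith_fst) (hp.reparam _ exists_lipschitzWith_snd)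
  refine ⟨?_, hfu.add hpk.integral, .add (.smul hp hk.g_al.avg) hpg.integral,
    almostLipschitz_kernelGradientVariation hf hk, ?_, ?_, hasGradientAt_kernelVariation hf hk,
    hasFDerivAt_kernelGradient hf hk, hasFDerivAt_kernelGradientVariation hf hk, ?_,
    hasLinearDerivative_kernelGradient hf hk, ?_⟩
  · obtain ⟨C, hC0, hC⟩ := hfu.1
    refine ⟨C, fun ρ => ?_⟩
    simpa [kernelFunctional] using norm_integral_le_of_norm_le_const (μ := ρ.toMeasure)
      (Eventually.of_forall fun x => hC ρ x)
  · intro μ z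
    refine (hm.jointContinuous μ z).add ((hpp.jointContinuous μ z).smul ?_)
    exact (hk.b_cont.tendsto z).comp tendsto_snd
  · obtain ⟨C₁, hC₁0, hC₁⟩ := hm.1
    obtain ⟨C₂, hC₂0, hC₂⟩ := hpp.1
    obtain ⟨C₃, hC₃⟩ := hk.b_bdd
    refine ⟨C₁ + C₂ * C₃, fun ρ x x' => (norm_add_le _ _).trans (add_le_add (hC₁ ρ (x, x')) ?_)⟩
    rw [norm_smul]
    exact mul_le_mul (hC₂ ρ (x, x')) (hC₃ x x') (norm_nonneg _) hC₂0
  -- The weight `m = 1` gives the functional itself.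
  · have := hasLinearDerivative_integral (k := k) (m := fun _ => (1 : ℝ)) (P := f) (P' := p)
      hk.k_al hk.symm (.of_lipschitz (C := 1) (L := 0) (by simp) le_rfl (by simp)) hf.hasDeriv
      hf.p_cont hf.p_bdd
    simp only [smul_eq_mul, mul_one] at this
    exact this
  · intro hs
    obtain ⟨ha, hb⟩ := hk.smooth hs
    refine ⟨.add (.add (.smul ((almostLipschitz_q_avg hf hk).upgrade hs)
      (.bilinear (outer d) hk.g_al.avg hk.g_al.avg)) (.smul hp ha.avg)) ?_,
      .add (hm.upgrade hs) (hpp.smul hb)⟩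
    have hpa : AlmostLipschitz True (fun ρ (z : E d × E d) => p (avg k ρ z.2) • a z.1 z.2) :=
      .smul (hp.reparam _ exists_lipschitzWith_snd) ha
    exact hpa.integral

end kernel

/-! ### Regular functionals are `C²` in the Wasserstein sense -/

section wasserstein

variable {s : Prop} {d : ℕ}

/-- Normalisation of a first variation. -/
noncomputable def normalizeVariation {Z : Type*} [NormedAddCommGroup Z] [NormedSpace ℝ Z]
    (h : P2 d → E d → Z) (ρ : P2 d) (x : E d) : Z := h ρ x - ∫ y, h ρ y ∂ρ.toMeasure

theorem AlmostLipschitz.normalizeVariation {Z : Type*} [NormedAddCommGroup Z] [NormedSpace ℝ Z]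
    {h : P2 d → E d → Z} (ha : AlmostLipschitz s h) : AlmostLipschitz s (normalizeVariation h) :=
  ha.sub (ha.reparam (Prod.snd : E d × E d → E d) exists_lipschitzWith_snd).integral

theorem AlmostLipschitz.quadratic_growth {Z : Type*} [NormedAddCommGroup Z]
    {h : P2 d → E d → Z} (ha : AlmostLipschitz s h) :
    ∃ C : ℝ, ∀ ρ x, ‖h ρ x‖ ≤ C * (1 + ‖x‖ ^ 2) := by
  obtain ⟨C, hC0, hC⟩ := ha.1
  exact ⟨C, fun ρ x => (hC ρ x).trans (le_mul_of_one_le_right hC0 (by nlinarith [norm_nonneg x]))⟩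

theorem HasLinearDerivative.isFirstVariation {φ : P2 d → ℝ} {h : P2 d → E d → ℝ}
    (hl : HasLinearDerivative φ h) (ha : AlmostLipschitz s h) :
    IsFirstVariation φ (normalizeVariation h) where
  cont := ha.normalizeVariation.jointContinuous
  growth := by
    obtain ⟨C, hC⟩ := ha.normalizeVariation.quadratic_growth
    exact fun ν => ⟨C, hC ν⟩
  limit := fun ρ ρ' => by
    refine ((hl.sub_const (fun ρ ν => ha.integrable ρ ν)
      (fun ρ => ∫ y, h ρ y ∂ρ.toMeasure)).tendsto ρ ρ').congr fun t => ?_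
    rw [smul_eq_mul, div_eq_inv_mul]
  normalized := fun ρ => by
    simp only [_root_.normalizeVariation]
    rw [integral_sub (ha.integrable ρ ρ) (integrable_const _)]
    simp

theorem IsRegularFunctional.isWassersteinC2 {φ : P2 d → ℝ} {h : P2 d → E d → ℝ}
    {G : P2 d → E d → E d} {K : P2 d → E d → E d → E d}
    {H A : P2 d → E d → E d → (E d →L[ℝ] E d)} (r : IsRegularFunctional s φ h G K H A) :
    IsWassersteinC2 φ (normalizeVariation h) G
      (fun ρ x => normalizeVariation (fun ρ => K ρ x) ρ) H where
  c1 :=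
    { firstVariation := r.h_linear.isFirstVariation r.h_al
      hasGradient := fun ρ x => (r.h_grad ρ x).hasFDerivAt.sub_const _
      cont := r.G_al.jointContinuous
      growth := by
        obtain ⟨C, hC⟩ := r.G_al.quadratic_growth
        exact fun ν => ⟨C, hC ν⟩ }
  c1_gradient := fun x i => by
    have hK : AlmostLipschitz s (fun ρ x' => K ρ x x') :=
      r.K_al.reparam (fun x' => (x, x')) (exists_lipschitzWith_prodMk_left x)
    have e : ∀ ρ x', normalizeVariation (fun ρ => K ρ x) ρ x' i =
        normalizeVariation (fun ρ x' => EuclideanSpace.proj (𝕜 := ℝ) i (K ρ x x')) ρ x' := by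
      intro ρ x'
      rw [_root_.normalizeVariation, _root_.normalizeVariation,
        (EuclideanSpace.proj (𝕜 := ℝ) i).integral_comp_comm (hK.integrable ρ ρ)]
      rfl
    refine ⟨?_, fun ρ x' => ?_, fun ρ x' => ?_, fun ρ => ?_⟩
    · have e' : (fun ρ x' => normalizeVariation (fun ρ => K ρ x) ρ x' i) =
          normalizeVariation (fun ρ x' => EuclideanSpace.proj (𝕜 := ℝ) i (K ρ x x')) :=
        funext₂ e
      have hl := (r.K_linear x).comp_clm (EuclideanSpace.proj (𝕜 := ℝ) i)
        (fun ρ ν => hK.integrable ρ ν)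
      rw [e']
      exact hl.isFirstVariation (hK.comp_clm (EuclideanSpace.proj (𝕜 := ℝ) i))
    -- The `i`-th component of `H v` is `⟨e_i, H v⟩ = ⟨Hᵀ e_i, v⟩`, so the gradient is the `i`-th
    -- row of `H`.
    · have := (EuclideanSpace.proj (𝕜 := ℝ) i).hasFDerivAt.comp x'
        ((r.K_fderiv ρ x x').sub_const (∫ y, K ρ x y ∂ρ.toMeasure))
      refine this.congr_fderiv ?_
      ext v
      rw [InnerProductSpace.toDual_apply_apply, ContinuousLinearMap.adjoint_inner_left]
      simp [EuclideanSpace.inner_single_left]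
    · have h1 : Tendsto (fun p : P2 d × E d => (p.1, (x, p.2))) (nhdsW2 ρ ×ˢ 𝓝 x')
          (nhdsW2 ρ ×ˢ 𝓝 (x, x')) := by
        refine tendsto_fst.prodMk ?_
        rw [nhds_prod_eq]
        exact tendsto_const_nhds.prodMk tendsto_snd
      have h2 := (r.H_cont ρ (x, x')).comp h1
      have hc : Continuous fun T : E d →L[ℝ] E d =>
          ContinuousLinearMap.adjoint T (EuclideanSpace.single i (1 : ℝ)) :=
        (ContinuousLinearMap.adjoint (𝕜 := ℝ) (E := E d) (F := E d)).continuous.clm_apply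
          continuous_const
      exact (hc.tendsto _).comp h2
    · obtain ⟨C, hC⟩ := r.H_bdd
      refine ⟨C, fun y => ?_⟩
      have hC0 : 0 ≤ C := (norm_nonneg _).trans (hC ρ 0 0)
      calc _ ≤ ‖ContinuousLinearMap.adjoint (H ρ x y)‖ * ‖EuclideanSpace.single i (1 : ℝ)‖ :=
            ContinuousLinearMap.le_opNorm _ _
        _ = ‖H ρ x y‖ := by rw [LinearIsometryEquiv.norm_map]; simp
        _ ≤ C := hC ρ x y
        _ ≤ _ := le_mul_of_one_le_right hC0 (by nlinarith [norm_nonneg y])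
  cont_hessian := r.H_cont

end wasserstein

/-! ### Taylor estimates -/

/-- Mean value inequality for `f - f' x` on the ball of radius `‖y - x‖` around `x`. The constant is
`L` instead of the sharp `L / 2`, which is sufficient for every use below. -/
theorem norm_sub_sub_le_of_lipschitz_fderiv {X Y : Type*} [NormedAddCommGroup X] [NormedSpace ℝ X]
    [NormedAddCommGroup Y] [NormedSpace ℝ Y] {f : X → Y} {f' : X → X →L[ℝ] Y}
    (hf : ∀ x, HasFDerivAt f (f' x) x) {L : ℝ} (hL : ∀ x y, ‖f' x - f' y‖ ≤ L * ‖x - y‖)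
    (x y : X) : ‖f y - f x - f' x (y - x)‖ ≤ L * ‖y - x‖ ^ 2 := by
  rcases eq_or_ne x y with rfl | hxy
  · simp
  have hL0 : 0 ≤ L := by
    have h1 := (norm_nonneg _).trans (hL x y)
    have h2 : 0 < ‖x - y‖ := norm_sub_pos_iff.2 hxy
    exact nonneg_of_mul_nonneg_left h1 h2
  have h := (convex_closedBall x ‖y - x‖).norm_image_sub_le_of_norm_hasFDerivWithin_le'
    (f := f) (f' := f') (φ := f' x) (C := L * ‖y - x‖) (x := x) (y := y)
    (fun z _ => (hf z).hasFDerivWithinAt) (fun z hz => (hL z x).trans ?_)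
    (Metric.mem_closedBall_self (norm_nonneg _)) (by simp [dist_eq_norm])
  · calc _ ≤ _ := h
      _ = _ := by ring
  · rw [mem_closedBall_iff_norm] at hz
    gcongr

theorem hasFDerivAt_of_norm_sub_sub_le_sq {X Y : Type*} [NormedAddCommGroup X] [NormedSpace ℝ X]
    [NormedAddCommGroup Y] [NormedSpace ℝ Y] {f : X → Y} {f' : X →L[ℝ] Y} {x : X} {C : ℝ}
    (h : ∀ y, ‖f y - f x - f' (y - x)‖ ≤ C * ‖y - x‖ ^ 2) : HasFDerivAt f f' x := by
  rw [hasFDerivAt_iff_isLittleO]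
  refine Asymptotics.IsBigO.trans_isLittleO (g := fun y => ‖y - x‖ ^ 2) ?_
    (Asymptotics.isLittleO_pow_sub_sub x one_lt_two)
  refine Asymptotics.IsBigO.of_bound C (Eventually.of_forall fun y => ?_)
  rw [norm_pow, norm_norm]
  exact h y

/-! ### Taylor expansion of functions of the push-forward -/

section L2

variable {d : ℕ} {μ : P2 d}

/-- Triangle inequality in `L²`; the constant function `c` has norm `c` because `μ` is a probability
measure. -/
theorem norm_le_of_ae_le_add {F η : L2Space μ} {c L : ℝ} (hc : 0 ≤ c) (hL : 0 ≤ L)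
    (h : ∀ᵐ y ∂μ.toMeasure, ‖F y‖ ≤ c + L * ‖η y‖) : ‖F‖ ≤ c + L * ‖η‖ := by
  have hN : MemLp (fun y => ‖η y‖) 2 μ.toMeasure := (Lp.memLp η).norm
  have hK : MemLp (fun _ : E d => c) 2 μ.toMeasure := memLp_const c
  have h1 : ‖F‖ ≤ ‖hK.toLp _ + L • hN.toLp _‖ := by
    refine Lp.norm_le_norm_of_ae_le ?_
    filter_upwards [h, Lp.coeFn_add (hK.toLp _) (L • hN.toLp _), Lp.coeFn_smul L (hN.toLp _),
      hN.coeFn_toLp, hK.coeFn_toLp] with y hy h1 h2 h3 h4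
    rw [h1, Pi.add_apply, h2, Pi.smul_apply, h3, h4, smul_eq_mul]
    exact hy.trans (le_abs_self _)
  refine h1.trans ((norm_add_le _ _).trans (add_le_add ?_ ?_))
  · rw [Lp.norm_toLp, eLpNorm_const _ (by norm_num) (IsProbabilityMeasure.ne_zero _)]
    simp [abs_of_nonneg hc]
  · rw [norm_smul, Real.norm_of_nonneg hL, Lp.norm_toLp, eLpNorm_norm, Lp.norm_def]

theorem integrable_norm_sq (η : L2Space μ) : Integrable (fun y => ‖η y‖ ^ 2) μ.toMeasure :=
  (memLp_two_iff_integrable_sq_norm (Lp.memLp η).1).1 (Lp.memLp η)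

theorem integral_norm_sq (η : L2Space μ) : ∫ y, ‖η y‖ ^ 2 ∂μ.toMeasure = ‖η‖ ^ 2 := by
  rw [← real_inner_self_eq_norm_sq, L2.inner_def]
  simp

theorem integrable_L2 (η : L2Space μ) : Integrable (fun y => η y) μ.toMeasure :=
  (Lp.memLp η).integrable (by norm_num)

theorem integral_norm_le (η : L2Space μ) : ∫ y, ‖η y‖ ∂μ.toMeasure ≤ ‖η‖ := by
  have h := eLpNorm_le_eLpNorm_of_exponent_le (μ := μ.toMeasure) (p := 1) (q := 2) (by norm_num)
    (Lp.aestronglyMeasurable η)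
  rw [eLpNorm_one_eq_lintegral_enorm] at h
  rw [integral_norm_eq_lintegral_enorm (Lp.aestronglyMeasurable η), Lp.norm_def]
  exact ENNReal.toReal_mono (Lp.eLpNorm_ne_top η) h

theorem integrable_clm_apply {Z : Type*} [NormedAddCommGroup Z] [NormedSpace ℝ Z]
    {T : E d → (E d →L[ℝ] Z)} (hT : Continuous T) {C : ℝ} (hC : ∀ x, ‖T x‖ ≤ C)
    (ξ η : L2Space μ) : Integrable (fun y => T (ξ y) (η y)) μ.toMeasure := by
  refine ((integrable_L2 η).norm.const_mul C).mono'
    (isBoundedBilinearMap_apply.continuous.comp_aestronglyMeasurable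
      ((hT.comp_aestronglyMeasurable (Lp.aestronglyMeasurable ξ)).prodMk
        (Lp.aestronglyMeasurable η))) (Eventually.of_forall fun y => ?_)
  exact ((T (ξ y)).le_opNorm _).trans (by gcongr; exact hC _)

/-- Second order Taylor estimate for functions of the measure along a coupling. -/
theorem HasLinearDerivative.norm_sub_sub_integral_le {Z : Type*} [NormedAddCommGroup Z]
    [NormedSpace ℝ Z] {Ψ : P2 d → Z} {κ : P2 d → E d → Z} {D : P2 d → E d → (E d →L[ℝ] Z)}
    (h : HasLinearDerivative Ψ κ) (hi : ∀ ρ ν : P2 d, Integrable (κ ρ) ν.toMeasure)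
    (hD : ∀ ρ x, HasFDerivAt (κ ρ) (D ρ x) x) {C L : ℝ} (hC : ∀ ρ x, ‖D ρ x‖ ≤ C) (hL0 : 0 ≤ L)
    (hL : ∀ ρ ρ' x x', ‖D ρ x - D ρ' x'‖ ≤ L * (wass 1 ρ ρ' + dist x x')) (ξ ξ' : L2Space μ) :
    ‖Ψ (pushforward μ ξ') - Ψ (pushforward μ ξ) -
      ∫ y, D (pushforward μ ξ) (ξ y) ((ξ' - ξ) y) ∂μ.toMeasure‖ ≤ 2 * L * ‖ξ' - ξ‖ ^ 2 := by
  set ρ := pushforward μ ξ with hρ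
  set ρ' := pushforward μ ξ' with hρ'
  set w := ∫ y, D ρ (ξ y) ((ξ' - ξ) y) ∂μ.toMeasure with hw
  obtain ⟨Θ, h1, h2⟩ := h ρ ρ'
  have e0 := h1 0
  have e1 := h1 1
  rw [mix_zero] at e0
  rw [mix_one] at e1
  have hLx : ∀ ρ x x', ‖D ρ x - D ρ x'‖ ≤ L * ‖x - x'‖ := fun ρ x x' => by
    have := hL ρ ρ x x'
    rwa [wass_one_self, zero_add, dist_eq_norm] at this
  have hDc : ∀ ρ, Continuous (D ρ) := fun ρ =>
    (LipschitzWith.of_dist_le_mul (K := ⟨L, hL0⟩) (fun x x' => by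
      rw [dist_eq_norm, dist_eq_norm]; exact hLx ρ x x')).continuous
  have hκc : ∀ ρ, Continuous (κ ρ) := fun ρ =>
    continuous_iff_continuousAt.2 fun x => (hD ρ x).continuousAt
  -- At the intermediate measure `σ` two errors arise, each at most `L ‖ξ' - ξ‖²`: the Taylor
  -- remainder of `κ σ` from `ξ y` to `ξ' y`, and the replacement of `D σ` by `D ρ`, for which
  -- `W₁(σ, ρ) ≤ ‖ξ' - ξ‖`.
  have hbound : ∀ t : unitInterval, ‖(∫ x, κ (mix ρ ρ' t) x ∂ρ'.toMeasure) -
      (∫ x, κ (mix ρ ρ' t) x ∂ρ.toMeasure) - w‖ ≤ 2 * L * ‖ξ' - ξ‖ ^ 2 := by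
    intro t
    set σ := mix ρ ρ' t
    have hm : ∀ ζ : L2Space μ, ∫ x, κ σ x ∂(pushforward μ ζ).toMeasure =
        ∫ y, κ σ (ζ y) ∂μ.toMeasure := fun ζ =>
      integral_map (Lp.aestronglyMeasurable ζ).aemeasurable (hκc σ).aestronglyMeasurable
    have hin : ∀ ζ : L2Space μ, Integrable (fun y => κ σ (ζ y)) μ.toMeasure := fun ζ =>
      (hi σ (pushforward μ ζ)).comp_aemeasurable (Lp.aestronglyMeasurable ζ).aemeasurable
    have hW : wass 1 σ ρ ≤ ‖ξ' - ξ‖ := (wass_one_mix_le ρ ρ' t).trans (wass_one_pushforward_le _ _)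
    rw [hm ξ', hm ξ, ← integral_sub (hin ξ') (hin ξ), hw,
      ← integral_sub (f := fun y => κ σ (ξ' y) - κ σ (ξ y)) ((hin ξ').sub (hin ξ))
        (integrable_clm_apply (hDc ρ) (hC ρ) _ _)]
    have ib : Integrable (fun y => L * ‖(ξ' - ξ) y‖ ^ 2 + L * ‖ξ' - ξ‖ * ‖(ξ' - ξ) y‖)
        μ.toMeasure :=
      ((integrable_norm_sq _).const_mul L).add ((integrable_L2 _).norm.const_mul _)
    refine (norm_integral_le_of_norm_le ib ?_).trans ?_
    · filter_upwards [Lp.coeFn_sub ξ' ξ] with y hy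
      rw [hy, Pi.sub_apply]
      have t1 := norm_sub_sub_le_of_lipschitz_fderiv (hD σ) (hLx σ) (ξ y) (ξ' y)
      have t2 : ‖(D σ (ξ y) - D ρ (ξ y)) (ξ' y - ξ y)‖ ≤ L * ‖ξ' - ξ‖ * ‖ξ' y - ξ y‖ := by
        refine (ContinuousLinearMap.le_opNorm _ _).trans ?_
        gcongr
        refine (hL σ ρ _ _).trans ?_
        rw [dist_self, add_zero]
        gcongr
      rw [sub_apply] at t2
      calc _ = ‖(κ σ (ξ' y) - κ σ (ξ y) - D σ (ξ y) (ξ' y - ξ y)) +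
            (D σ (ξ y) (ξ' y - ξ y) - D ρ (ξ y) (ξ' y - ξ y))‖ := by congr 1; abel
        _ ≤ _ := (norm_add_le _ _).trans (add_le_add t1 t2)
    · rw [integral_add ((integrable_norm_sq _).const_mul L) ((integrable_L2 _).norm.const_mul _),
        integral_const_mul, integral_const_mul, integral_norm_sq]
      have : L * ‖ξ' - ξ‖ * ∫ y, ‖(ξ' - ξ) y‖ ∂μ.toMeasure ≤ L * ‖ξ' - ξ‖ * ‖ξ' - ξ‖ := by
        gcongr
        exact integral_norm_le _
      nlinarith
  -- The mean value inequality for `Θ t - t w` on `[0,1]` compares the true increment with `w`. The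
  -- projection onto `[0,1]` only serves to make the derivative a function of a real variable.
  have key := (convex_Icc (0 : ℝ) 1).norm_image_sub_le_of_norm_hasDerivWithin_le
    (f := fun t => Θ t - t • w) (f' := fun t => (∫ x, κ (mix ρ ρ' (Set.projIcc 0 1 zero_le_one t)) x
      ∂ρ'.toMeasure) - (∫ x, κ (mix ρ ρ' (Set.projIcc 0 1 zero_le_one t)) x ∂ρ.toMeasure) - w)
    (C := 2 * L * ‖ξ' - ξ‖ ^ 2) (x := 0) (y := 1) (fun t ht => ?_) (fun t _ => hbound _)
    (by simp) (by simp)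
  · simp only [one_smul, zero_smul, sub_zero, norm_one, mul_one] at key
    rw [e0, e1]
    simp only [Set.Icc.coe_one, Set.Icc.coe_zero]
    rwa [sub_right_comm]
  · have h3 := h2 ⟨t, ht⟩
    rw [Set.projIcc_of_mem zero_le_one ht]
    have h4 : HasDerivAt (fun t : ℝ => t • w) w t := by
      simpa using (hasDerivAt_id t).smul_const w
    exact (h3.sub h4).hasDerivWithinAt

/-! ### The gradient of the lift -/

theorem AlmostLipschitz.memLp_comp {s : Prop} {G : P2 d → E d → E d} (hG : AlmostLipschitz s G)
    (ξ : L2Space μ) : MemLp (fun y => G (pushforward μ ξ) (ξ y)) 2 μ.toMeasure := by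
  obtain ⟨C, -, hC⟩ := hG.1
  exact MemLp.of_bound ((hG.continuous _).comp_aestronglyMeasurable (Lp.aestronglyMeasurable ξ)) C
    (Eventually.of_forall fun y => hC _ _)

/-- The map `ξ ↦ G(ξ_# μ, ξ(·))`. -/
noncomputable def lagrangianField {s : Prop} {G : P2 d → E d → E d} (hG : AlmostLipschitz s G)
    (ξ : L2Space μ) : L2Space μ := (hG.memLp_comp ξ).toLp _

theorem coeFn_lagrangianField {s : Prop} {G : P2 d → E d → E d} (hG : AlmostLipschitz s G)
    (ξ : L2Space μ) :
    lagrangianField hG ξ =ᵐ[μ.toMeasure] fun y => G (pushforward μ ξ) (ξ y) :=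
  (hG.memLp_comp ξ).coeFn_toLp

theorem exists_lagrangianField_ae_le {s : Prop} {G : P2 d → E d → E d}
    (hG : AlmostLipschitz s G) : ∃ C ≥ 0, ∀ (μ : P2 d) (ξ : L2Space μ),
      ∀ᵐ y ∂μ.toMeasure, ‖lagrangianField hG ξ y‖ ≤ C := by
  obtain ⟨C, hC0, hC⟩ := hG.1
  refine ⟨C, hC0, fun μ ξ => ?_⟩
  filter_upwards [coeFn_lagrangianField hG ξ] with y hy
  rw [hy]
  exact hC _ _

theorem exists_lagrangianField_bound {s : Prop} {G : P2 d → E d → E d}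
    (hG : AlmostLipschitz s G) : ∃ C ≥ 0, ∀ (μ : P2 d) (ξ : L2Space μ),
      ‖lagrangianField hG ξ‖ ≤ C := by
  obtain ⟨C, hC0, hC⟩ := exists_lagrangianField_ae_le hG
  refine ⟨C, hC0, fun μ ξ => ?_⟩
  have := norm_le_of_ae_le_add (F := lagrangianField hG ξ) (η := 0) hC0 le_rfl
    (by simpa using hC μ ξ)
  simpa using this

theorem exists_lagrangianField_sub_ae_le {G : P2 d → E d → E d} (hG : AlmostLipschitz True G) :
    ∃ L ≥ 0, ∀ (μ : P2 d) (ξ η : L2Space μ), ∀ᵐ y ∂μ.toMeasure,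
      ‖(lagrangianField hG ξ - lagrangianField hG η) y‖ ≤ L * ‖ξ - η‖ + L * ‖(ξ - η) y‖ := by
  obtain ⟨L, hL0, hL⟩ := hG.lipschitz
  refine ⟨L, hL0, fun μ ξ η => ?_⟩
  filter_upwards [coeFn_lagrangianField hG ξ, coeFn_lagrangianField hG η,
    Lp.coeFn_sub (lagrangianField hG ξ) (lagrangianField hG η), Lp.coeFn_sub ξ η] with y h1 h2 h3 h4
  rw [h3, h4, Pi.sub_apply, Pi.sub_apply, h1, h2, ← mul_add]
  refine (hL _ _ _ _).trans ?_
  rw [dist_eq_norm]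
  gcongr
  exact wass_one_pushforward_le ξ η

theorem exists_lagrangianField_lipschitz {G : P2 d → E d → E d} (hG : AlmostLipschitz True G) :
    ∃ L ≥ 0, ∀ (μ : P2 d) (ξ η : L2Space μ),
      ‖lagrangianField hG ξ - lagrangianField hG η‖ ≤ L * ‖ξ - η‖ := by
  obtain ⟨L, hL0, hL⟩ := exists_lagrangianField_sub_ae_le hG
  refine ⟨L + L, by positivity, fun μ ξ η => ?_⟩
  refine (norm_le_of_ae_le_add (by positivity) hL0 (hL μ ξ η)).trans (le_of_eq ?_)
  ring

variable {s : Prop} {φ : P2 d → ℝ} {h : P2 d → E d → ℝ} {G : P2 d → E d → E d}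
  {K : P2 d → E d → E d → E d} {H A : P2 d → E d → E d → (E d →L[ℝ] E d)}

/-- The Taylor estimate along the coupling, with `D = ⟨G, ·⟩`, has a quadratic remainder and
therefore gives Fréchet differentiability; its linear term is an inner product in `L²(μ)`. -/
theorem IsRegularFunctional.hasGradientAt_liftFun (r : IsRegularFunctional s φ h G K H A)
    (ξ : L2Space μ) : HasGradientAt (liftFun φ μ) (lagrangianField r.G_al ξ) ξ := by
  obtain ⟨L, hL0, hL⟩ := r.G_al.lipschitz
  obtain ⟨C, hC0, hC⟩ := r.G_al.1
  refine hasFDerivAt_of_norm_sub_sub_le_sq (C := 2 * L) fun ξ' => ?_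
  have key := r.h_linear.norm_sub_sub_integral_le (μ := μ) (D := fun ρ x => innerSL ℝ (G ρ x))
    (fun ρ ν => r.h_al.integrable ρ ν) (fun ρ x => (r.h_grad ρ x).hasFDerivAt) (C := C) (L := L)
    (fun ρ x => (innerSL_apply_norm ℝ (G ρ x)).le.trans (hC ρ x)) hL0
    (fun ρ ρ' x x' => by
      rw [← map_sub, innerSL_apply_norm]
      exact hL ρ ρ' x x') ξ ξ'
  convert key using 2
  refine congrArg₂ (· - ·) rfl ?_
  rw [InnerProductSpace.toDual_apply_apply, L2.inner_def]
  refine integral_congr_ae ?_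
  filter_upwards [coeFn_lagrangianField r.G_al ξ] with y hy
  rw [hy, innerSL_apply_apply]

theorem IsRegularFunctional.gradient_liftFun (r : IsRegularFunctional s φ h G K H A) :
    gradient (liftFun φ μ) = lagrangianField r.G_al :=
  funext fun ξ => (r.hasGradientAt_liftFun ξ).gradient

theorem IsRegularFunctional.isC1Holder_liftFun (r : IsRegularFunctional s φ h G K H A) :
    IsC1Holder 1 (liftFun φ μ) := by
  obtain ⟨L, hL0, hL⟩ := exists_lagrangianField_lipschitz r.G_al
  refine ⟨fun ξ => (r.hasGradientAt_liftFun ξ).differentiableAt, L + 1, by positivity,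
    fun ξ η => ?_⟩
  rw [r.gradient_liftFun, Real.rpow_one]
  refine (hL μ ξ η).trans ?_
  gcongr
  linarith

theorem IsRegularFunctional.isC1HolderBdd_liftFun (r : IsRegularFunctional s φ h G K H A) :
    IsC1HolderBdd 1 (liftFun φ μ) := by
  obtain ⟨C, hC0, hC⟩ := exists_lagrangianField_bound r.G_al
  obtain ⟨C', hC'⟩ := r.bdd
  refine ⟨r.isC1Holder_liftFun, C' + C, fun ξ => ?_⟩
  rw [r.gradient_liftFun]
  exact add_le_add (hC' _) (hC μ ξ)

end L2

/-! ### Bounded Lipschitz vector fields -/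

/-- A field bounded by `M` moves points by at most `M (n + 1)` during a time `n + 1`, so
Picard–Lindelöf applies on `[-(n+1), n+1]` with the ball of that radius. Uniqueness glues the
solutions. -/
theorem exists_global_solution {X : Type*} [NormedAddCommGroup X] [NormedSpace ℝ X]
    [CompleteSpace X] {F : X → X} {K M : ℝ≥0} (hK : LipschitzWith K F) (hM : ∀ x, ‖F x‖ ≤ M)
    (x₀ : X) : ∃ α : ℝ → X, α 0 = x₀ ∧ ∀ t, HasDerivAt α (F (α t)) t := by
  have hex : ∀ n : ℕ, ∃ α : ℝ → X, α 0 = x₀ ∧ ∀ t ∈ Set.Ioo (-(n + 1 : ℝ)) (n + 1),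
      HasDerivAt α (F (α t)) t := by
    intro n
    have h0 : (0 : ℝ) ∈ Set.Icc (-(n + 1 : ℝ)) (n + 1) :=
      ⟨by linarith [n.cast_nonneg (α := ℝ)], by positivity⟩
    have hp : IsPicardLindelof (fun _ => F) (⟨0, h0⟩ : Set.Icc (-(n + 1 : ℝ)) (n + 1)) x₀
        (M * (n + 1)) 0 M K :=
      .of_time_independent (fun x _ => hM x) hK.lipschitzOnWith (by simp)
    obtain ⟨α, ha, hα⟩ := hp.exists_eq_forall_mem_Icc_hasDerivWithinAt₀
    exact ⟨α, ha, fun t ht => (hα t (Set.Ioo_subset_Icc_self ht)).hasDerivAt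
      (Icc_mem_nhds ht.1 ht.2)⟩
  choose α h0 hα using hex
  have hEq : ∀ n m : ℕ, n ≤ m → Set.EqOn (α n) (α m) (Set.Ioo (-(n + 1 : ℝ)) (n + 1)) := by
    intro n m hnm
    have hnm' : (n : ℝ) ≤ m := by exact_mod_cast hnm
    refine ODE_solution_unique_of_mem_Ioo (v := fun _ => F) (s := fun _ => Set.univ) (t₀ := 0)
      (fun t _ => hK.lipschitzOnWith) ⟨by linarith [n.cast_nonneg (α := ℝ)], by positivity⟩
      (fun t ht => ⟨hα n t ht, trivial⟩)
      (fun t ht => ⟨hα m t ⟨by linarith [ht.1], by linarith [ht.2]⟩, trivial⟩) ?_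
    rw [h0, h0]
  -- The interval with index `⌈|t|⌉` has half-length `⌈|t|⌉ + 1 > |t|`, so `t` is interior to it. At
  -- nearby times the index may differ, but the two solutions agree there.
  refine ⟨fun t => α ⌈|t|⌉₊ t, h0 _, fun t => ?_⟩
  have hmem : ∀ t : ℝ, t ∈ Set.Ioo (-(⌈|t|⌉₊ + 1 : ℝ)) (⌈|t|⌉₊ + 1) := fun t => by
    have := Nat.le_ceil |t|
    exact abs_lt.1 (by linarith)
  refine (hα _ t (hmem t)).congr_of_eventuallyEq ?_
  filter_upwards [isOpen_Ioo.mem_nhds (hmem t)] with r hr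
  rcases le_total ⌈|t|⌉₊ ⌈|r|⌉₊ with h | h
  · exact (hEq _ _ h hr).symm
  · exact hEq _ _ h (hmem r)

theorem eqOn_Ici_of_hasDerivWithinAt {X : Type*} [NormedAddCommGroup X] [NormedSpace ℝ X]
    {F : X → X} {K : ℝ≥0} (hK : LipschitzWith K F) {α β : ℝ → X} (h0 : α 0 = β 0)
    (hα : ∀ t, 0 ≤ t → HasDerivWithinAt α (F (α t)) (Set.Ici 0) t)
    (hβ : ∀ t, 0 ≤ t → HasDerivWithinAt β (F (β t)) (Set.Ici 0) t) :
    Set.EqOn α β (Set.Ici 0) := fun t ht =>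
  ODE_solution_unique (v := fun _ => F) (a := 0) (b := t) (fun _ => hK)
    (fun r hr => (hα r hr.1).continuousWithinAt.mono Set.Icc_subset_Ici_self)
    (fun r hr => (hα r hr.1).mono (Set.Ici_subset_Ici.2 hr.1))
    (fun r hr => (hβ r hr.1).continuousWithinAt.mono Set.Icc_subset_Ici_self)
    (fun r hr => (hβ r hr.1).mono (Set.Ici_subset_Ici.2 hr.1)) h0 ⟨ht, le_rfl⟩

/-! ### The trapezoidal scheme in a Hilbert space -/

theorem existsUnique_sequence {X : Type*} {P : X → X → Prop} (h : ∀ x, ∃! y, P x y) (x₀ : X) :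
    ∃! Y : ℕ → X, Y 0 = x₀ ∧ ∀ n, P (Y n) (Y (n + 1)) := by
  choose g hg hu using h
  refine ⟨fun n => Nat.rec x₀ (fun _ y => g y) n, ⟨rfl, fun n => hg _⟩, fun Z hZ => ?_⟩
  funext n
  induction n with
  | zero => exact hZ.1
  | succ n ih =>
    have := hu _ _ (hZ.2 n)
    rw [this, ih]

section scheme

variable {X : Type*} [NormedAddCommGroup X] [InnerProductSpace ℝ X]
  {Φ : X → ℝ} {g : X → X} {L τ : ℝ}

/-- The right-hand side has Lipschitz constant `τL/2 ≤ 1/2` in `ξ`. -/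
theorem existsUnique_trapezoidal_step [CompleteSpace X]
    (hL : ∀ x y, ‖g x - g y‖ ≤ L * ‖x - y‖) (hτ : 0 < τ)
    (hτL : τ * L ≤ 1) (Y : X) : ∃! ξ, ξ = Y - (τ / 2) • (g ξ + g Y) := by
  have hc : ContractingWith (1 / 2) (fun ξ => Y - (τ / 2) • (g ξ + g Y)) := by
    refine ⟨by rw [← NNReal.coe_lt_coe]; norm_num, LipschitzWith.of_dist_le_mul fun x y => ?_⟩
    have e : Y - (τ / 2) • (g x + g Y) - (Y - (τ / 2) • (g y + g Y)) =
        -((τ / 2) • (g x - g y)) := by module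
    rw [dist_eq_norm, dist_eq_norm, e, norm_neg, norm_smul, Real.norm_of_nonneg (by positivity)]
    calc τ / 2 * ‖g x - g y‖ ≤ τ / 2 * (L * ‖x - y‖) := by gcongr; exact hL x y
      _ = τ * L * (‖x - y‖ / 2) := by ring
      _ ≤ 1 * (‖x - y‖ / 2) := by gcongr
      _ = _ := by simp; ring
  refine ⟨hc.fixedPoint, hc.fixedPoint_isFixedPt.symm, fun ξ hξ => hc.fixedPoint_unique hξ.symm⟩

/-- The equation is the first order condition. It is also sufficient without convexity of `Φ`: half
of the Taylor remainder `L ‖ζ - ξ‖²` is absorbed by the penalty `‖ζ - ξ‖² / (2τ)` because `τL ≤ 1`.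
-/
theorem isMinOn_trapezoidal_iff [CompleteSpace X] (hΦ : ∀ x, HasGradientAt Φ (g x) x)
    (hL : ∀ x y, ‖g x - g y‖ ≤ L * ‖x - y‖) (hτ : 0 < τ) (hτL : τ * L ≤ 1) (Y ξ : X) :
    IsMinOn (fun ξ : X => (1 / 2) * Φ ξ + (1 / 2) * inner ℝ (g Y) ξ +
      (1 / (2 * τ)) * ‖ξ - Y‖ ^ 2) Set.univ ξ ↔ ξ = Y - (τ / 2) • (g ξ + g Y) := by
  have hcrit : ξ = Y - (τ / 2) • (g ξ + g Y) ↔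
      (1 / 2 : ℝ) • g ξ + (1 / 2 : ℝ) • g Y + (1 / τ) • (ξ - Y) = 0 := by
    have e : (1 / 2 : ℝ) • g ξ + (1 / 2 : ℝ) • g Y + (1 / τ) • (ξ - Y) =
        (1 / τ) • (ξ - (Y - (τ / 2) • (g ξ + g Y))) := by
      have : (1 / τ) * (τ / 2) = 1 / 2 := by field_simp
      simp only [smul_sub, smul_add, smul_smul, this]
      abel
    rw [e, smul_eq_zero, sub_eq_zero]
    simp [hτ.ne']
  rw [hcrit]
  constructor
  · intro hmin
    have hd : HasFDerivAt (fun ξ : X => (1 / 2) * Φ ξ + (1 / 2) * inner ℝ (g Y) ξ +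
        (1 / (2 * τ)) * ‖ξ - Y‖ ^ 2) (innerSL ℝ
        ((1 / 2 : ℝ) • g ξ + (1 / 2 : ℝ) • g Y + (1 / τ) • (ξ - Y))) ξ := by
      have h1 := (hΦ ξ).hasFDerivAt.const_mul (1 / 2)
      have h2 := (innerSL ℝ (g Y)).hasFDerivAt (x := ξ) |>.const_mul (1 / 2)
      have h3 := ((hasFDerivAt_id ξ).sub_const Y).norm_sq.const_mul (1 / (2 * τ))
      refine ((h1.add h2).add h3).congr_fderiv ?_
      ext v
      simp
      field_simp
    have h0 := (hmin.isLocalMin univ_mem).hasFDerivAt_eq_zero hd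
    have := congrArg (fun T => T ((1 / 2 : ℝ) • g ξ + (1 / 2 : ℝ) • g Y + (1 / τ) • (ξ - Y))) h0
    simpa only [innerSL_apply_apply, zero_apply, inner_self_eq_zero] using this
  · intro h0 ζ _
    have h1 := norm_sub_sub_le_of_lipschitz_fderiv (f := Φ) (f' := fun x => innerSL ℝ (g x))
      (L := L) (fun x => (hΦ x).hasFDerivAt) (fun x y => by
        rw [← map_sub, innerSL_apply_norm]; exact hL x y) ξ ζ
    rw [innerSL_apply_apply] at h1
    have h2 := (abs_le.1 h1).1
    have h3 : ‖ζ - Y‖ ^ 2 = ‖ξ - Y‖ ^ 2 + 2 * inner ℝ (ξ - Y) (ζ - ξ) + ‖ζ - ξ‖ ^ 2 := by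
      rw [← norm_add_sq_real]
      congr 2
      abel
    have h4 : (1 / 2) * inner ℝ (g ξ) (ζ - ξ) + (1 / 2) * inner ℝ (g Y) (ζ - ξ) +
        (1 / τ) * inner ℝ (ξ - Y) (ζ - ξ) = 0 := by
      have := congrArg (fun x => inner ℝ x (ζ - ξ)) h0
      simpa [inner_add_left, inner_smul_left] using this
    have h5 : inner ℝ (g Y) (ζ - ξ) = inner ℝ (g Y) ζ - inner ℝ (g Y) ξ := inner_sub_right _ _ _
    have h6 : L / 2 * ‖ζ - ξ‖ ^ 2 ≤ 1 / (2 * τ) * ‖ζ - ξ‖ ^ 2 := by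
      refine mul_le_mul_of_nonneg_right ?_ (by positivity)
      rw [div_le_div_iff₀ (by norm_num) (by positivity)]
      linarith
    have h7 : 1 / (2 * τ) * (2 * inner ℝ (ξ - Y) (ζ - ξ)) = (1 / τ) * inner ℝ (ξ - Y) (ζ - ξ) := by
      field_simp
    simp only [Set.mem_ofPred_eq]
    rw [h3, mul_add, mul_add, h7]
    linarith

/-- One step of the trapezoidal rule along a curve whose velocity `X₁` has the Taylor constant `c`
with derivative `X₂`. -/
theorem norm_trapezoidal_rule_le {α X₁ X₂ : ℝ → X} {T c : ℝ}
    (hα : ∀ t, 0 ≤ t → HasDerivWithinAt α (X₁ t) (Set.Ici 0) t)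
    (hc : ∀ t ∈ Set.Icc 0 T, ∀ s ∈ Set.Icc 0 T,
      ‖X₁ t - X₁ s - (t - s) • X₂ s‖ ≤ c * |t - s| ^ 2) (hc0 : 0 ≤ c) (hτ : 0 < τ) {t : ℝ}
    (ht : 0 ≤ t) (htT : t + τ ≤ T) :
    ‖α (t + τ) - α t - (τ / 2) • (X₁ t + X₁ (t + τ))‖ ≤ 3 / 2 * c * τ ^ 3 := by
  have htm : t ∈ Set.Icc 0 T := ⟨ht, by linarith⟩
  have h1 := hc (t + τ) ⟨by linarith, htT⟩ t htm
  rw [add_sub_cancel_left, abs_of_pos hτ] at h1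
  -- The curve is compared with its quadratic Taylor polynomial at `t`; the velocities differ by at
  -- most `c τ²`, the endpoints therefore by `c τ³`.
  have h2 := (convex_Icc t (t + τ)).norm_image_sub_le_of_norm_hasDerivWithin_le
    (f := fun r => α r - ((r - t) • X₁ t + ((r - t) ^ 2 / 2) • X₂ t))
    (f' := fun r => X₁ r - (X₁ t + (r - t) • X₂ t)) (C := c * τ ^ 2) (x := t) (y := t + τ)
    (fun r hr => ?_) (fun r hr => ?_) ⟨le_rfl, by linarith⟩ ⟨by linarith, le_rfl⟩
  · simp only [add_sub_cancel_left, sub_self, zero_smul, ne_eq, OfNat.ofNat_ne_zero,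
      not_false_eq_true, zero_pow, zero_div, add_zero, sub_zero, Real.norm_of_nonneg hτ.le] at h2
    -- Expanding `X₁ (t + τ)` costs another `(τ / 2) c τ²`, which explains the factor `3 / 2`.
    have e : α (t + τ) - α t - (τ / 2) • (X₁ t + X₁ (t + τ)) =
        (α (t + τ) - (τ • X₁ t + (τ ^ 2 / 2) • X₂ t) - α t) -
        (τ / 2) • (X₁ (t + τ) - X₁ t - τ • X₂ t) := by module
    rw [e]
    refine (norm_sub_le _ _).trans ?_
    rw [norm_smul, Real.norm_of_nonneg (by positivity)]
    have h3 : τ / 2 * ‖X₁ (t + τ) - X₁ t - τ • X₂ t‖ ≤ τ / 2 * (c * τ ^ 2) := by gcongr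
    linarith
  · have h3 : HasDerivAt (fun r : ℝ => (r - t) • X₁ t) (X₁ t) r := by
      simpa using ((hasDerivAt_id r).sub_const t).smul_const (X₁ t)
    have h4 : HasDerivAt (fun r : ℝ => ((r - t) ^ 2 / 2) • X₂ t) ((r - t) • X₂ t) r := by
      have := ((((hasDerivAt_id r).sub_const t).pow 2).div_const 2).smul_const (X₂ t)
      simpa using this
    exact ((hα r (ht.trans hr.1)).mono (fun x hx => ht.trans hx.1)).sub
      (h3.add h4).hasDerivWithinAt
  · have h3 := hc r ⟨by linarith [hr.1], by linarith [hr.2]⟩ t htm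
    rw [← sub_sub]
    refine h3.trans ?_
    rw [sq_abs]
    have : 0 ≤ r - t := by linarith [hr.1]
    gcongr
    linarith [hr.2]

/-- The implicit term is absorbed on the left. For `0 ≤ z = τL ≤ 1` one has `1 + z/2 ≤ (1 - z/2)(1 +
2z)` and `1 ≤ 2 (1 - z/2)`. -/
theorem trapezoidal_error_step (hL : ∀ x y, ‖g x - g y‖ ≤ L * ‖x - y‖) (hL0 : 0 ≤ L) (hτ : 0 < τ)
    (hτL : τ * L ≤ 1) {x x' y y' : X} {δ : ℝ}
    (hx : ‖x' - x - (τ / 2) • (-g x + -g x')‖ ≤ δ) (hy : y' = y - (τ / 2) • (g y' + g y)) :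
    ‖x' - y'‖ ≤ (1 + 2 * τ * L) * ‖x - y‖ + 2 * δ := by
  have e : x' - y' = (x - y) + (x' - x - (τ / 2) • (-g x + -g x')) -
      (τ / 2) • ((g x - g y) + (g x' - g y')) := by
    nth_rw 1 [hy]
    module
  have h1 : ‖x' - y'‖ ≤ ‖x - y‖ + δ + τ / 2 * (L * ‖x - y‖ + L * ‖x' - y'‖) := by
    rw [e]
    refine (norm_sub_le _ _).trans (add_le_add ((norm_add_le _ _).trans (by gcongr)) ?_)
    rw [norm_smul, Real.norm_of_nonneg (by positivity)]
    rw [← e]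
    gcongr
    exact (norm_add_le _ _).trans (add_le_add (hL _ _) (hL _ _))
  have hδ : 0 ≤ δ := (norm_nonneg _).trans hx
  have hz : 0 ≤ τ * L := by positivity
  set z := τ * L with hzdef
  have h2 : (1 - z / 2) * ‖x' - y'‖ ≤ (1 + z / 2) * ‖x - y‖ + δ := by
    have : τ / 2 * (L * ‖x - y‖ + L * ‖x' - y'‖) = z / 2 * ‖x - y‖ + z / 2 * ‖x' - y'‖ := by
      rw [hzdef]; ring
    linarith
  have h3 : (1 + z / 2) * ‖x - y‖ ≤ (1 - z / 2) * ((1 + 2 * z) * ‖x - y‖) := by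
    rw [← mul_assoc]
    gcongr
    nlinarith
  have h4 : δ ≤ (1 - z / 2) * (2 * δ) := by nlinarith
  have h5 : (1 - z / 2) * ‖x' - y'‖ ≤ (1 - z / 2) * ((1 + 2 * z) * ‖x - y‖ + 2 * δ) := by
    rw [mul_add]; linarith
  have h6 := le_of_mul_le_mul_left h5 (by linarith)
  rwa [mul_assoc 2 τ L]

/-- Second order convergence of the trapezoidal scheme. -/
theorem trapezoidal_scheme_error (hL : ∀ x y, ‖g x - g y‖ ≤ L * ‖x - y‖) (hL0 : 0 ≤ L) (hτ : 0 < τ)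
    (hτL : τ * L ≤ 1) {α X₂ : ℝ → X} {T c : ℝ}
    (hα : ∀ t, 0 ≤ t → HasDerivWithinAt α (-g (α t)) (Set.Ici 0) t)
    (hc : ∀ t ∈ Set.Icc 0 T, ∀ s ∈ Set.Icc 0 T,
      ‖-g (α t) - -g (α s) - (t - s) • X₂ s‖ ≤ c * |t - s| ^ 2) (hc0 : 0 ≤ c) {Y : ℕ → X}
    (hY : ∀ n, Y (n + 1) = Y n - (τ / 2) • (g (Y (n + 1)) + g (Y n))) (n : ℕ) (hn : n * τ ≤ T) :
    ‖α (n * τ) - Y n‖ ≤ Real.exp (2 * L * T) * ‖Y 0 - α 0‖ +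
      2 * (c / L) * (Real.exp (2 * L * T) - 1) * τ ^ 2 := by
  -- Discrete Gronwall in closed form; the exponential enters only at the end.
  have hb : ‖α (n * τ) - Y n‖ ≤ (1 + 2 * τ * L) ^ n * ‖Y 0 - α 0‖ +
      2 * (c / L) * ((1 + 2 * τ * L) ^ n - 1) * τ ^ 2 := by
    induction n with
    | zero => simp [norm_sub_rev]
    | succ n ih =>
      have hn' : (n : ℝ) * τ + τ ≤ T := by
        have : ((n + 1 : ℕ) : ℝ) * τ = n * τ + τ := by push_cast; ring
        linarith
      have ht : 0 ≤ (n : ℝ) * τ := by positivity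
      have ih' := ih (by linarith)
      have et : ((n + 1 : ℕ) : ℝ) * τ = n * τ + τ := by push_cast; ring
      rw [et]
      -- If `L = 0`, then `c / L = 0` in Lean and no consistency error is allowed. Indeed `g` is
      -- then constant, and the local estimate holds with `c = 0` and zero acceleration.
      rcases eq_or_lt_of_le hL0 with h0 | hpos
      · have hconst : ∀ x y, g x = g y := fun x y => by
          have := hL x y
          rw [← h0, zero_mul] at this
          exact sub_eq_zero.1 (norm_le_zero_iff.1 this)
        have h1 := norm_trapezoidal_rule_le (X₁ := fun t => -g (α t)) (X₂ := fun _ => 0) (T := T)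
          (c := 0) hα (fun t _ s _ => by simp [hconst (α t) (α s)]) le_rfl hτ ht hn'
        have h2 := trapezoidal_error_step hL hL0 hτ hτL h1 (hY n)
        simp only [← h0, mul_zero, add_zero, one_mul, one_pow, zero_mul, div_zero] at h2 ih' ⊢
        linarith
      · have h1 := norm_trapezoidal_rule_le (X₁ := fun t => -g (α t)) hα hc hc0 hτ ht hn'
        have h2 := trapezoidal_error_step hL hL0 hτ hτL h1 (hY n)
        have h3 : 0 ≤ 1 + 2 * τ * L := by positivity
        have h4 := mul_le_mul_of_nonneg_left ih' h3
        refine h2.trans ((add_le_add_left h4 _).trans ?_)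
        rw [pow_succ (1 + 2 * τ * L) n]
        -- The closed form leaves room for `4cτ³` per step; the local error contributes `2 ·
        -- (3/2)cτ³ = 3cτ³`.
        have e1 : 2 * (c / L) * (2 * τ * L) * τ ^ 2 = 4 * c * τ ^ 3 := by field_simp; ring
        have h5 : 0 ≤ c * τ ^ 3 := by positivity
        have e2 : (1 + 2 * τ * L) ^ n * (1 + 2 * τ * L) * ‖Y 0 - α 0‖ +
            2 * (c / L) * ((1 + 2 * τ * L) ^ n * (1 + 2 * τ * L) - 1) * τ ^ 2 =
            (1 + 2 * τ * L) * ((1 + 2 * τ * L) ^ n * ‖Y 0 - α 0‖ +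
            2 * (c / L) * ((1 + 2 * τ * L) ^ n - 1) * τ ^ 2) +
            2 * (c / L) * (2 * τ * L) * τ ^ 2 := by ring
        linarith
  have hq : (1 + 2 * τ * L) ^ n ≤ Real.exp (2 * L * T) := by
    have h1 : 1 + 2 * τ * L ≤ Real.exp (2 * τ * L) := by linarith [Real.add_one_le_exp (2 * τ * L)]
    calc (1 + 2 * τ * L) ^ n ≤ Real.exp (2 * τ * L) ^ n := by gcongr
      _ = Real.exp (2 * L * (n * τ)) := by rw [← Real.exp_nat_mul]; ring_nf
      _ ≤ _ := by gcongr
  refine hb.trans ?_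
  have : 0 ≤ c / L := by positivity
  gcongr

end scheme

/-! ### Pointwise bounds along curves in `L²` -/

section curves

variable {d : ℕ} {μ : P2 d}

/-- `L²` convergence yields an almost everywhere convergent subsequence, along which the pointwise
bound survives. -/
theorem isClosed_ae_norm_le (M : ℝ) :
    IsClosed {ξ : L2Space μ | ∀ᵐ y ∂μ.toMeasure, ‖ξ y‖ ≤ M} := by
  refine IsSeqClosed.isClosed fun u ξ hu hlim => ?_
  obtain ⟨ns, -, hns⟩ := (tendstoInMeasure_of_tendsto_Lp hlim).exists_seq_tendsto_ae
  filter_upwards [hns, ae_all_iff.2 fun n => hu (ns n)] with y hy hb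
  exact le_of_tendsto hy.norm (Eventually.of_forall hb)

theorem convex_ae_norm_le (M : ℝ) :
    Convex ℝ {ξ : L2Space μ | ∀ᵐ y ∂μ.toMeasure, ‖ξ y‖ ≤ M} := by
  intro ξ hξ η hη a b ha hb hab
  filter_upwards [hξ, hη, Lp.coeFn_add (a • ξ) (b • η), Lp.coeFn_smul a ξ, Lp.coeFn_smul b η]
    with y h1 h2 h3 h4 h5
  rw [h3, Pi.add_apply, h4, h5, Pi.smul_apply, Pi.smul_apply]
  calc _ ≤ a * ‖ξ y‖ + b * ‖η y‖ := by
        refine (norm_add_le _ _).trans ?_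
        rw [norm_smul, norm_smul, Real.norm_of_nonneg ha, Real.norm_of_nonneg hb]
    _ ≤ a * M + b * M := by gcongr
    _ = M := by rw [← add_mul, hab, one_mul]

/-- A pointwise bound on the velocity passes to increments: the difference quotient is the time
average of the velocity, and averages stay in a closed convex set. This avoids choosing
representatives jointly measurable in time and space. -/
theorem ae_norm_sub_le_of_hasDerivAt {γ γ' : ℝ → L2Space μ} (hγ : ∀ t, HasDerivAt γ (γ' t) t)
    (hc : Continuous γ') {M : ℝ} (hM : ∀ t, ∀ᵐ y ∂μ.toMeasure, ‖γ' t y‖ ≤ M) (t h : ℝ) :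
    ∀ᵐ y ∂μ.toMeasure, ‖(γ (t + h) - γ t) y‖ ≤ M * |h| := by
  rcases eq_or_ne h 0 with rfl | hh
  · simp only [add_zero, sub_self, abs_zero, mul_zero]
    filter_upwards [Lp.coeFn_zero (E d) 2 μ.toMeasure] with y hy
    rw [hy]
    simp
  have hmem := (convex_ae_norm_le (μ := μ) M).set_average_mem (isClosed_ae_norm_le M)
    (t := Set.uIoc t (t + h)) (f := γ') (μ := volume) (by simp [hh])
    (by simp) (Eventually.of_forall hM)
    (intervalIntegrable_iff.1 (hc.intervalIntegrable _ _))
  rw [interval_average_eq, intervalIntegral.integral_eq_sub_of_hasDerivAt (fun r _ => hγ r)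
    (hc.intervalIntegrable _ _), add_sub_cancel_left] at hmem
  filter_upwards [hmem, Lp.coeFn_smul h⁻¹ (γ (t + h) - γ t)] with y h1 h2
  rw [h2, Pi.smul_apply, norm_smul, norm_inv, Real.norm_eq_abs,
    inv_mul_le_iff₀ (abs_pos.2 hh)] at h1
  linarith

theorem norm_sub_sub_le_of_lipschitz_deriv {X : Type*} [NormedAddCommGroup X] [NormedSpace ℝ X]
    {γ γ' : ℝ → X} (hγ : ∀ t, HasDerivAt γ (γ' t) t) {C : ℝ}
    (hC : ∀ t r, ‖γ' t - γ' r‖ ≤ C * |t - r|) (t h : ℝ) :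
    ‖γ (t + h) - γ t - h • γ' t‖ ≤ C * h ^ 2 := by
  have := norm_sub_sub_le_of_lipschitz_fderiv (f := γ)
    (f' := fun t => ContinuousLinearMap.toSpanSingleton ℝ (γ' t)) (L := C)
    (fun t => (hγ t).hasFDerivAt) (fun x y => ?_) t (t + h)
  · simpa using this
  · refine ContinuousLinearMap.opNorm_le_bound _ ((norm_nonneg _).trans (hC x y)) fun z => ?_
    simp only [sub_apply, ContinuousLinearMap.toSpanSingleton_apply, ← smul_sub, norm_smul]
    rw [mul_comm]
    gcongr
    exact hC x y

/-! ### Second order expansion of the Lagrangian field -/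

variable {s : Prop} {φ : P2 d → ℝ} {h : P2 d → E d → ℝ} {G : P2 d → E d → E d}
  {K : P2 d → E d → E d → E d} {H A : P2 d → E d → E d → (E d →L[ℝ] E d)}

/-- The local term is bounded by a multiple of `|ζ|`, hence in `L²`. The nonlocal term is a bounded
continuous function of `ξ y`, since `ζ` is integrable. -/
theorem memLp_field_derivative
    (hA : AlmostLipschitz True (fun ρ x => A ρ x x))
    (hH : AlmostLipschitz True (fun ρ (z : E d × E d) => H ρ z.1 z.2)) (ξ ζ : L2Space μ) :
    MemLp (fun y => A (pushforward μ ξ) (ξ y) (ξ y) (ζ y) +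
      ∫ z, H (pushforward μ ξ) (ξ y) (ξ z) (ζ z) ∂μ.toMeasure) 2 μ.toMeasure := by
  obtain ⟨C, hC0, hC⟩ := hA.1
  obtain ⟨C', hC0', hC'⟩ := hH.1
  have hAc := hA.continuous (pushforward μ ξ)
  have hHc := hH.continuous (pushforward μ ξ)
  have hm := Lp.aestronglyMeasurable ξ
  refine .add ?_ ?_
  · refine (Lp.memLp ζ).of_le_mul (c := C)
      (isBoundedBilinearMap_apply.continuous.comp_aestronglyMeasurable
      ((hAc.comp_aestronglyMeasurable hm).prodMk (Lp.aestronglyMeasurable ζ)))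
      (Eventually.of_forall fun y => ?_)
    exact (ContinuousLinearMap.le_opNorm _ _).trans (by gcongr; exact hC _ _)
  · have hb : ∀ x z, ‖H (pushforward μ ξ) x (ξ z) (ζ z)‖ ≤ C' * ‖ζ z‖ := fun x z =>
      (ContinuousLinearMap.le_opNorm _ _).trans (by gcongr; exact hC' _ (x, ξ z))
    have hc : Continuous fun x => ∫ z, H (pushforward μ ξ) x (ξ z) (ζ z) ∂μ.toMeasure := by
      refine continuous_of_dominated (bound := fun z => C' * ‖ζ z‖) (fun x => ?_)
        (fun x => Eventually.of_forall (hb x)) ((integrable_L2 ζ).norm.const_mul C')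
        (Eventually.of_forall fun z => ?_)
      · exact (integrable_clm_apply (T := fun z => H (pushforward μ ξ) x z)
          (hHc.comp (Continuous.prodMk_right x)) (fun z => hC' _ (x, z)) ξ ζ).1
      · exact (hHc.comp (Continuous.prodMk_left (ξ z))).clm_apply continuous_const
    refine MemLp.of_bound (hc.comp_aestronglyMeasurable hm) (C' * ∫ z, ‖ζ z‖ ∂μ.toMeasure)
      (Eventually.of_forall fun y => ?_)
    rw [← integral_const_mul]
    exact norm_integral_le_of_norm_le ((integrable_L2 ζ).norm.const_mul C')
      (Eventually.of_forall fun z => hb _ z)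

theorem norm_clm_integral_le {C : ℝ} (hC0 : 0 ≤ C)
    (hC : ∀ ρ (z : E d × E d), ‖H ρ z.1 z.2‖ ≤ C) (ρ : P2 d) (x : E d) (ξ ζ : L2Space μ) :
    ‖∫ z, H ρ x (ξ z) (ζ z) ∂μ.toMeasure‖ ≤ C * ‖ζ‖ := by
  calc _ ≤ ∫ z, C * ‖ζ z‖ ∂μ.toMeasure :=
        norm_integral_le_of_norm_le ((integrable_L2 ζ).norm.const_mul C)
          (Eventually.of_forall fun z => (ContinuousLinearMap.le_opNorm _ _).trans
            (by gcongr; exact hC ρ (x, ξ z)))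
    _ ≤ C * ‖ζ‖ := by
        rw [integral_const_mul]
        gcongr
        exact integral_norm_le ζ

/-- Second order expansion of the Lagrangian field at `ξ` for uniformly small increments, with
directional derivative `∇ₓG ζ + ∫ H ζ`. -/
theorem IsRegularFunctional.exists_norm_lagrangianField_sub_le
    (r : IsRegularFunctional s φ h G K H A) (hs : s) :
    ∃ C ≥ 0, ∀ (μ : P2 d) (ξ ξ' ζ : L2Space μ) (e b : ℝ), 0 ≤ b →
      (∀ᵐ y ∂μ.toMeasure, ‖(ξ' - ξ) y‖ ≤ b) →
      ‖lagrangianField r.G_al ξ' - lagrangianField r.G_al ξ -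
        e • (memLp_field_derivative (r.smooth hs).1 (r.smooth hs).2 ξ ζ).toLp _‖ ≤
        C * (b ^ 2 + ‖ξ' - ξ - e • ζ‖) := by
  obtain ⟨hA, hH⟩ := r.smooth hs
  obtain ⟨CA, hCA0, hCA⟩ := hA.1
  obtain ⟨CH, hCH0, hCH⟩ := hH.1
  obtain ⟨LA, hLA0, hLA⟩ := hA.lipschitz
  obtain ⟨LH, hLH0, hLH⟩ := hH.lipschitz
  refine ⟨2 * LA + 2 * LH + (CH + CA), by positivity, fun μ ξ ξ' ζ e b hb0 hb => ?_⟩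
  set ρ := pushforward μ ξ with hρ
  set ρ' := pushforward μ ξ' with hρ'
  have hη : ‖ξ' - ξ‖ ≤ b := by
    have := norm_le_of_ae_le_add (F := ξ' - ξ) (η := 0) hb0 le_rfl (by simpa using hb)
    simpa using this
  have hW : wass 1 ρ' ρ ≤ b := (wass_one_pushforward_le _ _).trans hη
  -- The dependence on the measure is expanded with `x` frozen, by the same estimate that gave the
  -- gradient of the lift.
  have hT : ∀ x, ‖G ρ' x - G ρ x - ∫ z, H ρ x (ξ z) ((ξ' - ξ) z) ∂μ.toMeasure‖ ≤
      2 * LH * b ^ 2 := fun x => by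
    refine ((r.K_linear x).norm_sub_sub_integral_le (D := fun ρ => H ρ x)
      (fun ρ ν => r.K_al.integrable_right ρ ν x) (fun ρ x' => r.K_fderiv ρ x x')
      (fun ρ x' => hCH ρ (x, x')) hLH0 (fun σ σ' y y' => ?_) ξ ξ').trans (by gcongr)
    refine (hLH σ σ' (x, y) (x, y')).trans (le_of_eq ?_)
    rw [Prod.dist_eq, dist_self, max_eq_right dist_nonneg]
  have key := norm_le_of_ae_le_add (F := lagrangianField r.G_al ξ' - lagrangianField r.G_al ξ -
    e • (memLp_field_derivative hA hH ξ ζ).toLp _) (η := ξ' - ξ - e • ζ)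
    (c := (2 * LA + 2 * LH) * b ^ 2 + CH * ‖ξ' - ξ - e • ζ‖) (L := CA) (by positivity) hCA0 ?_
  · refine key.trans ?_
    have h1 : 0 ≤ (CH + CA) * b ^ 2 := by positivity
    have h2 : 0 ≤ (2 * LA + 2 * LH) * ‖ξ' - ξ - e • ζ‖ := by positivity
    nlinarith
  · filter_upwards [hb, coeFn_lagrangianField r.G_al ξ, coeFn_lagrangianField r.G_al ξ',
      (memLp_field_derivative hA hH ξ ζ).coeFn_toLp,
      Lp.coeFn_sub (lagrangianField r.G_al ξ' - lagrangianField r.G_al ξ)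
        (e • (memLp_field_derivative hA hH ξ ζ).toLp _),
      Lp.coeFn_sub (lagrangianField r.G_al ξ') (lagrangianField r.G_al ξ),
      Lp.coeFn_smul e ((memLp_field_derivative hA hH ξ ζ).toLp _),
      Lp.coeFn_sub ξ' ξ, Lp.coeFn_sub (ξ' - ξ) (e • ζ), Lp.coeFn_smul e ζ]
      with y hby g1 g2 g3 g4 g5 g6 g7 g8 g9
    rw [g7, Pi.sub_apply] at hby
    have eη : (ξ' - ξ - e • ζ) y = ξ' y - ξ y - e • ζ y := by
      rw [g8, Pi.sub_apply, g7, Pi.sub_apply, g9, Pi.smul_apply]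
    rw [g4, Pi.sub_apply, g5, Pi.sub_apply, g6, Pi.smul_apply, g1, g2, g3, eη]
    -- Five errors are added: the Taylor remainder in `x` at the measure `ρ'`, the change of measure
    -- in `A`, the replacement of the increment by `e ζ` under `A`, the remainder in the measure,
    -- and the replacement of the increment under `H`. The pointwise bound `b` makes the two
    -- quadratic remainders in `x` uniform.
    have t1 : ‖G ρ' (ξ' y) - G ρ' (ξ y) - A ρ' (ξ y) (ξ y) (ξ' y - ξ y)‖ ≤ LA * b ^ 2 := by
      refine (norm_sub_sub_le_of_lipschitz_fderiv (f' := fun x => A ρ' x x) (r.G_fderiv ρ')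
        (L := LA) (fun x x' => ?_) (ξ y) (ξ' y)).trans (by gcongr)
      have := hLA ρ' ρ' x x'
      rwa [wass_one_self, zero_add, dist_eq_norm] at this
    have t2 : ‖(A ρ' (ξ y) (ξ y) - A ρ (ξ y) (ξ y)) (ξ' y - ξ y)‖ ≤ LA * b ^ 2 := by
      have h1 := hLA ρ' ρ (ξ y) (ξ y)
      rw [dist_self, add_zero] at h1
      calc _ ≤ ‖A ρ' (ξ y) (ξ y) - A ρ (ξ y) (ξ y)‖ * ‖ξ' y - ξ y‖ :=
            ContinuousLinearMap.le_opNorm _ _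
        _ ≤ (LA * b) * b := by
            gcongr
            exact h1.trans (by gcongr)
        _ = _ := by ring
    have t3 : ‖A ρ (ξ y) (ξ y) (ξ' y - ξ y - e • ζ y)‖ ≤ CA * ‖ξ' y - ξ y - e • ζ y‖ :=
      (ContinuousLinearMap.le_opNorm _ _).trans (by gcongr; exact hCA _ _)
    have t4 := hT (ξ y)
    have t5 := norm_clm_integral_le hCH0 hCH ρ (ξ y) ξ (ξ' - ξ - e • ζ)
    have hHi : ∀ η : L2Space μ, Integrable (fun z => H ρ (ξ y) (ξ z) (η z)) μ.toMeasure := fun η =>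
      integrable_clm_apply (T := fun z => H ρ (ξ y) z)
        ((hH.continuous ρ).comp (Continuous.prodMk_right (ξ y))) (fun z => hCH ρ (ξ y, z)) ξ η
    have e5 : ∫ z, H ρ (ξ y) (ξ z) ((ξ' - ξ - e • ζ) z) ∂μ.toMeasure =
        (∫ z, H ρ (ξ y) (ξ z) ((ξ' - ξ) z) ∂μ.toMeasure) -
          e • ∫ z, H ρ (ξ y) (ξ z) (ζ z) ∂μ.toMeasure := by
      rw [← integral_smul, ← integral_sub (g := fun z => e • H ρ (ξ y) (ξ z) (ζ z)) (hHi _)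
        ((hHi ζ).smul e)]
      refine integral_congr_ae ?_
      filter_upwards [Lp.coeFn_sub (ξ' - ξ) (e • ζ), Lp.coeFn_smul e ζ] with z h1 h2
      rw [h1, Pi.sub_apply, h2, Pi.smul_apply, map_sub, map_smul]
    rw [e5] at t5
    simp only [sub_apply, map_sub, map_smul] at t1 t2 t3
    have split : ∀ a₁ a₂ a₃ a₄ a₅ : E d, ‖a₁ + a₂ + a₃ + a₄ + a₅‖ ≤
        ‖a₁‖ + ‖a₂‖ + ‖a₃‖ + ‖a₄‖ + ‖a₅‖ := fun a₁ a₂ a₃ a₄ a₅ =>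
      (norm_add_le _ _).trans (add_le_add ((norm_add_le _ _).trans (add_le_add
        norm_add₃_le le_rfl)) le_rfl)
    refine le_trans (le_of_eq ?_) ((split _ _ _ _ _).trans
      (add_le_add (add_le_add (add_le_add (add_le_add t1 t2) t3) t4) t5) |>.trans (le_of_eq ?_))
    · congr 1
      rw [smul_add]
      abel
    · ring

/-- The velocity of a Lagrangian curve is differentiable in time, with a quadratic remainder. -/
theorem IsRegularFunctional.exists_acceleration (r : IsRegularFunctional s φ h G K H A) (hs : s)
    {X : ℝ → L2Space μ} (hX : ∀ t, HasDerivAt X (-lagrangianField r.G_al (X t)) t) :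
    ∃ X₂ : ℝ → L2Space μ, ∃ C > 0, ∀ t e : ℝ, ‖-lagrangianField r.G_al (X (t + e)) -
      -lagrangianField r.G_al (X t) - e • X₂ t‖ ≤ C * e ^ 2 := by
  obtain ⟨C, hC0, hC⟩ := r.exists_norm_lagrangianField_sub_le hs
  obtain ⟨M, hM0, hM⟩ := exists_lagrangianField_ae_le r.G_al
  obtain ⟨L, hL0, hL⟩ := exists_lagrangianField_lipschitz r.G_al
  have hFc : Continuous (lagrangianField (μ := μ) r.G_al) :=
    (LipschitzWith.of_dist_le_mul (K := ⟨L, hL0⟩) (fun x x' => by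
      rw [dist_eq_norm, dist_eq_norm]; exact hL μ x x')).continuous
  have hXc : Continuous X := continuous_iff_continuousAt.2 fun t => (hX t).continuousAt
  -- The velocity is bounded by `M` almost everywhere, so the increments are small in `L^∞`, as the
  -- expansion of the field requires.
  have hae : ∀ t e : ℝ, ∀ᵐ y ∂μ.toMeasure, ‖(X (t + e) - X t) y‖ ≤ M * |e| :=
    ae_norm_sub_le_of_hasDerivAt hX (hFc.comp hXc).neg fun t => by
      filter_upwards [hM μ (X t), Lp.coeFn_neg (lagrangianField r.G_al (X t))] with y h1 h2
      rwa [h2, Pi.neg_apply, norm_neg]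
  have hXl : ∀ t e : ℝ, ‖X (t + e) - X t‖ ≤ M * |e| := fun t e => by
    have := norm_le_of_ae_le_add (F := X (t + e) - X t) (η := 0)
      (mul_nonneg hM0 (abs_nonneg e)) le_rfl (by simpa using hae t e)
    simpa using this
  have hrem : ∀ t e : ℝ, ‖X (t + e) - X t - e • -lagrangianField r.G_al (X t)‖ ≤
      L * M * e ^ 2 := by
    refine norm_sub_sub_le_of_lipschitz_deriv hX fun t q => ?_
    rw [neg_sub_neg, norm_sub_rev, mul_assoc]
    refine (hL μ _ _).trans ?_
    have := hXl q (t - q)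
    rw [add_sub_cancel] at this
    gcongr
  -- The acceleration is minus the directional derivative of the field along the velocity. The
  -- summand `1` only makes the constant positive.
  refine ⟨fun t => -(memLp_field_derivative (r.smooth hs).1 (r.smooth hs).2 (X t)
    (-lagrangianField r.G_al (X t))).toLp _, C * (M ^ 2 + L * M) + 1, by positivity,
    fun t e => ?_⟩
  have key := hC μ (X t) (X (t + e)) (-lagrangianField r.G_al (X t)) e (M * |e|) (by positivity)
    (hae t e)
  rw [smul_neg, ← neg_sub', ← neg_sub', norm_neg]
  refine key.trans ?_
  rw [mul_pow, sq_abs]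
  have h1 := mul_le_mul_of_nonneg_left (hrem t e) hC0
  nlinarith [sq_nonneg e]

/-! ### The continuity equation -/

/-- As `ψ` is only `C¹`, there is no quadratic remainder; uniform continuity of the compactly
supported derivative replaces it. -/
theorem hasFDerivAt_integral_comp_L2 {ψ : E d → ℝ} (hψ : ContDiff ℝ 1 ψ)
    (hc : HasCompactSupport ψ) (ξ : L2Space μ) :
    ∃ Γ : L2Space μ, Γ =ᵐ[μ.toMeasure] (fun y => gradient ψ (ξ y)) ∧
      HasFDerivAt (fun η : L2Space μ => ∫ y, ψ (η y) ∂μ.toMeasure) (innerSL ℝ Γ) ξ := by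
  have hdc : Continuous (fderiv ℝ ψ) := hψ.continuous_fderiv one_ne_zero
  have huc : UniformContinuous (fderiv ℝ ψ) :=
    (hc.fderiv ℝ).uniformContinuous_of_continuous hdc
  obtain ⟨M, hM⟩ := hdc.bounded_above_of_compact_support (hc.fderiv ℝ)
  have hM0 : 0 ≤ M := (norm_nonneg _).trans (hM 0)
  obtain ⟨M', hM'⟩ := hψ.continuous.bounded_above_of_compact_support hc
  have hgn : ∀ x, ‖gradient ψ x‖ ≤ M := fun x => by
    rw [gradient, LinearIsometryEquiv.norm_map]; exact hM x
  have hgc : Continuous (gradient ψ) :=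
    (InnerProductSpace.toDual ℝ (E d)).symm.continuous.comp hdc
  have hmem : MemLp (fun y => gradient ψ (ξ y)) 2 μ.toMeasure :=
    MemLp.of_bound (hgc.comp_aestronglyMeasurable (Lp.aestronglyMeasurable ξ)) M
      (Eventually.of_forall fun y => hgn _)
  have hd : ∀ x, HasFDerivAt ψ (fderiv ℝ ψ x) x := fun x =>
    (hψ.differentiable one_ne_zero x).hasFDerivAt
  have hi : ∀ η : L2Space μ, Integrable (fun y => ψ (η y)) μ.toMeasure := fun η =>
    Integrable.of_bound (hψ.continuous.comp_aestronglyMeasurable (Lp.aestronglyMeasurable η)) M'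
      (Eventually.of_forall fun y => hM' _)
  refine ⟨hmem.toLp _, hmem.coeFn_toLp, ?_⟩
  rw [hasFDerivAt_iff_isLittleO, Asymptotics.isLittleO_iff]
  intro c hc'
  rw [Metric.uniformContinuous_iff] at huc
  obtain ⟨δ, hδ, hδ'⟩ := huc (c / 2) (by positivity)
  -- Within distance `δ` the oscillation of the derivative is at most `c / 2`. Beyond it, the linear
  -- bound `2M ‖x' - x‖` is dominated by a quadratic one, which is `o(‖η - ξ‖)` after integration.
  have hpt : ∀ x x', ‖ψ x' - ψ x - fderiv ℝ ψ x (x' - x)‖ ≤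
      c / 2 * ‖x' - x‖ + 2 * M / δ * ‖x' - x‖ ^ 2 := by
    intro x x'
    by_cases hxx : ‖x' - x‖ < δ
    · have := (convex_ball x δ).norm_image_sub_le_of_norm_hasFDerivWithin_le'
        (f := ψ) (f' := fderiv ℝ ψ) (φ := fderiv ℝ ψ x) (C := c / 2) (x := x) (y := x')
        (fun z _ => (hd z).hasFDerivWithinAt)
        (fun z hz => by rw [← dist_eq_norm]; exact (hδ' hz).le)
        (Metric.mem_ball_self hδ) (by rwa [mem_ball_iff_norm])
      have : 0 ≤ 2 * M / δ * ‖x' - x‖ ^ 2 := by positivity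
      linarith
    · have := (convex_univ).norm_image_sub_le_of_norm_hasFDerivWithin_le'
        (f := ψ) (f' := fderiv ℝ ψ) (φ := fderiv ℝ ψ x) (C := M + M) (x := x) (y := x')
        (fun z _ => (hd z).hasFDerivWithinAt)
        (fun z _ => (norm_sub_le _ _).trans (add_le_add (hM z) (hM x))) trivial trivial
      have h2 : (2 * M / δ * δ) * ‖x' - x‖ ≤ (2 * M / δ * ‖x' - x‖) * ‖x' - x‖ := by
        gcongr
        exact not_lt.1 hxx
      rw [div_mul_cancel₀ _ hδ.ne'] at h2
      have : 0 ≤ c / 2 * ‖x' - x‖ := by positivity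
      linarith
  have hev : ∀ᶠ η in 𝓝 ξ, 2 * M / δ * ‖η - ξ‖ < c / 2 := by
    have hcont : Continuous fun η : L2Space μ => 2 * M / δ * ‖η - ξ‖ := by fun_prop
    refine hcont.continuousAt.eventually_lt continuousAt_const ?_
    simpa using hc'
  filter_upwards [hev] with η hη
  have e1 : innerSL ℝ (hmem.toLp _) (η - ξ) =
      ∫ y, fderiv ℝ ψ (ξ y) ((η - ξ) y) ∂μ.toMeasure := by
    rw [innerSL_apply_apply, L2.inner_def]
    refine integral_congr_ae ?_
    filter_upwards [hmem.coeFn_toLp] with y hy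
    rw [hy, gradient, InnerProductSpace.toDual_symm_apply]
  rw [e1, ← integral_sub (hi η) (hi ξ), ← integral_sub (f := fun y => ψ (η y) - ψ (ξ y))
    ((hi η).sub (hi ξ)) (integrable_clm_apply hdc hM ξ (η - ξ))]
  have ib : Integrable (fun y => c / 2 * ‖(η - ξ) y‖ + 2 * M / δ * ‖(η - ξ) y‖ ^ 2) μ.toMeasure :=
    ((integrable_L2 _).norm.const_mul _).add ((integrable_norm_sq _).const_mul _)
  refine (norm_integral_le_of_norm_le ib ?_).trans ?_
  · filter_upwards [Lp.coeFn_sub η ξ] with y hy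
    rw [hy, Pi.sub_apply]
    exact hpt _ _
  · rw [integral_add ((integrable_L2 _).norm.const_mul _) ((integrable_norm_sq _).const_mul _),
      integral_const_mul, integral_const_mul, integral_norm_sq]
    have h1 : c / 2 * ∫ y, ‖(η - ξ) y‖ ∂μ.toMeasure ≤ c / 2 * ‖η - ξ‖ := by
      gcongr
      exact integral_norm_le _
    have h2 : (2 * M / δ * ‖η - ξ‖) * ‖η - ξ‖ ≤ c / 2 * ‖η - ξ‖ := by gcongr
    nlinarith

theorem pushforward_idL2 (μ : P2 d) : pushforward μ (idL2 μ) = μ := by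
  have h1 : μ.toMeasure.map (idL2 μ) = μ.toMeasure :=
    (Measure.map_congr μ.memLp_id.coeFn_toLp).trans Measure.map_id
  cases μ
  simp only [pushforward, P2.mk.injEq]
  exact h1

theorem isWeakSolution_pushforward {G : P2 d → E d → E d} (hG : AlmostLipschitz s G)
    {X : ℝ → L2Space μ} (h0 : X 0 = idL2 μ)
    (hX : ∀ t, HasDerivAt X (-lagrangianField hG (X t)) t) :
    IsWeakSolution G μ (fun t => pushforward μ (X t)) where
  equation := fun ψ hψ hψc t _ => by
    have hm : ∀ t, ∫ x, ψ x ∂(pushforward μ (X t)).toMeasure = ∫ y, ψ (X t y) ∂μ.toMeasure :=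
      fun t => integral_map (Lp.aestronglyMeasurable (X t)).aemeasurable
        hψ.continuous.aestronglyMeasurable
    simp_rw [hm]
    obtain ⟨Γ, hΓ, hd⟩ := hasFDerivAt_integral_comp_L2 hψ hψc (X t)
    refine (hd.comp_hasDerivAt t (hX t)).congr_deriv ?_
    have hgc : Continuous (gradient ψ) :=
      (InnerProductSpace.toDual ℝ (E d)).symm.continuous.comp (hψ.continuous_fderiv one_ne_zero)
    rw [map_neg, innerSL_apply_apply, L2.inner_def, pushforward,
      integral_map (Lp.aestronglyMeasurable (X t)).aemeasurable
        (hgc.inner (hG.continuous _)).aestronglyMeasurable]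
    congr 1
    refine integral_congr_ae ?_
    filter_upwards [hΓ, coeFn_lagrangianField hG (X t)] with y h1 h2
    rw [h1, h2]
    rfl
  initial := by
    have hc : Tendsto (fun t => ‖X t - X 0‖) (𝓝[>] 0) (𝓝 0) := by
      have h1 : Tendsto (fun t => ‖X t - X 0‖) (𝓝 0) (𝓝 ‖X 0 - X 0‖) := ((hX 0).continuousAt.sub
        (continuousAt_const : ContinuousAt (fun _ : ℝ => X 0) 0)).norm.tendsto
      rw [sub_self, norm_zero] at h1
      exact h1.mono_left nhdsWithin_le_nhds
    refine squeeze_zero (fun t => wass_nonneg _ _ _) (fun t => ?_) hc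
    have := wass_two_pushforward_le (X t) (X 0)
    rwa [h0, pushforward_idL2, ← h0] at this

end curves

/-! ### Consequences for regular functionals -/

section regular

variable {s : Prop} {d : ℕ} {φ : P2 d → ℝ} {h : P2 d → E d → ℝ} {G : P2 d → E d → E d}
  {K : P2 d → E d → E d → E d} {H A : P2 d → E d → E d → (E d →L[ℝ] E d)} {μ : P2 d}

theorem IsRegularFunctional.velocityConditions (r : IsRegularFunctional s φ h G K H A) (hs : s)
    (hμ : IsAtomless μ) : VelocityConditions φ (normalizeVariation h) G
      (fun ρ x => normalizeVariation (fun ρ => K ρ x) ρ) H μ 1 where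
  atomless := hμ
  c2 := r.isWassersteinC2
  lift_c11 := r.isC1Holder_liftFun
  gradient_growth := fun S _ => by
    obtain ⟨C, hC0, hC⟩ := r.G_al.1
    exact ⟨C, fun ρ _ x => (hC ρ x).trans
      (le_mul_of_one_le_right hC0 (by linarith [norm_nonneg x]))⟩
  variation_growth := fun S _ => by
    obtain ⟨C, hC⟩ := r.h_al.normalizeVariation.quadratic_growth
    exact ⟨C, fun ρ _ x => hC ρ x⟩
  gradient_differentiable := fun ρ x => (r.G_fderiv ρ x).differentiableAt
  bounds := by
    obtain ⟨hA, hH⟩ := r.smooth hs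
    obtain ⟨C₁, h₁0, h₁⟩ := r.G_al.1
    obtain ⟨C₂, h₂0, h₂⟩ := hA.1
    obtain ⟨C₃, h₃0, h₃⟩ := hH.1
    obtain ⟨L₂, l₂0, l₂⟩ := hA.lipschitz
    obtain ⟨L₃, l₃0, l₃⟩ := hH.lipschitz
    have hfd : ∀ ρ x, fderiv ℝ (G ρ) x = A ρ x x := fun ρ x => (r.G_fderiv ρ x).fderiv
    obtain ⟨C, hC⟩ : ∃ C : ℝ≥0, (C : ℝ) = C₁ + C₂ + C₃ + L₂ + L₃ :=
      ⟨⟨C₁ + C₂ + C₃ + L₂ + L₃, by positivity⟩, rfl⟩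
    have hle : ∀ {Y Z : Type} [PseudoMetricSpace Y] [NormedAddCommGroup Z] {Φ : P2 d → Y → Z}
        {L : ℝ} (_ : L ≤ C)
        (_ : ∀ ρ ρ' y y', ‖Φ ρ y - Φ ρ' y'‖ ≤ L * (wass 1 ρ ρ' + dist y y')) (ρ : P2 d),
        LipschitzWith C (Φ ρ) := by
      intro Y Z _ _ Φ L hL hl ρ
      refine LipschitzWith.of_dist_le_mul fun y y' => ?_
      have := hl ρ ρ y y'
      rw [wass_one_self, zero_add] at this
      rw [dist_eq_norm]
      exact this.trans (by gcongr)
    refine ⟨C, fun ρ x y => ?_, fun ρ => ?_, fun ρ => ?_, fun ρ ν x y => ?_⟩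
    · rw [hfd, hC]
      linarith [h₁ ρ x, h₂ ρ x, h₃ ρ (x, y)]
    · simp only [hfd]
      exact holderWith_one.2 (hle (by linarith) l₂ ρ)
    · exact holderWith_one.2 (hle (by linarith) l₃ ρ)
    · rw [NNReal.coe_one, Real.rpow_one]
      have h1 := l₃ ρ ν (x, y) (x, y)
      rw [dist_self, add_zero] at h1
      refine h1.trans (mul_le_mul_of_nonneg_right ?_ (wass_nonneg _ _ _))
      linarith

theorem IsRegularFunctional.bddAbove_gradientQuotients (r : IsRegularFunctional s φ h G K H A) :
    BddAbove (gradientQuotients φ μ) := by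
  obtain ⟨L, hL0, hL⟩ := exists_lagrangianField_lipschitz r.G_al
  refine ⟨L, ?_⟩
  rintro _ ⟨ξ, η, hne, rfl⟩
  rw [r.gradient_liftFun, div_le_iff₀ (norm_sub_pos_iff.2 hne)]
  exact hL μ ξ η

/-- The real supremum of nonnegative numbers is nonnegative, also for an empty or unbounded set. -/
theorem gradientLip_nonneg (φ : P2 d → ℝ) (μ : P2 d) : 0 ≤ gradientLip φ μ :=
  Real.sSup_nonneg (by rintro _ ⟨ξ, η, -, rfl⟩; positivity)

theorem norm_gradient_sub_le_gradientLip (hb : BddAbove (gradientQuotients φ μ))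
    (ξ η : L2Space μ) : ‖gradient (liftFun φ μ) ξ - gradient (liftFun φ μ) η‖ ≤
      gradientLip φ μ * ‖ξ - η‖ := by
  rcases eq_or_ne ξ η with rfl | hne
  · simp
  · rw [← div_le_iff₀ (norm_sub_pos_iff.2 hne)]
    exact le_csSup hb ⟨ξ, η, hne, rfl⟩

/-- The solution is built on all of `ℝ`, so that two-sided derivatives are available at `t = 0`;
uniqueness concerns `[0,∞)` only. -/
theorem IsRegularFunctional.exists_lagrangianFlow (r : IsRegularFunctional s φ h G K H A) :
    ∃ X : ℝ → L2Space μ, X 0 = idL2 μ ∧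
      (∀ t, HasDerivAt X (-gradient (liftFun φ μ) (X t)) t) ∧
      ∀ Z : ℝ → L2Space μ, IsLagrangianFlow φ μ Z → Set.EqOn Z X (Set.Ici 0) := by
  obtain ⟨L, hL0, hL⟩ := exists_lagrangianField_lipschitz r.G_al
  obtain ⟨M, hM0, hM⟩ := exists_lagrangianField_bound r.G_al
  have hlip : LipschitzWith ⟨L, hL0⟩ (fun ξ : L2Space μ => -gradient (liftFun φ μ) ξ) :=
    LipschitzWith.of_dist_le_mul fun ξ η => by
      rw [dist_neg_neg, r.gradient_liftFun, dist_eq_norm, dist_eq_norm]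
      exact hL μ ξ η
  obtain ⟨X, h0, hX⟩ := exists_global_solution (M := ⟨M, hM0⟩) hlip
    (fun ξ => by rw [norm_neg, r.gradient_liftFun]; exact hM μ ξ) (idL2 μ)
  exact ⟨X, h0, hX, fun Z hZ => eqOn_Ici_of_hasDerivWithinAt hlip (hZ.1.trans h0.symm) hZ.2
    fun t _ => (hX t).hasDerivWithinAt⟩

theorem taylorConst_nonneg {X : Type*} [NormedAddCommGroup X] [NormedSpace ℝ X] (α T : ℝ)
    (u u' : ℝ → X) : 0 ≤ taylorConst α T u u' :=
  Real.sSup_nonneg (by rintro _ ⟨t, -, s, -, -, rfl⟩; positivity)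

theorem norm_sub_sub_le_taylorConst {X : Type*} [NormedAddCommGroup X] [NormedSpace ℝ X] {T : ℝ}
    {u u' : ℝ → X} (hb : BddAbove (taylorQuotients 1 T u u')) (t : ℝ) (ht : t ∈ Set.Icc 0 T)
    (s : ℝ) (hs : s ∈ Set.Icc 0 T) :
    ‖u t - u s - (t - s) • u' s‖ ≤ taylorConst 1 T u u' * |t - s| ^ 2 := by
  rcases eq_or_ne t s with rfl | hne
  · simp
  · have hpos : 0 < |t - s| ^ 2 := pow_pos (abs_pos.2 (sub_ne_zero.2 hne)) 2
    rw [← div_le_iff₀ hpos]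
    refine le_csSup hb ⟨t, ht, s, hs, hne, ?_⟩
    rw [one_add_one_eq_two, Real.rpow_two]

theorem bddAbove_taylorQuotients {X : Type*} [NormedAddCommGroup X] [NormedSpace ℝ X] (T : ℝ)
    {u u' : ℝ → X} {C : ℝ} (hC : ∀ t e : ℝ, ‖u (t + e) - u t - e • u' t‖ ≤ C * e ^ 2) :
    BddAbove (taylorQuotients 1 T u u') := by
  refine ⟨C, ?_⟩
  rintro _ ⟨t, -, s, -, hne, rfl⟩
  have hpos : 0 < |t - s| ^ 2 := pow_pos (abs_pos.2 (sub_ne_zero.2 hne)) 2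
  rw [one_add_one_eq_two, Real.rpow_two, div_le_iff₀ hpos, sq_abs]
  simpa using hC s (t - s)

theorem isC1HolderCurve_of_quadratic {X : Type*} [NormedAddCommGroup X] [NormedSpace ℝ X]
    (I : Set ℝ) {u u' : ℝ → X} {C : ℝ} (hC0 : 0 < C)
    (hC : ∀ t e : ℝ, ‖u (t + e) - u t - e • u' t‖ ≤ C * e ^ 2) : IsC1HolderCurve 1 I u u' := by
  refine ⟨fun t _ => ?_, C, hC0, fun t e _ _ => ?_⟩
  · have h1 : HasFDerivAt u (ContinuousLinearMap.toSpanSingleton ℝ (u' t)) t :=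
      hasFDerivAt_of_norm_sub_sub_le_sq (C := C) fun y => by
        have := hC t (y - t)
        rw [add_sub_cancel] at this
        simpa using this
    simpa using h1.hasDerivAt.hasDerivWithinAt
  · rw [one_add_one_eq_two, Real.rpow_two, sq_abs]
    exact hC t e

theorem IsRegularFunctional.existsUnique_trapezoidalScheme
    (r : IsRegularFunctional s φ h G K H A) {τ : ℝ} (hτ : 0 < τ) (hτL : τ * gradientLip φ μ ≤ 1)
    (Y₀ : L2Space μ) : ∃! Y : ℕ → L2Space μ, Y 0 = Y₀ ∧ IsTrapezoidalScheme φ μ τ Y := by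
  have hL := norm_gradient_sub_le_gradientLip (r.bddAbove_gradientQuotients (μ := μ))
  refine existsUnique_sequence (P := fun y ξ => IsMinOn (fun ξ : L2Space μ =>
    (1 / 2) * liftFun φ μ ξ + (1 / 2) * inner ℝ (gradient (liftFun φ μ) y) ξ +
      (1 / (2 * τ)) * ‖ξ - y‖ ^ 2) Set.univ ξ) (fun y => ?_) Y₀
  have hg : ∀ ξ, HasGradientAt (liftFun φ μ) (gradient (liftFun φ μ) ξ) ξ := fun ξ =>
    (r.hasGradientAt_liftFun ξ).differentiableAt.hasGradientAt
  simp_rw [isMinOn_trapezoidal_iff hg hL hτ hτL]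
  exact existsUnique_trapezoidal_step hL hτ hτL y

theorem IsRegularFunctional.trapezoidalScheme_error
    (r : IsRegularFunctional s φ h G K H A) {X X₂ : ℝ → L2Space μ}
    (h0 : X 0 = idL2 μ) (hX : ∀ t, HasDerivAt X (-gradient (liftFun φ μ) (X t)) t) {T : ℝ}
    (hb : BddAbove (taylorQuotients 1 T (fun t => -gradient (liftFun φ μ) (X t)) X₂))
    {τ : ℝ} (hτ : 0 < τ) (hτL : τ * gradientLip φ μ ≤ 1)
    {Y : ℕ → L2Space μ} (hY : IsTrapezoidalScheme φ μ τ Y) (n : ℕ) (hn : n * τ ≤ T) :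
    ‖X (n * τ) - Y n‖ ≤ Real.exp (2 * gradientLip φ μ * T) * ‖Y 0 - idL2 μ‖ +
      2 * (taylorConst 1 T (fun t => -gradient (liftFun φ μ) (X t)) X₂ / gradientLip φ μ) *
        (Real.exp (2 * gradientLip φ μ * T) - 1) * τ ^ 2 := by
  have hL := norm_gradient_sub_le_gradientLip (r.bddAbove_gradientQuotients (μ := μ))
  have hg : ∀ ξ, HasGradientAt (liftFun φ μ) (gradient (liftFun φ μ) ξ) ξ := fun ξ =>
    (r.hasGradientAt_liftFun ξ).differentiableAt.hasGradientAt
  rw [← h0]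
  exact trapezoidal_scheme_error hL (gradientLip_nonneg φ μ) hτ hτL
    (fun t _ => (hX t).hasDerivWithinAt) (norm_sub_sub_le_taylorConst hb)
    (taylorConst_nonneg _ _ _ _)
    (fun n => (isMinOn_trapezoidal_iff hg hL hτ hτL _ _).1 (hY n)) n hn

end regular

/-! ### The data of the model functional -/

section data

theorem HasCompactSupport.isCb2 {F : Type*} [NormedAddCommGroup F] [NormedSpace ℝ F] {w : F → ℝ}
    (hc : HasCompactSupport w) (hw : ContDiff ℝ 2 w) : IsCb2 w :=
  ⟨hw, fun k hk => (hw.continuous_iteratedFDeriv (m := k)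
    (by exact_mod_cast hk)).bounded_above_of_compact_support (hc.iteratedFDeriv k)⟩

theorem IsCb2.isC2Scalar {s : Prop} {f : ℝ → ℝ} (hf : IsCb2 f)
    (hs : s → HasLipschitzSecondDeriv f) : IsC2Scalar s f (deriv f) (deriv (deriv f)) := by
  have h1 : ContDiff ℝ 1 (deriv f) := by
    have : ContDiff ℝ (1 + 1) f := by
      rw [one_add_one_eq_two]
      exact hf.1
    exact (contDiff_succ_iff_deriv.1 this).2.2
  have e2 : iteratedDeriv 2 f = deriv (deriv f) := by
    rw [iteratedDeriv_succ, iteratedDeriv_one]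
  refine ⟨fun z => (hf.1.differentiable (by norm_num) z).hasDerivAt,
    fun z => (h1.differentiable (by norm_num) z).hasDerivAt, h1.continuous_deriv le_rfl, ?_, ?_, ?_⟩
  · obtain ⟨C, hC⟩ := hf.2 1 (by norm_num)
    refine ⟨C, fun z => ?_⟩
    have := hC z
    rwa [norm_iteratedFDeriv_eq_norm_iteratedDeriv, iteratedDeriv_one] at this
  · obtain ⟨C, hC⟩ := hf.2 2 le_rfl
    refine ⟨C, fun z => ?_⟩
    have := hC z
    rwa [norm_iteratedFDeriv_eq_norm_iteratedDeriv, e2] at this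
  · intro h
    obtain ⟨L, hL⟩ := hs h
    refine ⟨L, LipschitzWith.of_dist_le_mul fun x y => ?_⟩
    have h2 := hL.dist_le_mul x y
    rw [dist_eq_norm] at h2 ⊢
    refine le_trans ?_ h2
    -- The second derivative is the bilinear form evaluated at unit vectors, so its Lipschitz
    -- constant is inherited.
    rw [← e2, iteratedDeriv_eq_iteratedFDeriv, iteratedDeriv_eq_iteratedFDeriv,
      ← sub_apply]
    refine (ContinuousMultilinearMap.le_opNorm _ _).trans ?_
    simp

theorem isC2Scalar_mul_left (s : Prop) (c : ℝ) :
    IsC2Scalar s (fun z => c * z) (fun _ => c) (fun _ => 0) where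
  hasDeriv := fun z => by simpa using (hasDerivAt_id z).const_mul c
  hasDeriv₂ := fun z => hasDerivAt_const z c
  q_cont := continuous_const
  p_bdd := ⟨|c|, fun _ => le_rfl⟩
  q_bdd := ⟨0, fun _ => by simp⟩
  smooth := fun _ => ⟨0, LipschitzWith.const 0⟩

variable {d : ℕ} {w : E d → ℝ}

theorem gradient_eq_comp (w : E d → ℝ) :
    gradient w = (InnerProductSpace.toDual ℝ (E d)).symm ∘ fderiv ℝ w := rfl

theorem IsCb2.contDiff_gradient (hw : IsCb2 w) : ContDiff ℝ 1 (gradient w) := by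
  rw [gradient_eq_comp]
  exact (InnerProductSpace.toDual ℝ (E d)).symm.contDiff.comp
    (hw.1.fderiv_right (by norm_num))

/-- Identifies the derivative of the gradient with the second derivative as a bilinear form, which
transfers the bounds and Lipschitz constants assumed for the latter. -/
theorem fderiv_gradient_apply (hw : IsCb2 w) (x u v : E d) :
    inner ℝ (fderiv ℝ (gradient w) x u) v = iteratedFDeriv ℝ 2 w x ![u, v] := by
  have h1 : DifferentiableAt ℝ (fderiv ℝ w) x :=
    (hw.1.fderiv_right (m := 1) (by norm_num)).differentiable (by norm_num) x
  have h2 := (InnerProductSpace.toDual ℝ (E d)).symm.toContinuousLinearEquiv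
    |>.toContinuousLinearMap.hasFDerivAt.comp x h1.hasFDerivAt
  have h3 : fderiv ℝ (gradient w) x = _ := h2.fderiv
  rw [h3, iteratedFDeriv_two_apply]
  exact InnerProductSpace.toDual_symm_apply

theorem norm_le_of_inner_eq_multilinear {T : E d →L[ℝ] E d}
    {M : ContinuousMultilinearMap ℝ (fun _ : Fin 2 => E d) ℝ}
    (h : ∀ u v, inner ℝ (T u) v = M ![u, v]) : ‖T‖ ≤ ‖M‖ := by
  refine ContinuousLinearMap.opNorm_le_bound _ (norm_nonneg _) fun u => ?_
  rcases eq_or_lt_of_le (norm_nonneg (T u)) with h0 | hpos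
  · rw [← h0]
    positivity
  · have h1 : ‖T u‖ * ‖T u‖ ≤ ‖M‖ * ‖u‖ * ‖T u‖ := by
      rw [← real_inner_self_eq_norm_mul_norm, h]
      refine (le_abs_self _).trans ((M.le_opNorm _).trans (le_of_eq ?_))
      simp [Fin.prod_univ_two, mul_assoc]
    exact le_of_mul_le_mul_right h1 hpos

theorem norm_fderiv_gradient_le (hw : IsCb2 w) (x : E d) :
    ‖fderiv ℝ (gradient w) x‖ ≤ ‖iteratedFDeriv ℝ 2 w x‖ :=
  norm_le_of_inner_eq_multilinear (fderiv_gradient_apply hw x)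

theorem norm_fderiv_gradient_sub_le (hw : IsCb2 w) (x y : E d) :
    ‖fderiv ℝ (gradient w) x - fderiv ℝ (gradient w) y‖ ≤
      ‖iteratedFDeriv ℝ 2 w x - iteratedFDeriv ℝ 2 w y‖ :=
  norm_le_of_inner_eq_multilinear fun u v => by
    rw [sub_apply, sub_apply, inner_sub_left, fderiv_gradient_apply hw, fderiv_gradient_apply hw]

theorem IsCb2.hasGradientAt (hw : IsCb2 w) (x : E d) : HasGradientAt w (gradient w x) x :=
  (hw.1.differentiable (by norm_num) x).hasGradientAt

theorem IsCb2.hasFDerivAt_gradient (hw : IsCb2 w) (x : E d) :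
    HasFDerivAt (gradient w) (fderiv ℝ (gradient w) x) x :=
  (hw.contDiff_gradient.differentiable (by norm_num) x).hasFDerivAt

theorem IsCb2.continuous_fderiv_gradient (hw : IsCb2 w) : Continuous (fderiv ℝ (gradient w)) :=
  hw.contDiff_gradient.continuous_fderiv (by norm_num)

theorem IsCb2.exists_norm_fderiv_gradient_le (hw : IsCb2 w) :
    ∃ C, ∀ x, ‖fderiv ℝ (gradient w) x‖ ≤ C := by
  obtain ⟨C, hC⟩ := hw.2 2 le_rfl
  exact ⟨C, fun x => (norm_fderiv_gradient_le hw x).trans (hC x)⟩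

theorem almostLipschitz_of_norm_fderiv_le {Z : Type*} [NormedAddCommGroup Z] [NormedSpace ℝ Z]
    {F : E d → Z} (hF : Differentiable ℝ F) (hb : ∃ C, ∀ x, ‖F x‖ ≤ C)
    (hd : ∃ C, ∀ x, ‖fderiv ℝ F x‖ ≤ C) : AlmostLipschitz True (fun (_ : P2 d) x => F x) := by
  obtain ⟨C, hC⟩ := hb
  obtain ⟨L, hL⟩ := hd
  have hL0 : 0 ≤ L := (norm_nonneg _).trans (hL 0)
  refine .of_lipschitz (C := C) (L := L) (fun _ => hC) hL0 fun ρ ρ' x y => ?_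
  have h1 := (convex_univ).norm_image_sub_le_of_norm_hasFDerivWithin_le (f := F)
    (f' := fderiv ℝ F) (C := L) (x := y) (y := x)
    (fun z _ => (hF z).hasFDerivAt.hasFDerivWithinAt) (fun z _ => hL z) trivial trivial
  rw [← dist_eq_norm x y] at h1
  have : 0 ≤ L * wass 1 ρ ρ' := mul_nonneg hL0 (wass_nonneg _ _ _)
  linarith

theorem IsCb2.almostLipschitz (hw : IsCb2 w) : AlmostLipschitz True (fun (_ : P2 d) x => w x) := by
  refine almostLipschitz_of_norm_fderiv_le (hw.1.differentiable (by norm_num)) ?_ ?_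
  · obtain ⟨C, hC⟩ := hw.2 0 (by norm_num)
    exact ⟨C, fun x => by simpa using hC x⟩
  · obtain ⟨C, hC⟩ := hw.2 1 (by norm_num)
    exact ⟨C, fun x => by simpa only [norm_iteratedFDeriv_one] using hC x⟩

theorem IsCb2.almostLipschitz_gradient (hw : IsCb2 w) :
    AlmostLipschitz True (fun (_ : P2 d) x => gradient w x) := by
  refine almostLipschitz_of_norm_fderiv_le (hw.contDiff_gradient.differentiable (by norm_num)) ?_
    hw.exists_norm_fderiv_gradient_le
  obtain ⟨C, hC⟩ := hw.2 1 (by norm_num)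
  refine ⟨C, fun x => ?_⟩
  rw [gradient, LinearIsometryEquiv.norm_map]
  simpa only [norm_iteratedFDeriv_one] using hC x

theorem IsCb2.almostLipschitz_fderiv_gradient (hw : IsCb2 w) (hl : HasLipschitzSecondDeriv w) :
    AlmostLipschitz True (fun (_ : P2 d) x => fderiv ℝ (gradient w) x) := by
  obtain ⟨C, hC⟩ := hw.exists_norm_fderiv_gradient_le
  obtain ⟨L, hL⟩ := hl
  refine .of_lipschitz (C := C) (L := L) (fun _ => hC) L.2 fun ρ ρ' x y => ?_
  have h1 := (norm_fderiv_gradient_sub_le hw x y).trans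
    ((dist_eq_norm _ _).symm.le.trans (hL.dist_le_mul x y))
  have : 0 ≤ (L : ℝ) * wass 1 ρ ρ' := mul_nonneg L.2 (wass_nonneg _ _ _)
  linarith

theorem AlmostLipschitz.comp_sub {s : Prop} {Z : Type*} [NormedAddCommGroup Z] {F : E d → Z}
    (hF : AlmostLipschitz s (fun (_ : P2 d) x => F x)) :
    AlmostLipschitz s (fun (_ : P2 d) (z : E d × E d) => F (z.1 - z.2)) :=
  hF.reparam (fun z : E d × E d => z.1 - z.2)
    ⟨1 + 1, LipschitzWith.prod_fst.sub LipschitzWith.prod_snd⟩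

/-- Convolution with an even function. -/
theorem IsCb2.isC2Kernel_sub {s : Prop} (hw : IsCb2 w) (heven : ∀ x, w (-x) = w x)
    (hs : s → HasLipschitzSecondDeriv w) :
    IsC2Kernel s (fun x y => w (x - y)) (fun x y => gradient w (x - y))
      (fun x y => fderiv ℝ (gradient w) (x - y)) (fun x y => -fderiv ℝ (gradient w) (x - y)) where
  symm := fun x y => by rw [← heven, neg_sub]
  k_al := hw.almostLipschitz.comp_sub
  g_al := hw.almostLipschitz_gradient.comp_sub
  grad := fun x y => by
    have := (hw.hasGradientAt (x - y)).hasFDerivAt.comp x ((hasFDerivAt_id x).sub_const y)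
    exact this
  g_fst := fun x y => by
    have := (hw.hasFDerivAt_gradient (x - y)).comp x ((hasFDerivAt_id x).sub_const y)
    exact this
  g_snd := fun x y => by
    have := (hw.hasFDerivAt_gradient (x - y)).comp y ((hasFDerivAt_id y).const_sub x)
    refine this.congr_fderiv ?_
    ext v
    simp
  a_cont := hw.continuous_fderiv_gradient.comp (continuous_fst.sub continuous_snd)
  b_cont := (hw.continuous_fderiv_gradient.comp (continuous_fst.sub continuous_snd)).neg
  a_bdd := by
    obtain ⟨C, hC⟩ := hw.exists_norm_fderiv_gradient_le
    exact ⟨C, fun x y => hC _⟩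
  b_bdd := by
    obtain ⟨C, hC⟩ := hw.exists_norm_fderiv_gradient_le
    exact ⟨C, fun x y => by rw [norm_neg]; exact hC _⟩
  smooth := fun h => by
    have := (hw.almostLipschitz_fderiv_gradient (hs h)).comp_sub
    refine ⟨this, ?_⟩
    have h0 : AlmostLipschitz True (fun (_ : P2 d) (_ : E d × E d) => (0 : E d →L[ℝ] E d)) :=
      .of_lipschitz (C := 0) (L := 0) (by simp) le_rfl (by simp)
    simpa using h0.sub this

/-- The kernel that represents a potential energy. -/
theorem IsCb2.isC2Kernel_potential {s : Prop} (hw : IsCb2 w)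
    (hs : s → HasLipschitzSecondDeriv w) :
    IsC2Kernel s (fun x y => (1 / 2 : ℝ) • (w x + w y)) (fun x _ => (1 / 2 : ℝ) • gradient w x)
      (fun x _ => (1 / 2 : ℝ) • fderiv ℝ (gradient w) x) (fun _ _ => 0) := by
  have hhalf : ∀ {Z : Type} [NormedAddCommGroup Z] [NormedSpace ℝ Z] {Φ : P2 d → E d × E d → Z},
      AlmostLipschitz True Φ → AlmostLipschitz True (fun ρ z => (1 / 2 : ℝ) • Φ ρ z) :=
    fun h => .smul (.of_lipschitz (C := 1) (L := 0) (fun _ _ => by norm_num) le_rfl (by simp)) h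
  obtain ⟨C, hC⟩ := hw.exists_norm_fderiv_gradient_le
  exact
  { symm := fun x y => by rw [add_comm]
    k_al := hhalf ((hw.almostLipschitz.reparam _ exists_lipschitzWith_fst).add
      (hw.almostLipschitz.reparam _ exists_lipschitzWith_snd))
    g_al := hhalf (hw.almostLipschitz_gradient.reparam _ exists_lipschitzWith_fst)
    grad := fun x y => by
      have := ((hw.hasGradientAt x).hasFDerivAt.add_const (w y)).const_smul (1 / 2 : ℝ)
      rw [← map_smul] at this
      exact this
    g_fst := fun x y => (hw.hasFDerivAt_gradient x).const_smul (1 / 2 : ℝ)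
    g_snd := fun x y => hasFDerivAt_const _ _
    a_cont := (hw.continuous_fderiv_gradient.comp continuous_fst).const_smul (1 / 2 : ℝ)
    b_cont := continuous_const
    a_bdd := ⟨1 / 2 * C, fun x y => by
      rw [norm_smul, Real.norm_of_nonneg (by norm_num)]
      gcongr
      exact hC x⟩
    b_bdd := ⟨0, fun x y => by simp⟩
    smooth := fun h => ⟨hhalf ((hw.almostLipschitz_fderiv_gradient (hs h)).reparam _
      exists_lipschitzWith_fst), .of_lipschitz (C := 0) (L := 0) (by simp) le_rfl (by simp)⟩ }

/-- The potential is symmetrised to `(V x + V y) / 2` because kernels are required to be symmetric;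
its double integral is `∫ V dρ`. The potential and interaction terms have linear outer functions. -/
theorem modelU_eq (f : ℝ → ℝ) {V : E d → ℝ} (hV : IsCb2 V) (W χ : E d → ℝ) :
    modelU f V W χ = fun ρ => kernelFunctional f (fun x y => χ (x - y)) ρ +
      kernelFunctional (fun z => 1 * z) (fun x y => (1 / 2 : ℝ) • (V x + V y)) ρ +
      kernelFunctional (fun z => 1 / 2 * z) (fun x y => W (x - y)) ρ := by
  funext ρ
  have hi := hV.almostLipschitz.integrable ρ ρ
  rw [modelU, kernelFunctional, kernelFunctional, kernelFunctional]
  congr 1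
  · congr 1
    simp only [avg, one_mul]
    have e : ∀ x, ∫ y, (1 / 2 : ℝ) • (V x + V y) ∂ρ.toMeasure =
        (1 / 2 : ℝ) * (V x + ∫ y, V y ∂ρ.toMeasure) := fun x => by
      rw [integral_smul, integral_add (integrable_const _) hi]
      simp
    simp_rw [e]
    rw [integral_const_mul, integral_add hi (integrable_const _)]
    simp
    ring
  · rw [integral_const_mul]
    rfl

end data

/-! ### Regularity of the model functional and the main theorem -/

theorem exists_isRegularFunctional_modelU {d : ℕ} {f : ℝ → ℝ} {V W χ : E d → ℝ}
    (hf : IsCb2 f) (hV : IsCb2 V) (hW : IsCb2 W) (hχ : IsCb2 χ)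
    (hWeven : ∀ x, W (-x) = W x) (hχeven : ∀ x, χ (-x) = χ x) :
    ∃ (h : P2 d → E d → ℝ) (G : P2 d → E d → E d) (K : P2 d → E d → E d → E d)
      (H A : P2 d → E d → E d → (E d →L[ℝ] E d)),
      IsRegularFunctional (HasLipschitzSecondDeriv f ∧ HasLipschitzSecondDeriv V ∧
        HasLipschitzSecondDeriv W ∧ HasLipschitzSecondDeriv χ) (modelU f V W χ) h G K H A := by
  rw [modelU_eq f hV W χ]
  -- Taking for `s` the conjunction of the four Lipschitz conditions lets the same derivatives serve
  -- `C²` and `C^{2,1}` data.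
  exact ⟨_, _, _, _, _, ((isRegularFunctional_kernelFunctional
    (hf.isC2Scalar fun h => h.1) (hχ.isC2Kernel_sub hχeven fun h => h.2.2.2)).add
    (isRegularFunctional_kernelFunctional (isC2Scalar_mul_left _ 1)
    (hV.isC2Kernel_potential fun h => h.2.1))).add (isRegularFunctional_kernelFunctional
    (isC2Scalar_mul_left _ (1 / 2)) (hW.isC2Kernel_sub hWeven fun h => h.2.2.1))⟩

theorem mainTheorem8 (d : ℕ) (f : ℝ → ℝ) (V W χ : E d → ℝ)
    (hf : IsCb2 f) (hV : IsCb2 V) (hW : IsCb2 W)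
    (hχ : ContDiff ℝ 2 χ) (hχc : HasCompactSupport χ)
    (hWeven : ∀ x, W (-x) = W x) (hχeven : ∀ x, χ (-x) = χ x) :
    ∃ (h : P2 d → E d → ℝ) (G : P2 d → E d → E d) (K : P2 d → E d → E d → E d)
      (H : P2 d → E d → E d → (E d →L[ℝ] E d)),
      -- `U` is `C²` in the Wasserstein sense
      IsWassersteinC2 (modelU f V W χ) h G K H ∧
      -- the Wasserstein gradient is uniformly Lipschitz in `x`
      (∃ C : ℝ, ∀ ρ x y, ‖G ρ x - G ρ y‖ ≤ C * ‖x - y‖) ∧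
      -- the Wasserstein Hessian is bounded
      (∃ C : ℝ, ∀ ρ x x', ‖H ρ x x'‖ ≤ C) ∧
      -- the lift over an atomless measure is `C^{1,1}`
      (∀ μ : P2 d, IsAtomless μ → IsC1Holder 1 (liftFun (modelU f V W χ) μ)) ∧
      -- the case of `C^{2,1}` data
      (HasLipschitzSecondDeriv f → HasLipschitzSecondDeriv V → HasLipschitzSecondDeriv W →
        HasLipschitzSecondDeriv χ → ∀ ρ₀ : P2 d, IsAtomless ρ₀ →
        -- the sufficient conditions for a smooth velocity hold with `α = 1`
        VelocityConditions (modelU f V W χ) h G K H ρ₀ 1 ∧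
        -- the lift and the Lagrangian flow satisfy the assumptions for second order convergence
        IsC1HolderBdd 1 (liftFun (modelU f V W χ) ρ₀) ∧
        BddAbove (gradientQuotients (modelU f V W χ) ρ₀) ∧
        ∃ X : ℝ → L2Space ρ₀, IsLagrangianFlow (modelU f V W χ) ρ₀ X ∧
          (∀ Z : ℝ → L2Space ρ₀, IsLagrangianFlow (modelU f V W χ) ρ₀ Z →
            Set.EqOn Z X (Set.Ici 0)) ∧
          ∃ X₁ X₂ : ℝ → L2Space ρ₀,
            (∀ t, 0 ≤ t → HasDerivWithinAt X (X₁ t) (Set.Ici 0) t) ∧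
            IsC1HolderCurve 1 (Set.Ici 0) X₁ X₂ ∧
            (∀ T > 0, BddAbove (taylorQuotients 1 T X₁ X₂)) ∧
            -- the flow transports `ρ₀` along the Wasserstein gradient flow
            IsWeakSolution G ρ₀ (fun t => pushforward ρ₀ (X t)) ∧
            -- the trapezoidal scheme is well defined and converges at rate `O(τ²)`
            (∀ τ > 0, τ * gradientLip (modelU f V W χ) ρ₀ ≤ 1 →
              (∀ Y₀ : L2Space ρ₀, ∃! Y : ℕ → L2Space ρ₀,
                Y 0 = Y₀ ∧ IsTrapezoidalScheme (modelU f V W χ) ρ₀ τ Y) ∧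
              ∀ Y : ℕ → L2Space ρ₀, IsTrapezoidalScheme (modelU f V W χ) ρ₀ τ Y →
                ∀ T > 0, ∀ n : ℕ, n * τ ≤ T →
                  wass 2 (pushforward ρ₀ (X (n * τ))) (pushforward ρ₀ (Y n)) ≤ ‖X (n * τ) - Y n‖ ∧
                  ‖X (n * τ) - Y n‖ ≤
                    Real.exp (2 * gradientLip (modelU f V W χ) ρ₀ * T) * ‖Y 0 - idL2 ρ₀‖ +
                    2 * (taylorConst 1 T X₁ X₂ / gradientLip (modelU f V W χ) ρ₀) *
                      (Real.exp (2 * gradientLip (modelU f V W χ) ρ₀ * T) - 1) * τ ^ 2)) := by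
  obtain ⟨h, G, K, H, A, r⟩ := exists_isRegularFunctional_modelU hf hV hW (hχc.isCb2 hχ) hWeven
    hχeven
  -- Normalising subtracts terms that depend on the measure (and, for `K`, on `x`) but not on the
  -- variable of differentiation, so `G` and `H` are unchanged.
  refine ⟨normalizeVariation h, G, fun ρ x => normalizeVariation (fun ρ => K ρ x) ρ, H,
    r.isWassersteinC2, ?_, r.H_bdd, fun μ _ => r.isC1Holder_liftFun, ?_⟩
  · obtain ⟨L, -, hL⟩ := r.G_al.lipschitz
    refine ⟨L, fun ρ x y => ?_⟩
    have := hL ρ ρ x y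
    rwa [wass_one_self, zero_add, dist_eq_norm] at this
  · intro lf lV lW lχ ρ₀ hρ₀
    obtain ⟨X, h0, hX, hu⟩ := r.exists_lagrangianFlow (μ := ρ₀)
    have hX' := hX
    rw [r.gradient_liftFun] at hX'
    obtain ⟨X₂, C, hC0, hC⟩ := r.exists_acceleration ⟨lf, lV, lW, lχ⟩ hX'
    rw [← r.gradient_liftFun] at hC
    have hb := fun T => bddAbove_taylorQuotients T
      (u := fun t => -gradient (liftFun (modelU f V W χ) ρ₀) (X t)) hC
    refine ⟨r.velocityConditions ⟨lf, lV, lW, lχ⟩ hρ₀, r.isC1HolderBdd_liftFun,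
      r.bddAbove_gradientQuotients, X, ⟨h0, fun t _ => (hX t).hasDerivWithinAt⟩, hu,
      fun t => -gradient (liftFun (modelU f V W χ) ρ₀) (X t), X₂,
      fun t _ => (hX t).hasDerivWithinAt, isC1HolderCurve_of_quadratic _ hC0 hC, fun T _ => hb T,
      isWeakSolution_pushforward r.G_al h0 hX', fun τ hτ hτL =>
      ⟨r.existsUnique_trapezoidalScheme hτ hτL, fun Y hY T _ n hn =>
        ⟨wass_two_pushforward_le _ _, r.trapezoidalScheme_error h0 hX (hb T) hτ hτL hY n hn⟩⟩⟩
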